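/- Let $\mathcal H_0$ be a Hardy field (a subfield, closed under differentiation, of the ring of germs at $+\infty$ of real functions) that is closed under composition and under compositional inversion whenever these are defined (i.e. if $f,g\in\mathcal H_0$ and $g(x)\to+\infty$, then $f\circ g\in\mathcal H_0$ and $g$ has a compositional inverse in $\mathcal H_0$), and let $\mathcal H$ be the set of $a\in\mathcal H_0$ with $a(x)=O(x^d)$ for some $d>0$. Let $a_1,\dots,a_\ell\in\mathcal H$, let $(X,\mathcal X,\mu)$ be a probability space, and let $T_1,\dots,T_\ell$ be invertible, bimeasurable, measure-preserving transformations of it that commute $\mu$-almost everywhere. Write $Tf=f\circ T$ and $\mathbb E_{n\in[N]}=\frac1N\sum_{n=1}^N$. A sequence $(S_n)_n$ of transformations of a probability space $(Y,\mathcal Y,\nu)$ is called ergodic if $\mathbb E_{n\in[N]}S_nf\to\int f\,d\nu$ in $L^2(\nu)$ as $N\to\infty$ for every $f\in L^\infty(\nu)$. Suppose that $a_1,\dots,a_\ell$ are jointly ergodic for $(X,\mathcal X,\mu,T_1,\dots,T_\ell)$, that is, $$\lim_{N\to\infty}\Bigl\|\mathbb E_{n\in[N]}\prod_{j=1}^{\ell}T_j^{\lfloor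 a_j(n)\rfloor}f_j-\prod_{j=1}^\ell\int f_j\,d\mu\Bigr\|_{L^2(\mu)}=0\qquad\text{for all } f_1,\dots,f_\ell\in L^\infty(\mu).$$ Then: (i) (Product ergodicity condition) The sequence $\bigl(T_1^{\lfloor a_1(n)\rfloor}\times\cdots\times T_\ell^{\lfloor a_\ell(n)\rfloor}\bigr)_n$ is ergodic on $(X^\ell,\mathcal X^{\otimes\ell},\mu^{\ell})$. (ii) Suppose additionally that for all $i\ne j$ and all $c_i,c_j\in\mathbb R$, the function $b=c_ia_i-c_ja_j$ is either an almost rational polynomial (there is $p\in\mathbb Q[x]$ such that $b(x)-p(x)$ converges to a real number as $x\to\infty$), or stays logarithmically away from $\mathbb Q[x]$ ($\log x=o(b(x)-p(x))$ as $x\to\infty$ for every $p\in\mathbb Q[x]$). Then the difference ergodicity condition holds: for all distinct $i,j$, the sequence $\bigl(T_i^{\lfloor a_i(n)\rfloor}T_j^{-\lfloor a_j(n)\rfloor}\bigr)_n$ is ergodic on $(X,\mathcal X,\mu)$. -/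

import Mathlib

open Filter Topology MeasureTheory Asymptotics
open scoped ENNReal

/-- `H` is a Hardy field: a subring of the ring of germs at `+∞` of real functions in which every
nonzero element is invertible, and which is closed under differentiation (in particular every
element of `H` is differentiable on some half-line). -/
structure IsHardyField (H : Subring (Germ (atTop : Filter ℝ) ℝ)) : Prop where
  exists_inv : ∀ u ∈ H, u ≠ 0 → ∃ v ∈ H, u * v = 1
  exists_deriv : ∀ f : ℝ → ℝ, (f : Germ (atTop : Filter ℝ) ℝ) ∈ H →
    ∃ g : ℝ → ℝ, (g : Germ (atTop : Filter ℝ) ℝ) ∈ H ∧ ∀ᶠ x in atTop, HasDerivAt f (g x) x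

/-- `H` is closed under composition, when defined: the germ at `+∞` of `f ∘ g` makes sense for
germs `f` and `g` when `g` tends to `+∞`. -/
def ClosedUnderComp (H : Subring (Germ (atTop : Filter ℝ) ℝ)) : Prop :=
  ∀ f g : ℝ → ℝ, (f : Germ (atTop : Filter ℝ) ℝ) ∈ H → (g : Germ (atTop : Filter ℝ) ℝ) ∈ H →
    Tendsto g atTop atTop → ((f ∘ g : ℝ → ℝ) : Germ (atTop : Filter ℝ) ℝ) ∈ H

/-- `H` is closed under compositional inversion, when defined: a germ in `H` tending to `+∞` has
a compositional inverse (again tending to `+∞`) in `H`. -/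
def ClosedUnderCompInv (H : Subring (Germ (atTop : Filter ℝ) ℝ)) : Prop :=
  ∀ f : ℝ → ℝ, (f : Germ (atTop : Filter ℝ) ℝ) ∈ H → Tendsto f atTop atTop →
    ∃ g : ℝ → ℝ, (g : Germ (atTop : Filter ℝ) ℝ) ∈ H ∧ Tendsto g atTop atTop ∧
      (∀ᶠ x in atTop, f (g x) = x) ∧ ∀ᶠ x in atTop, g (f x) = x

/-- `a` is a Hardy function of polynomial growth (with respect to the Hardy field `H`): its germ
is in `H`, and `a(x) ≪ x ^ d` for some real `d > 0`. -/
def IsHardyPolyGrowth (H : Subring (Germ (atTop : Filter ℝ) ℝ)) (a : ℝ → ℝ) : Prop :=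
  (a : Germ (atTop : Filter ℝ) ℝ) ∈ H ∧ ∃ d : ℝ, 0 < d ∧ a =O[atTop] fun x : ℝ => x ^ d

/-- `a` is an almost rational polynomial: `a - p` converges (to a real number) at `+∞`
for some `p ∈ ℚ[x]`. -/
def IsAlmostRationalPolynomial (a : ℝ → ℝ) : Prop :=
  ∃ p : Polynomial ℚ, ∃ L : ℝ, Tendsto (fun x => a x - Polynomial.aeval x p) atTop (𝓝 L)

/-- `a` stays logarithmically away from `ℚ[x]`: `a - p ≻ log` for all `p ∈ ℚ[x]`. -/
def StaysLogAwayFromRatPoly (a : ℝ → ℝ) : Prop :=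
  ∀ p : Polynomial ℚ, (fun x => Real.log x) =o[atTop] fun x => a x - Polynomial.aeval x p

/-- The integer power `T ^ k` of an invertible measurable transformation, as a map. -/
def iterZ {X : Type*} [MeasurableSpace X] (T : X ≃ᵐ X) (k : ℤ) : X → X :=
  ⇑((T.toEquiv : Equiv.Perm X) ^ k)

/-- A sequence of transformations `(S n)` is ergodic on `(Y, ν)`: for every `f ∈ L^∞(ν)`, the
averages of `f ∘ S n` over `1 ≤ n ≤ N` converge to `∫ f dν` in `L²(ν)`. -/
def ErgodicSeq {Y : Type*} [MeasurableSpace Y] (ν : Measure Y) (S : ℕ → Y → Y) : Prop :=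
  ∀ f : Y → ℂ, MemLp f ∞ ν →
    Tendsto (fun N : ℕ =>
      eLpNorm (fun y => (1 / (N : ℂ)) * (∑ n ∈ Finset.Icc 1 N, f (S n y)) - ∫ z, f z ∂ν) 2 ν)
      atTop (𝓝 0)

section Conditions

variable {X : Type*} [MeasurableSpace X]

/-- `b 1, …, b ℓ : ℕ → ℝ` are jointly ergodic for `(X, μ, T 1, …, T ℓ)`. -/
def JointlyErgodic {ℓ : ℕ} (μ : Measure X) (T : Fin ℓ → X ≃ᵐ X) (b : Fin ℓ → ℕ → ℝ) : Prop :=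
  ∀ f : Fin ℓ → X → ℂ, (∀ j, MemLp (f j) ∞ μ) →
    Tendsto (fun N : ℕ =>
      eLpNorm (fun x => (1 / (N : ℂ)) * (∑ n ∈ Finset.Icc 1 N, ∏ j, f j (iterZ (T j) ⌊b j n⌋ x))
        - ∏ j, ∫ z, f j z ∂μ) 2 μ)
      atTop (𝓝 0)

/-- The difference ergodicity condition: `T i ^ ⌊b i n⌋ T j ^ (-⌊b j n⌋)` is ergodic on `(X, μ)`
for all distinct `i`, `j`. -/
def DifferenceErgodic {ℓ : ℕ} (μ : Measure X) (T : Fin ℓ → X ≃ᵐ X) (b : Fin ℓ → ℕ → ℝ) : Prop :=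
  ∀ i j : Fin ℓ, i ≠ j →
    ErgodicSeq μ fun n => iterZ (T i) ⌊b i n⌋ ∘ iterZ (T j) (-⌊b j n⌋)

/-- The product ergodicity condition: `T 1 ^ ⌊b 1 n⌋ × ⋯ × T ℓ ^ ⌊b ℓ n⌋` is ergodic on the
product space `(X ^ ℓ, μ ^ ℓ)`. -/
def ProductErgodic {ℓ : ℕ} (μ : Measure X) (T : Fin ℓ → X ≃ᵐ X) (b : Fin ℓ → ℕ → ℝ) : Prop :=
  ErgodicSeq (Measure.pi fun _ : Fin ℓ => μ) fun n x j => iterZ (T j) ⌊b j n⌋ (x j)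

end Conditions

/-! Both parts are reduced by spectral theory to Cesàro means of products of characters evaluated at
integer parts. Joint ergodicity itself controls these means at eigenvalues. Exponential sum
estimates for Hardy functions control them everywhere else.

Product ergodicity. Setting all functions but one equal to 1 shows that each sequence `T j ^ ⌊a j
n⌋` is ergodic, hence `T j` is ergodic and its eigenfunctions may be normalised to modulus one. By a
π-system argument it suffices to average a tensor product of indicators `f j`. If `σ j` is the
spectral measure of `f j` under `T j`, the squared norm of the average is the integral over the
product of the `σ j` of the squared modulus of the Cesàro mean of `∏ j, fourier ⌊a j n⌋ (z j)`. At a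
point all of whose coordinates are atoms, every coordinate is an eigenvalue, and joint ergodicity
tested on eigenfunctions makes the mean converge to 0, except at the origin, where it is 1 for `N ≥
1` (`JointlyErgodic.tendsto_cesaro_fourier`). The limit is therefore the mass of the origin, which
is the squared modulus of the product of the integrals. The points with some non-atomic coordinate
contribute nothing in the limit (`tendsto_correlations_off_atoms`), for one of two reasons. If `x *
a'(x)` is unbounded, then all but countably many real multiples of `a` have vanishing exponential
means. A positive kernel then replaces the difference of integer parts by a continuous function of
`a n - a m`, and an atomless measure does not see the countably many exceptions. If `x * a'(x)`
converges, then `⌊a n⌋` is constant on blocks of length comparable to their position, and ergodicity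
leaves no spectral mass outside 0.

Difference ergodicity. The growth hypothesis on `c * a i - d * a j` makes the Cesàro means of `e(s
⌊a i n⌋ + t ⌊a j n⌋)` converge for all real `s` and `t`
(`IsHardyRing.exists_tendsto_cesaro_unitExp_floor`). By a spectral measure on the two-dimensional
torus, the averages of the commuting unitaries converge in norm to some vector
(`exists_tendsto_average_of_commute`). Its inner products with indicators are computed by moving the
power of `T j` to the other side, where joint ergodicity gives the product of the integrals. Hence
the limit is the constant `∫ f`.

Exponential sums. The Hardy field is enlarged to a ring of functions containing real constants and
the identity and closed under integer shifts (`exists_isHardyRing`). There the Kusmin–Landau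
inequality handles functions between the logarithm and linear growth, van der Corput's inequality
the next range, and repeated differencing the rest. Rational leading terms are split off as periodic
factors (`IsHardyRing.tendsto_cesaro_periodic_mul_unitExp`). -/

/-! ### Hardy rings -/

/-- A class of real functions, considered near `+∞`, closed under differentiation and negation,
and all of whose elements are eventually zero or eventually nonzero. -/
structure IsHardyClass (R : Set (ℝ → ℝ)) : Prop where
  neg : ∀ {f : ℝ → ℝ}, f ∈ R → (fun x => - f x) ∈ R
  deriv : ∀ {f : ℝ → ℝ}, f ∈ R → deriv f ∈ R
  diff : ∀ {f : ℝ → ℝ}, f ∈ R → ∀ᶠ x in atTop, DifferentiableAt ℝ f x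
  zero_or_ne : ∀ {f : ℝ → ℝ}, f ∈ R → (∀ᶠ x in atTop, f x = 0) ∨ ∀ᶠ x in atTop, f x ≠ 0

/-- A ring of real functions, considered near `+∞`, which contains the real constants and the
identity, is closed under differentiation and integer translations, and all of whose elements
are eventually zero or eventually nonzero. -/
structure IsHardyRing (R : Set (ℝ → ℝ)) : Prop extends IsHardyClass R where
  congr : ∀ {f g : ℝ → ℝ}, f ∈ R → f =ᶠ[atTop] g → g ∈ R
  add : ∀ {f g : ℝ → ℝ}, f ∈ R → g ∈ R → (fun x => f x + g x) ∈ R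
  mul : ∀ {f g : ℝ → ℝ}, f ∈ R → g ∈ R → (fun x => f x * g x) ∈ R
  const : ∀ c : ℝ, (fun _ => c) ∈ R
  id : (fun x => x) ∈ R
  shift : ∀ {f : ℝ → ℝ}, f ∈ R → ∀ h : ℕ, (fun x => f (x + h)) ∈ R

lemma deriv_congr_atTop {f g : ℝ → ℝ} (h : f =ᶠ[atTop] g) : deriv f =ᶠ[atTop] deriv g := by
  obtain ⟨X, hX⟩ := eventually_atTop.1 h
  filter_upwards [eventually_gt_atTop X] with x hx
  apply EventuallyEq.deriv_eq
  filter_upwards [lt_mem_nhds hx] with y hy using hX y hy.le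

/-- A function which is eventually differentiable and eventually nonzero has a definite sign. -/
lemma eventually_pos_or_neg_of_ne {f : ℝ → ℝ} (hd : ∀ᶠ x in atTop, DifferentiableAt ℝ f x)
    (h0 : ∀ᶠ x in atTop, f x ≠ 0) :
    (∀ᶠ x in atTop, 0 < f x) ∨ ∀ᶠ x in atTop, f x < 0 := by
  obtain ⟨X, hX⟩ := eventually_atTop.1 (hd.and h0)
  have hc : ContinuousOn f (Set.Ici X) := fun x hx => (hX x hx).1.continuousAt.continuousWithinAt
  have key : ∀ x y, X ≤ x → X ≤ y → 0 < f x → 0 < f y := by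
    intro x y hx hy hfx
    by_contra hfy
    have : (0 : ℝ) ∈ f '' Set.Ici X :=
      (isPreconnected_Ici.image f hc).ordConnected.out ⟨y, hy, rfl⟩ ⟨x, hx, rfl⟩
        ⟨not_lt.1 hfy, hfx.le⟩
    obtain ⟨z, hz, hz0⟩ := this
    exact (hX z hz).2 hz0
  rcases lt_or_gt_of_ne (hX X le_rfl).2 with h | h
  · right
    filter_upwards [eventually_ge_atTop X] with y hy
    rcases lt_or_gt_of_ne (hX y hy).2 with h' | h'
    · exact h'
    · exact absurd (key y X hy le_rfl h') (not_lt.2 h.le)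
  · left
    filter_upwards [eventually_ge_atTop X] with y hy using key X y le_rfl hy h

lemma eventually_monotoneOn_of_deriv_nonneg {f : ℝ → ℝ}
    (hd : ∀ᶠ x in atTop, DifferentiableAt ℝ f x) (h : ∀ᶠ x in atTop, 0 ≤ deriv f x) :
    ∃ X, MonotoneOn f (Set.Ici X) := by
  obtain ⟨X, hX⟩ := eventually_atTop.1 (hd.and h)
  refine ⟨X, monotoneOn_of_deriv_nonneg (convex_Ici X)
    (fun x hx => (hX x hx).1.continuousAt.continuousWithinAt) ?_ ?_⟩
  · intro x hx
    exact (hX x (interior_subset hx)).1.differentiableWithinAt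
  · intro x hx
    exact (hX x (interior_subset hx)).2

lemma eventually_strictMonoOn_of_deriv_pos {f : ℝ → ℝ}
    (hd : ∀ᶠ x in atTop, DifferentiableAt ℝ f x) (h : ∀ᶠ x in atTop, 0 < deriv f x) :
    ∃ X, StrictMonoOn f (Set.Ici X) := by
  obtain ⟨X, hX⟩ := eventually_atTop.1 (hd.and h)
  refine ⟨X, strictMonoOn_of_deriv_pos (convex_Ici X)
    (fun x hx => (hX x hx).1.continuousAt.continuousWithinAt) ?_⟩
  intro x hx
  exact (hX x (interior_subset hx)).2

lemma eventually_const_of_deriv_eq_zero {f : ℝ → ℝ}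
    (hd : ∀ᶠ x in atTop, DifferentiableAt ℝ f x) (h : ∀ᶠ x in atTop, deriv f x = 0) :
    ∃ c, ∀ᶠ x in atTop, f x = c := by
  obtain ⟨X, hX⟩ := eventually_monotoneOn_of_deriv_nonneg hd (h.mono fun x hx => hx.ge)
  obtain ⟨Y, hY⟩ := eventually_monotoneOn_of_deriv_nonneg (f := fun x => - f x)
    (hd.mono fun x hx => hx.neg) (h.mono fun x hx => by rw [deriv.fun_neg, hx, neg_zero])
  refine ⟨f (max X Y), ?_⟩
  filter_upwards [eventually_ge_atTop (max X Y)] with x hx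
  apply le_antisymm
  · have := hY (Set.mem_Ici.2 (le_max_right X Y)) (Set.mem_Ici.2 ((le_max_right X Y).trans hx)) hx
    simpa using this
  · exact hX (Set.mem_Ici.2 (le_max_left X Y)) (Set.mem_Ici.2 ((le_max_left X Y).trans hx)) hx

/-- Mean value theorem on a half-line. -/
lemma eventually_exists_deriv_eq_slope {f : ℝ → ℝ}
    (hd : ∀ᶠ x in atTop, DifferentiableAt ℝ f x) :
    ∀ᶠ x in atTop, ∀ h : ℝ, 0 < h → ∃ y, x < y ∧ y < x + h ∧ f (x + h) - f x = h * deriv f y := by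
  obtain ⟨X, hX⟩ := eventually_atTop.1 hd
  filter_upwards [eventually_ge_atTop X] with x hx h hh
  obtain ⟨y, hy, hy'⟩ := exists_deriv_eq_slope f (show x < x + h by linarith)
    (fun z hz => (hX z (hx.trans hz.1)).continuousAt.continuousWithinAt)
    (fun z hz => (hX z (hx.trans hz.1.le)).differentiableWithinAt)
  refine ⟨y, hy.1, hy.2, ?_⟩
  rw [hy', add_sub_cancel_left, mul_div_cancel₀ _ hh.ne']

namespace IsHardyClass

variable {R : Set (ℝ → ℝ)} (hR : IsHardyClass R) {f g : ℝ → ℝ}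
include hR

lemma sign (hf : f ∈ R) :
    (∀ᶠ x in atTop, f x = 0) ∨ (∀ᶠ x in atTop, 0 < f x) ∨ ∀ᶠ x in atTop, f x < 0 := by
  rcases hR.zero_or_ne hf with h | h
  · exact Or.inl h
  · exact Or.inr (eventually_pos_or_neg_of_ne (hR.diff hf) h)

/-- The derivative again lies in the class, so it has an eventual sign and the function is
eventually monotone. -/
lemma tendsto_trichotomy (hf : f ∈ R) :
    (∃ l, Tendsto f atTop (𝓝 l)) ∨ Tendsto f atTop atTop ∨ Tendsto f atTop atBot := by
  have key : ∀ f : ℝ → ℝ, f ∈ R → (∀ᶠ x in atTop, 0 ≤ _root_.deriv f x) →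
      (∃ l, Tendsto f atTop (𝓝 l)) ∨ Tendsto f atTop atTop := by
    intro f hf h
    obtain ⟨X, hX⟩ := eventually_monotoneOn_of_deriv_nonneg (hR.diff hf) h
    have hm : Monotone fun x => f (max x X) := fun x y hxy =>
      hX (le_max_right x X) (le_max_right y X) (max_le_max_right X hxy)
    have he : (fun x => f (max x X)) =ᶠ[atTop] f := by
      filter_upwards [eventually_ge_atTop X] with x hx
      rw [max_eq_left hx]
    rcases tendsto_atTop_of_monotone hm with h | ⟨l, h⟩
    · exact Or.inr (h.congr' he)
    · exact Or.inl ⟨l, h.congr' he⟩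
  have hpos : (∀ᶠ x in atTop, 0 ≤ _root_.deriv f x) ∨ ∀ᶠ x in atTop, _root_.deriv f x ≤ 0 := by
    rcases hR.sign (hR.deriv hf) with h | h | h
    · exact Or.inl (h.mono fun x hx => hx.ge)
    · exact Or.inl (h.mono fun x hx => hx.le)
    · exact Or.inr (h.mono fun x hx => hx.le)
  rcases hpos with h | h
  · rcases key f hf h with h | h
    · exact Or.inl h
    · exact Or.inr (Or.inl h)
  · rcases key (fun x => - f x) (hR.neg hf)
      (h.mono fun x hx => by rw [deriv.fun_neg]; linarith) with ⟨l, h⟩ | h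
    · exact Or.inl ⟨-l, by simpa using h.neg⟩
    · exact Or.inr (Or.inr (by simpa [Function.comp_def] using tendsto_neg_atTop_atBot.comp h))

/-- Either `f` converges or `|f|` tends to infinity. -/
lemma tendsto_or_abs_atTop (hf : f ∈ R) :
    (∃ l, Tendsto f atTop (𝓝 l)) ∨ Tendsto (fun x => |f x|) atTop atTop := by
  rcases hR.tendsto_trichotomy hf with h | h | h
  · exact Or.inl h
  · exact Or.inr (tendsto_abs_atTop_atTop.comp h)
  · exact Or.inr (tendsto_abs_atBot_atTop.comp h)

/-- Unit increments of a convergent function tend to 0, and by the mean value theorem each is a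
value of the derivative. The derivative either converges or has modulus tending to infinity, so its
only possible behaviour is convergence to 0. -/
lemma tendsto_deriv_of_tendsto (hf : f ∈ R) {l : ℝ} (h : Tendsto f atTop (𝓝 l)) :
    Tendsto (_root_.deriv f) atTop (𝓝 0) := by
  have hd : Tendsto (fun x => f (x + 1) - f x) atTop (𝓝 0) := by
    simpa using (h.comp (tendsto_atTop_add_const_right _ 1 tendsto_id)).sub h
  have hmv := eventually_exists_deriv_eq_slope (hR.diff hf)
  rcases hR.tendsto_or_abs_atTop (hR.deriv hf) with ⟨m, hm⟩ | hm
  · suffices m = 0 by rwa [this] at hm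
    by_contra hne
    obtain ⟨X, hX⟩ := eventually_atTop.1
      (hm.abs.eventually (lt_mem_nhds (show |m| / 2 < |m| by have := abs_pos.2 hne; linarith)))
    have h1 := hd.abs.eventually (gt_mem_nhds (show |(0 : ℝ)| < |m| / 2 by
      have := abs_pos.2 hne; rw [abs_zero]; linarith))
    obtain ⟨x, hx1, hx2, hx3⟩ := (h1.and (hmv.and (eventually_ge_atTop X))).exists
    obtain ⟨y, hy, -, hy'⟩ := hx2 1 one_pos
    rw [hy', one_mul] at hx1
    linarith [hX y (hx3.trans hy.le)]
  · exfalso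
    obtain ⟨X, hX⟩ := eventually_atTop.1 (hm.eventually (eventually_gt_atTop 1))
    have h1 := hd.abs.eventually (gt_mem_nhds (show |(0 : ℝ)| < 1 by simp))
    obtain ⟨x, hx1, hx2, hx3⟩ := (h1.and (hmv.and (eventually_ge_atTop X))).exists
    obtain ⟨y, hy, -, hy'⟩ := hx2 1 one_pos
    rw [hy', one_mul] at hx1
    linarith [hX y (hx3.trans hy.le)]

end IsHardyClass

namespace IsHardyRing

variable {R : Set (ℝ → ℝ)} (hR : IsHardyRing R) {f g : ℝ → ℝ}
include hR

lemma const_mul (hf : f ∈ R) (c : ℝ) : (fun x => c * f x) ∈ R := hR.mul (hR.const c) hf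

lemma sub (hf : f ∈ R) (hg : g ∈ R) : (fun x => f x - g x) ∈ R := by
  simpa [sub_eq_add_neg] using hR.add hf (hR.neg hg)

lemma pow (n : ℕ) : (fun x => x ^ n) ∈ R := by
  induction n with
  | zero => simpa using hR.const 1
  | succ n ih => simpa [pow_succ] using hR.mul ih hR.id

lemma iterate_deriv (hf : f ∈ R) (k : ℕ) : _root_.deriv^[k] f ∈ R := by
  induction k generalizing f with
  | zero => simpa using hf
  | succ k ih =>
    rw [Function.iterate_succ_apply]
    exact ih (hR.deriv hf)

lemma aeval_rat (p : Polynomial ℚ) : (fun x : ℝ => Polynomial.aeval x p) ∈ R := by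
  induction p using Polynomial.induction_on' with
  | add p q hp hq => simpa using hR.add hp hq
  | monomial n c => simpa [Polynomial.aeval_monomial] using hR.const_mul (hR.pow n) c

/-- An eventual upper bound for the derivative from one for the function. -/
lemma deriv_le_of_le_pow (hf : f ∈ R) {C : ℝ} {d : ℕ}
    (h : ∀ᶠ x in atTop, |f x| ≤ C * x ^ (d + 1)) :
    ∃ C', ∀ᶠ x in atTop, _root_.deriv f x ≤ C' * x ^ d := by
  -- This is the leading coefficient of the derivative of `(C + 1) * x ^ (d + 1)`; the extra 1
  -- provides the slack for the contradiction. If the derivative of `f` exceeded it eventually, `f -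
  -- (C + 1) x ^ (d + 1)` would be nondecreasing, while the bound on `f` makes it at most `-x ^ (d +
  -- 1)`.
  refine ⟨(C + 1) * (d + 1), ?_⟩
  have hmem : (fun x => _root_.deriv f x - (C + 1) * (d + 1) * x ^ d) ∈ R :=
    hR.sub (hR.deriv hf) (hR.const_mul (hR.pow d) _)
  have hle : (∀ᶠ x in atTop, _root_.deriv f x ≤ (C + 1) * (d + 1) * x ^ d) ∨
      ∀ᶠ x in atTop, 0 ≤ _root_.deriv f x - (C + 1) * (d + 1) * x ^ d := by
    rcases hR.sign hmem with h | h | h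
    · exact Or.inl (h.mono fun x hx => by linarith)
    · exact Or.inr (h.mono fun x hx => hx.le)
    · exact Or.inl (h.mono fun x hx => by linarith)
  refine hle.resolve_right fun hpos => ?_
  have hder : ∀ x, HasDerivAt (fun x : ℝ => (C + 1) * x ^ (d + 1))
      ((C + 1) * (d + 1) * x ^ d) x := by
    intro x
    have := (hasDerivAt_pow (d + 1) x).const_mul (C + 1)
    refine this.congr_deriv ?_
    push_cast
    ring
  have hdiff : ∀ᶠ x in atTop, HasDerivAt (fun x => f x - (C + 1) * x ^ (d + 1))
      (_root_.deriv f x - (C + 1) * (d + 1) * x ^ d) x :=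
    (hR.diff hf).mono fun x hx => hx.hasDerivAt.sub (hder x)
  obtain ⟨X, hX⟩ := eventually_monotoneOn_of_deriv_nonneg
    (hdiff.mono fun x hx => hx.differentiableAt) (by
      filter_upwards [hdiff, hpos] with x h1 h2
      rw [h1.deriv]; exact h2)
  have hgrow : Tendsto (fun x : ℝ => x ^ (d + 1)) atTop atTop := tendsto_pow_atTop (by omega)
  obtain ⟨x, hx1, hx2, hx3⟩ := (h.and ((eventually_ge_atTop X).and
    (hgrow.eventually (eventually_gt_atTop (-(f X - (C + 1) * X ^ (d + 1))))))).exists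
  have := hX (Set.mem_Ici.2 le_rfl) (Set.mem_Ici.2 hx2) hx2
  simp only at this
  have := abs_le.1 hx1
  linarith [this.2]

lemma abs_deriv_le_of_le_pow (hf : f ∈ R) {C : ℝ} {d : ℕ}
    (h : ∀ᶠ x in atTop, |f x| ≤ C * x ^ (d + 1)) :
    ∃ C', ∀ᶠ x in atTop, |_root_.deriv f x| ≤ C' * x ^ d := by
  obtain ⟨C₁, h₁⟩ := hR.deriv_le_of_le_pow hf h
  obtain ⟨C₂, h₂⟩ := hR.deriv_le_of_le_pow (hR.neg hf) (C := C) (d := d) (by simpa using h)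
  refine ⟨max C₁ C₂, ?_⟩
  filter_upwards [h₁, h₂, eventually_ge_atTop 0] with x h1 h2 h3
  rw [deriv.fun_neg] at h2
  have hx : 0 ≤ x ^ d := pow_nonneg h3 d
  have a1 := mul_le_mul_of_nonneg_right (le_max_left C₁ C₂) hx
  have a2 := mul_le_mul_of_nonneg_right (le_max_right C₁ C₂) hx
  exact abs_le.2 ⟨by linarith, by linarith⟩

/-- Each derivative lowers the power bound by one degree. After `d` of them the function is bounded,
hence convergent, and one more derivative tends to 0. -/
lemma tendsto_iterate_deriv (hf : f ∈ R) {C : ℝ} {d : ℕ}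
    (h : ∀ᶠ x in atTop, |f x| ≤ C * x ^ d) :
    Tendsto (_root_.deriv^[d + 1] f) atTop (𝓝 0) := by
  induction d generalizing f C with
  | zero =>
    simp only [pow_zero, mul_one] at h
    rcases hR.tendsto_or_abs_atTop hf with ⟨l, hl⟩ | hl
    · simpa using hR.tendsto_deriv_of_tendsto hf hl
    · obtain ⟨x, h1, h2⟩ := (h.and (hl.eventually (eventually_gt_atTop C))).exists
      linarith
  | succ d ih =>
    obtain ⟨C', h'⟩ := hR.abs_deriv_le_of_le_pow hf h
    rw [Function.iterate_succ_apply]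
    exact ih (hR.deriv hf) h'

end IsHardyRing

lemma exists_pow_bound_of_isBigO_rpow {a : ℝ → ℝ} {d : ℝ}
    (h : a =O[atTop] fun x : ℝ => x ^ d) :
    ∃ (C : ℝ) (n : ℕ), ∀ᶠ x in atTop, |a x| ≤ C * x ^ n := by
  obtain ⟨C, hC, h⟩ := h.exists_nonneg
  refine ⟨C, ⌈d⌉₊, ?_⟩
  filter_upwards [h.bound, eventually_ge_atTop 1] with x hx h1
  refine hx.trans (mul_le_mul_of_nonneg_left ?_ hC)
  rw [Real.norm_of_nonneg (Real.rpow_nonneg (by linarith) _), ← Real.rpow_natCast]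
  exact Real.rpow_le_rpow_of_exponent_le h1 (Nat.le_ceil d)

/-! ### Embedding the Hardy field into a Hardy ring -/

section Construction

/-- The functions whose germ lies in `H`. -/
def germSet (H : Subring (Germ (atTop : Filter ℝ) ℝ)) : Set (ℝ → ℝ) :=
  {f | (f : Germ (atTop : Filter ℝ) ℝ) ∈ H}

variable {H : Subring (Germ (atTop : Filter ℝ) ℝ)}

lemma germSet_congr {f g : ℝ → ℝ} (hf : f ∈ germSet H) (h : f =ᶠ[atTop] g) : g ∈ germSet H := by
  have : (f : Germ (atTop : Filter ℝ) ℝ) = g := Germ.coe_eq.2 h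
  show (g : Germ (atTop : Filter ℝ) ℝ) ∈ H
  rw [← this]; exact hf

lemma germSet_add {f g : ℝ → ℝ} (hf : f ∈ germSet H) (hg : g ∈ germSet H) :
    (fun x => f x + g x) ∈ germSet H := H.add_mem hf hg

lemma germSet_mul {f g : ℝ → ℝ} (hf : f ∈ germSet H) (hg : g ∈ germSet H) :
    (fun x => f x * g x) ∈ germSet H := H.mul_mem hf hg

lemma germSet_natCast (n : ℕ) : (fun _ => (n : ℝ)) ∈ germSet H := natCast_mem H n

lemma exists_inv_germSet (hH : IsHardyField H) {f : ℝ → ℝ} (hf : f ∈ germSet H)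
    (h : ¬ ∀ᶠ x in atTop, f x = 0) : ∃ v ∈ germSet H, ∀ᶠ x in atTop, f x * v x = 1 := by
  obtain ⟨v, hv, hfv⟩ := hH.exists_inv f hf (fun h0 => h (Germ.coe_eq.1 h0))
  induction v using Germ.inductionOn with
  | h v => exact ⟨v, hv, Germ.coe_eq.1 hfv⟩

lemma isHardyClass_germSet (hH : IsHardyField H) : IsHardyClass (germSet H) where
  neg hf := H.neg_mem hf
  deriv {f} hf := by
    obtain ⟨g, hg, h⟩ := hH.exists_deriv f hf
    exact germSet_congr hg (h.mono fun x hx => hx.deriv.symm)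
  diff {f} hf := by
    obtain ⟨g, hg, h⟩ := hH.exists_deriv f hf
    exact h.mono fun x hx => hx.differentiableAt
  zero_or_ne {f} hf := by
    by_cases h : ∀ᶠ x in atTop, f x = 0
    · exact Or.inl h
    · obtain ⟨v, -, hv⟩ := exists_inv_germSet hH hf h
      refine Or.inr (hv.mono fun x hx h0 => ?_)
      simp [h0] at hx

/-- A Hardy field closed under composition and compositional inversion contains the identity,
unless all its elements are constant. -/
lemma id_mem_germSet (hH : IsHardyField H) (hcomp : ClosedUnderComp H)
    (hinv : ClosedUnderCompInv H) {f : ℝ → ℝ} (hf : f ∈ germSet H)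
    (hfc : ¬ ∃ c, ∀ᶠ x in atTop, f x = c) : (fun x => x) ∈ germSet H := by
  have hK := isHardyClass_germSet hH
  have hinf : ∃ g ∈ germSet H, Tendsto (fun x => |g x|) atTop atTop := by
    rcases hK.tendsto_or_abs_atTop hf with ⟨l, hl⟩ | h
    -- A convergent nonconstant germ has a derivative that tends to 0 without vanishing eventually,
    -- so the reciprocal of that derivative is unbounded.
    · have h0 := hK.tendsto_deriv_of_tendsto hf hl
      obtain ⟨v, hv, hfv⟩ := exists_inv_germSet hH (hK.deriv hf)
        (fun h => hfc (eventually_const_of_deriv_eq_zero (hK.diff hf) h))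
      refine ⟨v, hv, ?_⟩
      have h1 : Tendsto (fun x => |deriv f x|) atTop (𝓝[>] 0) := by
        refine tendsto_nhdsWithin_iff.2 ⟨by simpa using h0.abs, hfv.mono fun x hx => ?_⟩
        exact abs_pos.2 (left_ne_zero_of_mul_eq_one hx)
      refine h1.inv_tendsto_nhdsGT_zero.congr' (hfv.mono fun x hx => ?_)
      simp only [Pi.inv_apply]
      rw [← abs_inv, eq_inv_of_mul_eq_one_right hx]
    · exact ⟨f, hf, h⟩
  obtain ⟨g, hg, hg'⟩ : ∃ g ∈ germSet H, Tendsto g atTop atTop := by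
    obtain ⟨g, hg, h⟩ := hinf
    rcases hK.tendsto_trichotomy hg with ⟨l, hl⟩ | h' | h'
    · exact absurd h (not_tendsto_atTop_of_tendsto_nhds hl.abs)
    · exact ⟨g, hg, h'⟩
    · exact ⟨_, hK.neg hg, tendsto_neg_atBot_atTop.comp h'⟩
  -- The identity germ is recovered as the compositional inverse of `g` composed with `g`.
  obtain ⟨h, hh, -, -, hhg⟩ := hinv g hg hg'
  exact germSet_congr (hcomp h g hh hg hg') hhg

/-- A derivative of constant sign makes the function strictly monotone, hence with at most one zero
on a half-line; a vanishing derivative makes it constant. -/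
lemma zero_or_ne_of_deriv {g : ℝ → ℝ} (hd : ∀ᶠ x in atTop, DifferentiableAt ℝ g x)
    (h : (∀ᶠ x in atTop, deriv g x = 0) ∨ (∀ᶠ x in atTop, 0 < deriv g x) ∨
      ∀ᶠ x in atTop, deriv g x < 0) :
    (∀ᶠ x in atTop, g x = 0) ∨ ∀ᶠ x in atTop, g x ≠ 0 := by
  have key : ∀ g : ℝ → ℝ, (∀ᶠ x in atTop, DifferentiableAt ℝ g x) →
      (∀ᶠ x in atTop, 0 < deriv g x) → ∀ᶠ x in atTop, g x ≠ 0 := by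
    intro g hd h
    obtain ⟨X, hX⟩ := eventually_strictMonoOn_of_deriv_pos hd h
    by_cases hz : ∃ z, X ≤ z ∧ g z = 0
    · obtain ⟨z, hz, hz0⟩ := hz
      filter_upwards [eventually_gt_atTop z] with x hx
      have := hX (Set.mem_Ici.2 hz) (Set.mem_Ici.2 (hz.trans hx.le)) hx
      rw [hz0] at this
      exact this.ne'
    · push Not at hz
      filter_upwards [eventually_ge_atTop X] with x hx using hz x hx
  rcases h with h | h | h
  · obtain ⟨c, hc⟩ := eventually_const_of_deriv_eq_zero hd h
    rcases eq_or_ne c 0 with rfl | h0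
    · exact Or.inl hc
    · exact Or.inr (hc.mono fun x hx => by rw [hx]; exact h0)
  · exact Or.inr (key g hd h)
  · refine Or.inr ((key (fun x => - g x) (hd.mono fun x hx => hx.neg)
      (h.mono fun x hx => by rw [deriv.fun_neg]; linarith)).mono fun x hx => ?_)
    simpa using hx

/-- A real multiple of a germ of the field need not lie in the field, so invertibility there says
nothing about real combinations. A Rolle-type induction on the number of summands replaces it.
Dividing by the first germ and differentiating removes one summand, the induction hypothesis gives
the derivative a constant sign, and this controls the zeros of the quotient. -/
lemma zero_or_ne_sum_germSet (hH : IsHardyField H) (n : ℕ) :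
    ∀ (c : Fin n → ℝ) (h : Fin n → ℝ → ℝ), (∀ i, h i ∈ germSet H) →
    (∀ᶠ x in atTop, ∑ i, c i * h i x = 0) ∨ ∀ᶠ x in atTop, ∑ i, c i * h i x ≠ 0 := by
  have hK := isHardyClass_germSet hH
  induction n with
  | zero => intro c h _; left; simp
  | succ n ih =>
    intro c h hh
    by_cases h0 : ∀ᶠ x in atTop, h 0 x = 0
    · refine (ih (fun i => c i.succ) (fun i => h i.succ) fun i => hh _).imp ?_ ?_ <;>
      · intro h1
        filter_upwards [h0, h1] with x hx hx'
        rw [Fin.sum_univ_succ, hx]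
        simpa using hx'
    · obtain ⟨v, hv, hv1⟩ := exists_inv_germSet hH (hh 0) h0
      set q : Fin n → ℝ → ℝ := fun i x => h i.succ x * v x with hq
      have hqK : ∀ i, q i ∈ germSet H := fun i => germSet_mul (hh _) hv
      set g : ℝ → ℝ := fun x => c 0 + ∑ i, c i.succ * q i x with hg
      have hqd : ∀ᶠ x in atTop, ∀ i, DifferentiableAt ℝ (q i) x :=
        eventually_all.2 fun i => hK.diff (hqK i)
      have hgd : ∀ᶠ x in atTop, HasDerivAt g (∑ i, c i.succ * deriv (q i) x) x := by
        filter_upwards [hqd] with x hx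
        have := HasDerivAt.fun_sum (u := Finset.univ) (A := fun i x => c (Fin.succ i) * q i x)
          (A' := fun i => c i.succ * deriv (q i) x) (x := x)
          (fun i _ => (hx i).hasDerivAt.const_mul _)
        exact this.const_add _
      have hdiff : ∀ᶠ x in atTop, DifferentiableAt ℝ g x :=
        hgd.mono fun x hx => hx.differentiableAt
      have hdd : ∀ᶠ x in atTop,
          DifferentiableAt ℝ (fun x => ∑ i, c (Fin.succ i) * deriv (q i) x) x := by
        filter_upwards [eventually_all.2 fun i => hK.diff (hK.deriv (hqK i))] with x hx
        exact DifferentiableAt.fun_sum fun i _ => (hx i).const_mul _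
      have hsgn : (∀ᶠ x in atTop, deriv g x = 0) ∨ (∀ᶠ x in atTop, 0 < deriv g x) ∨
          ∀ᶠ x in atTop, deriv g x < 0 := by
        have : (fun x => ∑ i, c (Fin.succ i) * deriv (q i) x) =ᶠ[atTop] deriv g :=
          hgd.mono fun x hx => hx.deriv.symm
        rcases ih (fun i => c i.succ) (fun i => deriv (q i)) (fun i => hK.deriv (hqK i))
          with h1 | h1
        · exact Or.inl ((this.and h1).mono fun x hx => hx.1 ▸ hx.2)
        · rcases eventually_pos_or_neg_of_ne hdd h1 with h2 | h2
          · exact Or.inr (Or.inl ((this.and h2).mono fun x hx => hx.1 ▸ hx.2))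
          · exact Or.inr (Or.inr ((this.and h2).mono fun x hx => hx.1 ▸ hx.2))
      have hfac : ∀ᶠ x in atTop, ∑ i, c i * h i x = h 0 x * g x := by
        filter_upwards [hv1] with x hx
        rw [Fin.sum_univ_succ, hg, mul_add, Finset.mul_sum]
        congr 1
        · ring
        · refine Finset.sum_congr rfl fun i _ => ?_
          simp only [hq]
          linear_combination (-(c i.succ * h i.succ x)) * hx
      refine (zero_or_ne_of_deriv hdiff hsgn).imp ?_ ?_
      · intro h1
        filter_upwards [hfac, h1] with x hx hx'
        rw [hx, hx', mul_zero]
      · intro h1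
        filter_upwards [hfac, h1, hv1] with x hx hx' hx''
        rw [hx]
        exact mul_ne_zero (left_ne_zero_of_mul_eq_one hx'') hx'

-- Real coefficients are adjoined because the later arguments use arbitrary real multiples of the
-- functions. Translations come from composing with `x + h`, which is where the identity germ is
-- needed.
open scoped Pointwise in
lemma isHardyRing_span (hH : IsHardyField H) (hcomp : ClosedUnderComp H)
    (hid : (fun x => x) ∈ germSet H) :
    IsHardyRing (Submodule.span ℝ (germSet H) : Set (ℝ → ℝ)) := by
  have hK := isHardyClass_germSet hH
  have hdiff : ∀ {f : ℝ → ℝ}, f ∈ Submodule.span ℝ (germSet H) →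
      ∀ᶠ x in atTop, DifferentiableAt ℝ f x := by
    intro f hf
    induction hf using Submodule.span_induction with
    | mem f hf => exact hK.diff hf
    | zero => exact Eventually.of_forall fun x => differentiableAt_const 0
    | add f g _ _ hf hg => exact (hf.and hg).mono fun x hx => hx.1.add hx.2
    | smul c f _ hf => exact hf.mono fun x hx => hx.const_smul c
  have hcongr : ∀ {f g : ℝ → ℝ}, f ∈ Submodule.span ℝ (germSet H) → f =ᶠ[atTop] g →
      g ∈ Submodule.span ℝ (germSet H) := by
    intro f g hf h
    have h0 : g - f ∈ germSet H := by
      refine germSet_congr (germSet_natCast 0) (h.mono fun x hx => ?_)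
      simp [hx]
    simpa using Submodule.add_mem _ hf (Submodule.subset_span h0)
  refine ⟨⟨?_, ?_, hdiff, ?_⟩, hcongr, ?_, ?_, ?_, Submodule.subset_span hid, ?_⟩
  · intro f hf
    exact Submodule.neg_mem _ hf
  · intro f hf
    induction hf using Submodule.span_induction with
    | mem f hf => exact Submodule.subset_span (hK.deriv hf)
    | zero => exact hcongr (Submodule.zero_mem _) (Eventually.of_forall fun x => by simp)
    | add f g hfm hgm hf hg =>
      refine hcongr (Submodule.add_mem _ hf hg) ?_
      filter_upwards [hdiff hfm, hdiff hgm] with x h1 h2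
      rw [deriv_add h1 h2]; rfl
    | smul c f hfm hf =>
      refine hcongr (Submodule.smul_mem _ c hf) ?_
      filter_upwards [hdiff hfm] with x h1
      rw [deriv_const_smul _ h1]; rfl
  · intro f hf
    obtain ⟨n, c, g, hg⟩ := Submodule.mem_span_set'.1 hf
    have := zero_or_ne_sum_germSet hH n c (fun i => (g i : ℝ → ℝ)) (fun i => (g i).2)
    have he : ∀ x, ∑ i, c i * (g i : ℝ → ℝ) x = f x := by
      intro x
      rw [← hg]; simp
    simpa only [he] using this
  · intro f g hf hg
    exact Submodule.add_mem _ hf hg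
  · intro f g hf hg
    have : f * g ∈ Submodule.span ℝ (germSet H * germSet H) := by
      rw [← Submodule.span_mul_span]
      exact Submodule.mul_mem_mul hf hg
    refine Submodule.span_mono ?_ this
    rintro _ ⟨u, hu, v, hv, rfl⟩
    exact germSet_mul hu hv
  · intro c
    have := Submodule.smul_mem (Submodule.span ℝ (germSet H)) c
      (Submodule.subset_span (germSet_natCast (H := H) 1))
    exact hcongr this (Eventually.of_forall fun x => by simp)
  · intro f hf h
    induction hf using Submodule.span_induction with
    | mem f hf =>
      exact Submodule.subset_span (hcomp f (fun x => x + h) hf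
        (germSet_add hid (germSet_natCast h)) (tendsto_atTop_add_const_right _ _ tendsto_id))
    | zero => exact Submodule.zero_mem _
    | add f g _ _ hf hg => exact Submodule.add_mem _ hf hg
    | smul c f _ hf => exact Submodule.smul_mem _ c hf

/-- This ring covers the degenerate case of a field made of constants only, which may not contain
the identity. -/
lemma isHardyRing_polynomial :
    IsHardyRing {f : ℝ → ℝ | ∃ p : Polynomial ℝ, f =ᶠ[atTop] fun x => p.eval x} := by
  have hderiv : ∀ {f : ℝ → ℝ} {p : Polynomial ℝ}, (f =ᶠ[atTop] fun x => p.eval x) →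
      (∀ᶠ x in atTop, HasDerivAt f (p.derivative.eval x) x) := by
    intro f p h
    obtain ⟨X, hX⟩ := eventually_atTop.1 h
    filter_upwards [eventually_gt_atTop X] with x hx
    refine (p.hasDerivAt x).congr_of_eventuallyEq ?_
    filter_upwards [lt_mem_nhds hx] with y hy using hX y hy.le
  refine ⟨⟨?_, ?_, ?_, ?_⟩, ?_, ?_, ?_, ?_, ?_, ?_⟩
  · rintro f ⟨p, hp⟩
    exact ⟨-p, hp.mono fun x hx => by simp [hx]⟩
  · rintro f ⟨p, hp⟩
    exact ⟨p.derivative, (hderiv hp).mono fun x hx => hx.deriv⟩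
  · rintro f ⟨p, hp⟩
    exact (hderiv hp).mono fun x hx => hx.differentiableAt
  · rintro f ⟨p, hp⟩
    rcases eq_or_ne p 0 with rfl | h0
    · exact Or.inl (hp.mono fun x hx => by simpa using hx)
    · obtain ⟨M, hM⟩ := (p.roots.toFinset.finite_toSet).bddAbove
      refine Or.inr ?_
      filter_upwards [hp, eventually_gt_atTop M] with x hx hxM h
      refine absurd (hM (a := x) ?_) (not_le.2 hxM)
      simp [h0, ← hx, h]
  · rintro f g ⟨p, hp⟩ h
    exact ⟨p, h.symm.trans hp⟩
  · rintro f g ⟨p, hp⟩ ⟨q, hq⟩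
    exact ⟨p + q, (hp.and hq).mono fun x hx => by simp [hx.1, hx.2]⟩
  · rintro f g ⟨p, hp⟩ ⟨q, hq⟩
    exact ⟨p * q, (hp.and hq).mono fun x hx => by simp [hx.1, hx.2]⟩
  · exact fun c => ⟨Polynomial.C c, by simp⟩
  · exact ⟨Polynomial.X, by simp⟩
  · rintro f ⟨p, hp⟩ h
    refine ⟨p.comp (Polynomial.X + Polynomial.C (h : ℝ)), ?_⟩
    filter_upwards [(tendsto_atTop_add_const_right atTop (h : ℝ) tendsto_id).eventually hp]
      with x hx
    simpa using hx

/-- Every Hardy field closed under composition and compositional inversion is contained in a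
Hardy ring. -/
theorem exists_isHardyRing (hH : IsHardyField H) (hcomp : ClosedUnderComp H)
    (hinv : ClosedUnderCompInv H) :
    ∃ R : Set (ℝ → ℝ), IsHardyRing R ∧ ∀ f : ℝ → ℝ, (f : Germ (atTop : Filter ℝ) ℝ) ∈ H → f ∈ R := by
  by_cases h : ∀ f ∈ germSet H, ∃ c, ∀ᶠ x in atTop, f x = c
  · refine ⟨_, isHardyRing_polynomial, fun f hf => ?_⟩
    obtain ⟨c, hc⟩ := h f hf
    exact ⟨Polynomial.C c, hc.mono fun x hx => by simpa using hx⟩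
  · push Not at h
    obtain ⟨f, hf, hfc⟩ := h
    have hid := id_mem_germSet hH hcomp hinv hf (by push Not; exact hfc)
    exact ⟨_, isHardyRing_span hH hcomp hid, fun f hf => Submodule.subset_span hf⟩

end Construction

/-! ### Exponentials and Cesàro means -/

/-- The character `x ↦ exp (2πix)`. -/
noncomputable def unitExp (x : ℝ) : ℂ := Complex.exp (2 * Real.pi * x * Complex.I)

/-- The Cesàro means of a complex sequence. -/
noncomputable def cesaro (u : ℕ → ℂ) (N : ℕ) : ℂ := (1 / (N : ℂ)) * ∑ n ∈ Finset.Icc 1 N, u n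

open Complex in
lemma unitExp_eq_exp (x : ℝ) : unitExp x = Complex.exp ((2 * Real.pi * x : ℝ) * I) := by
  simp [unitExp]

lemma unitExp_add (x y : ℝ) : unitExp (x + y) = unitExp x * unitExp y := by
  rw [unitExp, unitExp, unitExp, ← Complex.exp_add]
  push_cast
  ring_nf

@[simp] lemma unitExp_zero : unitExp 0 = 1 := by simp [unitExp]

@[simp] lemma norm_unitExp (x : ℝ) : ‖unitExp x‖ = 1 := by
  rw [unitExp_eq_exp, Complex.norm_exp_ofReal_mul_I]

lemma unitExp_ne_zero (x : ℝ) : unitExp x ≠ 0 := Complex.exp_ne_zero _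

lemma star_unitExp (x : ℝ) : (starRingEnd ℂ) (unitExp x) = unitExp (-x) := by
  rw [unitExp_eq_exp, unitExp_eq_exp, ← Complex.exp_conj, map_mul, Complex.conj_I,
    Complex.conj_ofReal]
  push_cast
  ring_nf

lemma unitExp_neg (x : ℝ) : unitExp (-x) = (unitExp x)⁻¹ := by
  rw [unitExp, unitExp, ← Complex.exp_neg]
  push_cast
  ring_nf

lemma unitExp_sub (x y : ℝ) : unitExp (x - y) = unitExp x * (starRingEnd ℂ) (unitExp y) := by
  rw [sub_eq_add_neg, unitExp_add, star_unitExp]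

@[simp] lemma unitExp_intCast (k : ℤ) : unitExp k = 1 := by
  rw [unitExp]
  have := Complex.exp_int_mul_two_pi_mul_I k
  rw [← this]
  push_cast
  ring_nf

lemma unitExp_eq_one_iff {x : ℝ} : unitExp x = 1 ↔ ∃ k : ℤ, x = k := by
  constructor
  · intro h
    obtain ⟨k, hk⟩ := Complex.exp_eq_one_iff.1 h
    refine ⟨k, ?_⟩
    have h2 : (2 * Real.pi * Complex.I : ℂ) ≠ 0 := Complex.two_pi_I_ne_zero
    have : (x : ℂ) = k := by
      apply mul_right_cancel₀ h2
      rw [← hk]; ring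
    exact_mod_cast this
  · rintro ⟨k, rfl⟩
    exact unitExp_intCast k

lemma unitExp_add_int (x : ℝ) (k : ℤ) : unitExp (x + k) = unitExp x := by
  rw [unitExp_add, unitExp_intCast, mul_one]

lemma continuous_unitExp : Continuous unitExp := by
  unfold unitExp
  fun_prop

lemma norm_unitExp_sub_le (x y : ℝ) : ‖unitExp x - unitExp y‖ ≤ 2 * Real.pi * |x - y| := by
  have h : unitExp x - unitExp y = unitExp y * (unitExp (x - y) - 1) := by
    rw [mul_sub, ← unitExp_add]; simp
  rw [h, norm_mul, norm_unitExp, one_mul, unitExp_eq_exp]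
  have := Real.norm_exp_I_mul_ofReal_sub_one_le (x := 2 * Real.pi * (x - y))
  rw [mul_comm, ] at this
  refine this.trans ?_
  rw [Real.norm_eq_abs, abs_mul, abs_of_pos Real.two_pi_pos]

lemma sum_Icc_one_eq_sum_range {M : Type*} [AddCommMonoid M] (u : ℕ → M) (N : ℕ) :
    ∑ n ∈ Finset.Icc 1 N, u n = ∑ n ∈ Finset.range N, u (n + 1) := by
  rw [Finset.range_eq_Ico, Finset.sum_Ico_add' u 0 N 1]
  rfl

lemma norm_cesaro (u : ℕ → ℂ) (N : ℕ) :
    ‖cesaro u N‖ = ‖∑ n ∈ Finset.Icc 1 N, u n‖ / N := by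
  rw [cesaro, norm_mul]
  simp [div_eq_inv_mul]

lemma norm_cesaro_le_cesaro {u : ℕ → ℂ} {v : ℕ → ℝ} (h : ∀ n, ‖u n‖ ≤ v n) (N : ℕ) :
    ‖cesaro u N‖ ≤ (∑ n ∈ Finset.Icc 1 N, v n) / N := by
  rw [norm_cesaro]
  gcongr
  exact norm_sum_le_of_le _ fun n _ => h n

lemma norm_cesaro_le {u : ℕ → ℂ} {C : ℝ} (hC : 0 ≤ C) (h : ∀ n, ‖u n‖ ≤ C) (N : ℕ) :
    ‖cesaro u N‖ ≤ C := by
  refine (norm_cesaro_le_cesaro h N).trans ?_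
  rcases Nat.eq_zero_or_pos N with rfl | hN
  · simpa using hC
  · have : (0 : ℝ) < N := by exact_mod_cast hN
    simp [this.ne']

lemma cesaro_add (u v : ℕ → ℂ) (N : ℕ) :
    cesaro (fun n => u n + v n) N = cesaro u N + cesaro v N := by
  simp [cesaro, Finset.sum_add_distrib, mul_add]

lemma cesaro_sub (u v : ℕ → ℂ) (N : ℕ) :
    cesaro (fun n => u n - v n) N = cesaro u N - cesaro v N := by
  simp [cesaro, Finset.sum_sub_distrib, mul_sub]

lemma cesaro_const_mul (c : ℂ) (u : ℕ → ℂ) (N : ℕ) :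
    cesaro (fun n => c * u n) N = c * cesaro u N := by
  simp only [cesaro, ← Finset.mul_sum]
  ring

lemma cesaro_sum {ι : Type*} (s : Finset ι) (u : ι → ℕ → ℂ) (N : ℕ) :
    cesaro (fun n => ∑ i ∈ s, u i n) N = ∑ i ∈ s, cesaro (u i) N := by
  simp only [cesaro, ← Finset.mul_sum]
  rw [Finset.sum_comm]

lemma cesaro_star (u : ℕ → ℂ) (N : ℕ) :
    cesaro (fun n => (starRingEnd ℂ) (u n)) N = (starRingEnd ℂ) (cesaro u N) := by
  simp [cesaro]

lemma cesaro_const (c : ℂ) : Tendsto (cesaro fun _ => c) atTop (𝓝 c) := by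
  apply tendsto_const_nhds.congr'
  filter_upwards [eventually_gt_atTop 0] with N hN
  have : (N : ℂ) ≠ 0 := by exact_mod_cast hN.ne'
  simp [cesaro, this]

lemma tendsto_sum_div_of_tendsto {u : ℕ → ℝ} {l : ℝ} (h : Tendsto u atTop (𝓝 l)) :
    Tendsto (fun N : ℕ => (∑ n ∈ Finset.Icc 1 N, u n) / N) atTop (𝓝 l) := by
  have := ((tendsto_add_atTop_iff_nat 1).2 h).cesaro
  refine this.congr fun N => ?_
  rw [sum_Icc_one_eq_sum_range, div_eq_inv_mul]

lemma tendsto_cesaro_of_tendsto {u : ℕ → ℂ} {l : ℂ} (h : Tendsto u atTop (𝓝 l)) :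
    Tendsto (cesaro u) atTop (𝓝 l) := by
  have := ((tendsto_add_atTop_iff_nat 1).2 h).cesaro_smul
  refine this.congr fun N => ?_
  rw [cesaro, sum_Icc_one_eq_sum_range, one_div]
  simp

lemma tendsto_cesaro_congr {u v : ℕ → ℂ} {l : ℂ} (h : Tendsto (fun n => u n - v n) atTop (𝓝 0))
    (hv : Tendsto (cesaro v) atTop (𝓝 l)) : Tendsto (cesaro u) atTop (𝓝 l) := by
  have := (tendsto_cesaro_of_tendsto h).add hv
  rw [zero_add] at this
  refine this.congr fun N => ?_
  rw [cesaro_sub]; ring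

lemma tendsto_zero_of_forall_eventually_le {f : ℕ → ℝ} (h0 : ∀ N, 0 ≤ f N)
    (h : ∀ ε > 0, ∀ᶠ N in atTop, f N ≤ ε) : Tendsto f atTop (𝓝 0) := by
  rw [Metric.tendsto_nhds]
  intro ε hε
  filter_upwards [h (ε / 2) (by positivity)] with N hN
  rw [Real.dist_eq, sub_zero, abs_of_nonneg (h0 N)]
  linarith

/-! ### Estimates for exponential sums -/

/-- The inverse of `e(x) - 1` is `-1/2 - (i/2) cot(πx)`. Its real part is constant, so its variation
is that of a cotangent, which is monotone. -/
lemma inv_unitExp_sub_one {x : ℝ} (h : Real.sin (Real.pi * x) ≠ 0) :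
    (unitExp x - 1) * (-(1 / 2) - Complex.I / 2 *
      (Real.cos (Real.pi * x) / Real.sin (Real.pi * x) : ℝ)) = 1 := by
  have h' : (Real.sin (Real.pi * x) : ℂ) ≠ 0 := by exact_mod_cast h
  have h1 : unitExp x = (Real.cos (Real.pi * x) + Real.sin (Real.pi * x) * Complex.I) ^ 2 := by
    have : (Real.cos (Real.pi * x) + Real.sin (Real.pi * x) * Complex.I : ℂ) =
        Complex.exp ((Real.pi * x : ℝ) * Complex.I) := by
      rw [Complex.exp_mul_I]; simp
    rw [this, ← Complex.exp_nat_mul, unitExp]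
    push_cast
    ring_nf
  have h2 : (Real.sin (Real.pi * x) : ℂ) ^ 2 + (Real.cos (Real.pi * x) : ℂ) ^ 2 = 1 := by
    exact_mod_cast Real.sin_sq_add_cos_sq (Real.pi * x)
  rw [h1, Complex.ofReal_div]
  set s : ℂ := (Real.sin (Real.pi * x) : ℂ)
  set c : ℂ := (Real.cos (Real.pi * x) : ℂ)
  field_simp
  have hI := Complex.I_sq
  linear_combination (s - Complex.I * c) * h2 + (-s * c ^ 2 * 2 - Complex.I * c * s ^ 2 - s ^ 3 + 0) * hI

/-- **Kusmin–Landau inequality** for decreasing differences in `[δ, 1/2]`. -/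
lemma norm_sum_unitExp_le {b : ℕ → ℝ} {N : ℕ} {δ : ℝ} (hδ : 0 < δ)
    (h1 : ∀ n < N, δ ≤ b (n + 1) - b n) (h2 : ∀ n < N, b (n + 1) - b n ≤ 1 / 2)
    (h3 : ∀ n, n + 1 < N → b (n + 2) - b (n + 1) ≤ b (n + 1) - b n) :
    ‖∑ n ∈ Finset.range N, unitExp (b n)‖ ≤ 1 / δ := by
  have hpi := Real.pi_pos
  set Δ : ℕ → ℝ := fun n => b (n + 1) - b n with hΔ
  set c : ℕ → ℝ := fun n => Real.cos (Real.pi * Δ n) / Real.sin (Real.pi * Δ n) with hc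
  set w : ℕ → ℂ := fun n => -(1 / 2) - Complex.I / 2 * (c n : ℂ) with hw
  -- Jordan's inequality, available because the differences do not exceed `1/2`.
  have hsin : ∀ n < N, 2 * δ ≤ Real.sin (Real.pi * Δ n) := by
    intro n hn
    have ha := h1 n hn
    have hb := h2 n hn
    have := Real.mul_le_sin (x := Real.pi * Δ n) (by positivity [hδ.le.trans ha]) (by
      have := mul_le_mul_of_nonneg_left hb hpi.le
      linarith)
    have h' : 2 / Real.pi * (Real.pi * Δ n) = 2 * Δ n := by field_simp
    rw [h'] at this
    linarith
  have hcos : ∀ n < N, 0 ≤ Real.cos (Real.pi * Δ n) := by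
    intro n hn
    have ha := h1 n hn
    have hb := h2 n hn
    apply Real.cos_nonneg_of_mem_Icc
    constructor
    · have : 0 ≤ Real.pi * Δ n := mul_nonneg hpi.le (hδ.le.trans ha)
      linarith
    · have := mul_le_mul_of_nonneg_left hb hpi.le
      linarith
  have hc0 : ∀ n < N, 0 ≤ c n := fun n hn =>
    div_nonneg (hcos n hn) ((by positivity : 0 ≤ 2 * δ).trans (hsin n hn))
  have hcle : ∀ n < N, c n ≤ 1 / (2 * δ) := fun n hn =>
    div_le_div₀ zero_le_one (Real.cos_le_one _) (by positivity) (hsin n hn)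
  have hcmono : ∀ n, n + 1 < N → c n ≤ c (n + 1) := by
    intro n hn
    have hs1 : 0 < Real.sin (Real.pi * Δ n) :=
      (by positivity : 0 < 2 * δ).trans_le (hsin n (by omega))
    have hs2 : 0 < Real.sin (Real.pi * Δ (n + 1)) :=
      (by positivity : 0 < 2 * δ).trans_le (hsin (n + 1) hn)
    rw [hc]
    simp only
    rw [div_le_div_iff₀ hs1 hs2]
    have hd : 0 ≤ Real.sin (Real.pi * Δ n - Real.pi * Δ (n + 1)) := by
      apply Real.sin_nonneg_of_nonneg_of_le_pi
      · have := mul_le_mul_of_nonneg_left (h3 n hn) hpi.le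
        simp only [hΔ]
        linarith
      · have ha := mul_le_mul_of_nonneg_left (h2 n (by omega)) hpi.le
        have hb := mul_nonneg hpi.le (hδ.le.trans (h1 (n + 1) hn))
        simp only [hΔ]
        linarith
    rw [Real.sin_sub] at hd
    linarith
  have hwn : ∀ n < N, ‖w n‖ ≤ 1 / 2 + c n / 2 := by
    intro n hn
    have e1 : ‖w n‖ ≤ ‖(-(1 / 2) : ℂ)‖ + ‖Complex.I / 2 * (c n : ℂ)‖ := norm_sub_le _ _
    have e2 : ‖(-(1 / 2) : ℂ)‖ = 1 / 2 := by simp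
    have e3 : ‖Complex.I / 2 * (c n : ℂ)‖ = c n / 2 := by
      rw [norm_mul, norm_div, Complex.norm_I, Complex.norm_real,
        Real.norm_of_nonneg (hc0 n hn)]
      simp
      ring
    rwa [e2, e3] at e1
  -- Each term is a difference of consecutive exponentials times the weight `1 / (e(Δ n) - 1)`, so
  -- the sum is open to Abel summation.
  have hE : ∀ n < N, unitExp (b n) = (unitExp (b (n + 1)) - unitExp (b n)) * w n := by
    intro n hn
    have := inv_unitExp_sub_one (x := Δ n)
      ((by positivity : 0 < 2 * δ).trans_le (hsin n hn)).ne'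
    have h' : unitExp (b (n + 1)) = unitExp (b n) * unitExp (Δ n) := by
      rw [← unitExp_add]; simp [hΔ]
    rw [h']
    linear_combination (-unitExp (b n)) * this
  -- After Abel summation the error is the total variation of the weights. As the differences
  -- decrease, the cotangents increase, so the variation telescopes to its last value.
  have main : ∀ m, m + 1 ≤ N → ‖∑ n ∈ Finset.range (m + 1), unitExp (b n) -
      unitExp (b (m + 1)) * w m‖ ≤ 1 / 2 + c m / 2 := by
    intro m
    induction m with
    | zero =>
      intro hm
      have : ∑ n ∈ Finset.range (0 + 1), unitExp (b n) - unitExp (b (0 + 1)) * w 0 =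
          - (unitExp (b 0) * w 0) := by
        rw [Finset.sum_range_one]
        linear_combination hE 0 (by omega)
      rw [this, norm_neg, norm_mul, norm_unitExp, one_mul]
      exact hwn 0 (by omega)
    | succ m ih =>
      intro hm
      have : ∑ n ∈ Finset.range (m + 1 + 1), unitExp (b n) -
          unitExp (b (m + 1 + 1)) * w (m + 1) =
          (∑ n ∈ Finset.range (m + 1), unitExp (b n) - unitExp (b (m + 1)) * w m) +
          unitExp (b (m + 1)) * (w m - w (m + 1)) := by
        rw [Finset.sum_range_succ]
        linear_combination hE (m + 1) (by omega)
      rw [this]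
      refine (norm_add_le _ _).trans ?_
      have hd : ‖w m - w (m + 1)‖ = (c (m + 1) - c m) / 2 := by
        have : w m - w (m + 1) = Complex.I / 2 * ((c (m + 1) - c m : ℝ) : ℂ) := by
          simp only [hw]; push_cast; ring
        rw [this, norm_mul, norm_div, Complex.norm_I, Complex.norm_real,
          Real.norm_of_nonneg (sub_nonneg.2 (hcmono m (by omega)))]
        simp
        ring
      rw [norm_mul, norm_unitExp, one_mul, hd]
      linarith [ih (by omega)]
  rcases Nat.eq_zero_or_pos N with rfl | hN
  · simp [hδ.le]
  obtain ⟨m, rfl⟩ := Nat.exists_eq_add_of_le' hN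
  have hm := main m le_rfl
  have hwm := hwn m (by omega)
  have hcm := hcle m (by omega)
  have hδ2 : δ ≤ 1 / 2 := (h1 m (by omega)).trans (h2 m (by omega))
  have h1δ : 1 ≤ 1 / (2 * δ) := by
    rw [le_div_iff₀ (by positivity)]; linarith
  have e : ∑ n ∈ Finset.range (m + 1), unitExp (b n) =
      (∑ n ∈ Finset.range (m + 1), unitExp (b n) - unitExp (b (m + 1)) * w m) +
      unitExp (b (m + 1)) * w m := by ring
  rw [e]
  refine (norm_add_le _ _).trans ?_
  rw [norm_mul, norm_unitExp, one_mul]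
  have : 1 / δ = 1 / (2 * δ) + 1 / (2 * δ) := by field_simp; norm_num
  linarith

lemma norm_sum_shift_sub_le {u : ℕ → ℂ} (hu : ∀ n, ‖u n‖ ≤ 1) (N h : ℕ) :
    ‖∑ n ∈ Finset.range N, u (n + h) - ∑ n ∈ Finset.range N, u n‖ ≤ 2 * h := by
  induction h with
  | zero => simp
  | succ h ih =>
    have e : ∑ n ∈ Finset.range N, u (n + (h + 1)) =
        ∑ n ∈ Finset.range N, u (n + h) + (u (N + h) - u h) := by
      have h1 := Finset.sum_range_succ (fun n => u (n + h)) N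
      have h2 := Finset.sum_range_succ' (fun n => u (n + h)) N
      simp only [zero_add] at h2
      have h3 : ∀ n, n + 1 + h = n + (h + 1) := fun n => by ring
      simp only [h3] at h2
      linear_combination h2.symm.trans h1
    have e2 : ∑ n ∈ Finset.range N, u (n + (h + 1)) - ∑ n ∈ Finset.range N, u n =
        (∑ n ∈ Finset.range N, u (n + h) - ∑ n ∈ Finset.range N, u n) + (u (N + h) - u h) := by
      rw [e]; ring
    rw [e2]
    refine (norm_add_le _ _).trans ?_
    have := (norm_sub_le (u (N + h)) (u h)).trans (add_le_add (hu _) (hu _))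
    push_cast
    linarith

/-- **Van der Corput's inequality.** -/
lemma vanDerCorput_inequality {u : ℕ → ℂ} (hu : ∀ n, ‖u n‖ ≤ 1) (N : ℕ) {H : ℕ} (hH : 0 < H) :
    ‖∑ n ∈ Finset.range N, u n‖ ^ 2 ≤ 8 * (H : ℝ) ^ 2 + 4 * N * H +
      4 * N / H * ∑ h ∈ Finset.range H,
        ‖∑ n ∈ Finset.range N, u (n + h) * (starRingEnd ℂ) (u n)‖ := by
  have hH' : (0 : ℝ) < H := by exact_mod_cast hH
  set S : ℕ → ℝ := fun h => ‖∑ n ∈ Finset.range N, u (n + h) * (starRingEnd ℂ) (u n)‖ with hS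
  set Z := ∑ n ∈ Finset.range N, u n with hZ
  set V : ℕ → ℂ := fun n => ∑ h ∈ Finset.range H, u (n + h) with hV
  -- The sum is replaced by an average over windows of length `H`; each shift by `h < H` costs at
  -- most `2H` boundary terms.
  have hwindow : (H : ℝ) * ‖Z‖ ≤ ∑ n ∈ Finset.range N, ‖V n‖ + 2 * (H : ℝ) ^ 2 := by
    have e : (H : ℂ) * Z = ∑ n ∈ Finset.range N, V n -
        ∑ h ∈ Finset.range H, (∑ n ∈ Finset.range N, u (n + h) - Z) := by
      rw [Finset.sum_sub_distrib, Finset.sum_const, Finset.card_range, nsmul_eq_mul, hV,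
        Finset.sum_comm]
      ring
    have : (H : ℝ) * ‖Z‖ = ‖(H : ℂ) * Z‖ := by rw [norm_mul]; simp
    rw [this, e]
    refine (norm_sub_le _ _).trans (add_le_add (norm_sum_le _ _) ?_)
    refine (norm_sum_le_of_le _ (f := fun h => ∑ n ∈ Finset.range N, u (n + h) - Z)
      (n := fun _ => 2 * (H : ℝ)) fun h hh => ?_).trans ?_
    · refine (norm_sum_shift_sub_le hu N h).trans ?_
      have : (h : ℝ) ≤ H := by exact_mod_cast (Finset.mem_range.1 hh).le
      linarith
    · rw [Finset.sum_const, Finset.card_range, nsmul_eq_mul]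
      apply le_of_eq; ring
  have hcorr : ∀ h h' : ℕ, h' < H → h' ≤ h →
      ‖∑ n ∈ Finset.range N, u (n + h) * (starRingEnd ℂ) (u (n + h'))‖ ≤ S (h - h') + 2 * H := by
    intro h h' hh' hle
    have hv : ∀ n, ‖u (n + (h - h')) * (starRingEnd ℂ) (u n)‖ ≤ 1 := by
      intro n
      rw [norm_mul, RCLike.norm_conj]
      exact mul_le_one₀ (hu _) (norm_nonneg _) (hu _)
    have := norm_sum_shift_sub_le hv N h'
    have e : ∀ n, n + h' + (h - h') = n + h := fun n => by omega
    simp only [e] at this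
    have h1 : (h' : ℝ) ≤ H := by exact_mod_cast hh'.le
    have h2 := norm_le_norm_add_norm_sub'
      (∑ n ∈ Finset.range N, u (n + h) * (starRingEnd ℂ) (u (n + h')))
      (∑ n ∈ Finset.range N, u (n + (h - h')) * (starRingEnd ℂ) (u n))
    simp only [hS]
    linarith
  have hS0 : ∀ k, 0 ≤ S k := fun k => norm_nonneg _
  -- A one-sided version of the correlation at lag `h - h'`. The pair `G h h'`, `G h' h` covers both
  -- orders, the reversed order being reached by conjugation.
  set G : ℕ → ℕ → ℝ := fun h h' => if h' ≤ h then S (h - h') else 0 with hG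
  have hG0 : ∀ h h', 0 ≤ G h h' := fun h h' => by
    simp only [hG]; split_ifs <;> simp [hS0]
  have hcorr' : ∀ h ∈ Finset.range H, ∀ h' ∈ Finset.range H,
      ‖∑ n ∈ Finset.range N, u (n + h) * (starRingEnd ℂ) (u (n + h'))‖ ≤
        G h h' + G h' h + 2 * H := by
    intro h hh h' hh'
    rcases le_total h' h with hle | hle
    · have := hcorr h h' (Finset.mem_range.1 hh') hle
      have e : G h h' = S (h - h') := if_pos hle
      linarith [hG0 h' h]
    · have := hcorr h' h (Finset.mem_range.1 hh) hle
      rw [← RCLike.norm_conj, map_sum] at this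
      simp only [map_mul, RCLike.conj_conj] at this
      have e : ∀ n, (starRingEnd ℂ) (u (n + h')) * u (n + h) =
        u (n + h) * (starRingEnd ℂ) (u (n + h')) := fun n => mul_comm _ _
      simp only [e] at this
      have e : G h' h = S (h' - h) := if_pos hle
      linarith [hG0 h h']
  have hGsum : ∀ h ∈ Finset.range H, ∑ h' ∈ Finset.range H, G h h' ≤
      ∑ k ∈ Finset.range H, S k := by
    intro h hh
    have hh := Finset.mem_range.1 hh
    simp only [hG]
    rw [← Finset.sum_filter]
    have hf : (Finset.range H).filter (fun h' => h' ≤ h) = Finset.range (h + 1) := by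
      ext x; simp; omega
    rw [hf]
    have hr := Finset.sum_range_reflect S (h + 1)
    simp only [Nat.add_sub_cancel] at hr
    rw [hr]
    exact Finset.sum_le_sum_of_subset_of_nonneg (Finset.range_mono (by omega))
      fun k _ _ => hS0 k
  have hmoment : ∑ n ∈ Finset.range N, ‖V n‖ ^ 2 ≤
      2 * H * ∑ k ∈ Finset.range H, S k + 2 * (H : ℝ) ^ 3 := by
    have e : ((∑ n ∈ Finset.range N, ‖V n‖ ^ 2 : ℝ) : ℂ) = ∑ h ∈ Finset.range H,
        ∑ h' ∈ Finset.range H, ∑ n ∈ Finset.range N,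
          u (n + h) * (starRingEnd ℂ) (u (n + h')) := by
      have : ∀ n, ((‖V n‖ ^ 2 : ℝ) : ℂ) = ∑ h ∈ Finset.range H,
          ∑ h' ∈ Finset.range H, u (n + h) * (starRingEnd ℂ) (u (n + h')) := by
        intro n
        rw [← Finset.sum_mul_sum, ← map_sum]
        push_cast
        rw [← Complex.mul_conj']
      push_cast
      simp only [Complex.ofReal_pow] at this
      simp only [this]
      rw [Finset.sum_comm]
      refine Finset.sum_congr rfl fun h _ => ?_
      rw [Finset.sum_comm]
    have hpos : 0 ≤ ∑ n ∈ Finset.range N, ‖V n‖ ^ 2 := Finset.sum_nonneg fun _ _ => by positivity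
    rw [← Real.norm_of_nonneg hpos, ← Complex.norm_real, e]
    have b1 : ‖∑ h ∈ Finset.range H, ∑ h' ∈ Finset.range H, ∑ n ∈ Finset.range N,
          u (n + h) * (starRingEnd ℂ) (u (n + h'))‖ ≤ ∑ h ∈ Finset.range H,
        ∑ h' ∈ Finset.range H, (G h h' + G h' h + 2 * H) :=
      norm_sum_le_of_le _ fun h hh => norm_sum_le_of_le _ fun h' hh' => hcorr' h hh h' hh'
    refine b1.trans ?_
    simp only [Finset.sum_add_distrib, Finset.sum_const, Finset.card_range, nsmul_eq_mul]
    rw [Finset.sum_comm (f := fun h h' => G h' h)]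
    have b2 : ∑ h ∈ Finset.range H, ∑ h' ∈ Finset.range H, G h h' ≤
        H * ∑ k ∈ Finset.range H, S k := by
      refine (Finset.sum_le_sum hGsum).trans ?_
      rw [Finset.sum_const, Finset.card_range, nsmul_eq_mul]
    nlinarith
  have hcauchy : (∑ n ∈ Finset.range N, ‖V n‖) ^ 2 ≤ N * ∑ n ∈ Finset.range N, ‖V n‖ ^ 2 := by
    simpa using sq_sum_le_card_mul_sum_sq (s := Finset.range N) (f := fun n => ‖V n‖)
  have hcombined : ((H : ℝ) * ‖Z‖) ^ 2 ≤ 8 * (H : ℝ) ^ 4 +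
      2 * N * (2 * H * ∑ k ∈ Finset.range H, S k + 2 * (H : ℝ) ^ 3) := by
    have h0 : 0 ≤ (H : ℝ) * ‖Z‖ := by positivity
    have h1 : ((H : ℝ) * ‖Z‖) ^ 2 ≤ (∑ n ∈ Finset.range N, ‖V n‖ + 2 * (H : ℝ) ^ 2) ^ 2 :=
      pow_le_pow_left₀ h0 hwindow 2
    have h2 := mul_le_mul_of_nonneg_left hmoment (Nat.cast_nonneg (α := ℝ) N)
    nlinarith [sq_nonneg (∑ n ∈ Finset.range N, ‖V n‖ - 2 * (H : ℝ) ^ 2)]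
  have h2 : 0 < (H : ℝ) ^ 2 := by positivity
  refine le_of_mul_le_mul_left ?_ h2
  calc (H : ℝ) ^ 2 * ‖Z‖ ^ 2 = ((H : ℝ) * ‖Z‖) ^ 2 := by ring
    _ ≤ _ := hcombined
    _ = (H : ℝ) ^ 2 * (8 * (H : ℝ) ^ 2 + 4 * N * H +
        4 * N / H * ∑ h ∈ Finset.range H, S h) := by field_simp; ring

/-- **Van der Corput's difference theorem.** -/
lemma tendsto_cesaro_of_correlations {u : ℕ → ℂ} (hu : ∀ n, ‖u n‖ ≤ 1)
    (h : ∀ h : ℕ, 0 < h →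
      Tendsto (cesaro fun n => u (n + h) * (starRingEnd ℂ) (u n)) atTop (𝓝 0)) :
    Tendsto (cesaro u) atTop (𝓝 0) := by
  have hsq : Tendsto (fun N => ‖cesaro u N‖ ^ 2) atTop (𝓝 0) := by
    refine tendsto_zero_of_forall_eventually_le (fun N => by positivity) fun ε hε => ?_
    -- In the limit only the lag 0 contributes, and it contributes at most `4 / H`, which is below
    -- `ε`.
    obtain ⟨H, hH⟩ := exists_nat_gt (max 1 (16 / ε))
    have hH1 : (1 : ℝ) < H := (le_max_left _ _).trans_lt hH
    have hHε : 16 / ε < H := (le_max_right _ _).trans_lt hH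
    have hH0 : 0 < H := by
      have : (0 : ℝ) < H := by linarith
      exact_mod_cast this
    have hlim : Tendsto (fun N : ℕ => 8 * (H : ℝ) ^ 2 / N ^ 2 + 4 * H / N + 4 / H *
        (1 + ∑ k ∈ Finset.range (H - 1),
          ‖cesaro (fun n => u (n + (k + 1)) * (starRingEnd ℂ) (u n)) N‖)) atTop
        (𝓝 (0 + 0 + 4 / H * (1 + ∑ k ∈ Finset.range (H - 1), ‖(0 : ℂ)‖))) := by
      refine ((Tendsto.div_atTop tendsto_const_nhds ?_).add
        (Tendsto.div_atTop tendsto_const_nhds tendsto_natCast_atTop_atTop)).add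
        (tendsto_const_nhds.mul (tendsto_const_nhds.add
          (tendsto_finsetSum _ fun k _ => (h (k + 1) k.succ_pos).norm)))
      exact (tendsto_pow_atTop two_ne_zero).comp tendsto_natCast_atTop_atTop
    have hlt : 0 + 0 + 4 / (H : ℝ) * (1 + ∑ k ∈ Finset.range (H - 1), ‖(0 : ℂ)‖) < ε := by
      have : 4 / (H : ℝ) < ε := by
        rw [div_lt_iff₀ (by linarith)]
        rw [div_lt_iff₀ hε] at hHε
        linarith
      simpa using this
    filter_upwards [hlim.eventually (gt_mem_nhds hlt), eventually_gt_atTop 0] with N hN hN0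
    refine le_trans ?_ hN.le
    have hN' : (0 : ℝ) < N := by exact_mod_cast hN0
    have hvdc := vanDerCorput_inequality (u := fun n => u (n + 1)) (fun n => hu _) N hH0
    have e1 : ‖cesaro u N‖ = ‖∑ n ∈ Finset.range N, u (n + 1)‖ / N := by
      rw [norm_cesaro, sum_Icc_one_eq_sum_range]
    have e2 : ∀ k, ‖∑ n ∈ Finset.range N, u (n + k + 1) * (starRingEnd ℂ) (u (n + 1))‖ =
        N * ‖cesaro (fun n => u (n + k) * (starRingEnd ℂ) (u n)) N‖ := by
      intro k
      rw [norm_cesaro, sum_Icc_one_eq_sum_range, mul_div_cancel₀ _ hN'.ne']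
      simp only [add_right_comm _ 1 k]
    have e3 : ∑ h ∈ Finset.range H,
        ‖∑ n ∈ Finset.range N, u (n + h + 1) * (starRingEnd ℂ) (u (n + 1))‖ ≤
        N * (1 + ∑ k ∈ Finset.range (H - 1),
          ‖cesaro (fun n => u (n + (k + 1)) * (starRingEnd ℂ) (u n)) N‖) := by
      simp only [e2, ← Finset.mul_sum]
      gcongr
      obtain ⟨m, rfl⟩ := Nat.exists_eq_add_of_le' hH0
      rw [Finset.sum_range_succ', Nat.add_sub_cancel, add_comm]
      gcongr
      refine norm_cesaro_le zero_le_one (fun n => ?_) N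
      rw [norm_mul, RCLike.norm_conj]
      exact mul_le_one₀ (hu _) (norm_nonneg _) (hu _)
    rw [e1, div_pow, div_le_iff₀ (by positivity)]
    refine hvdc.trans ?_
    have e4 := mul_le_mul_of_nonneg_left e3 (by positivity : (0 : ℝ) ≤ 4 * N / H)
    refine (add_le_add_right e4 _).trans (le_of_eq ?_)
    field_simp
  have := hsq.sqrt
  simp only [Real.sqrt_sq (norm_nonneg _), Real.sqrt_zero] at this
  exact tendsto_zero_iff_norm_tendsto_zero.2 this

/-- If the normalized sums over all long dyadic blocks `(A, 2A]` are small, then the Cesàro means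
tend to zero. -/
lemma tendsto_cesaro_of_dyadic {u : ℕ → ℂ} (hu : ∀ n, ‖u n‖ ≤ 1)
    (h : ∀ ε > 0, ∀ᶠ A : ℕ in atTop, ‖∑ n ∈ Finset.range A, u (A + 1 + n)‖ ≤ ε * A) :
    Tendsto (cesaro u) atTop (𝓝 0) := by
  rw [tendsto_zero_iff_norm_tendsto_zero]
  refine tendsto_zero_of_forall_eventually_le (fun N => by positivity) fun ε hε => ?_
  obtain ⟨A₀, hA₀⟩ := eventually_atTop.1 (h (ε / 4) (by positivity))
  obtain ⟨A₁, hA₁⟩ := exists_nat_gt (4 / ε)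
  set B := max (max A₀ A₁) 1 with hB
  set S : ℕ → ℂ := fun N => ∑ n ∈ Finset.range N, u (n + 1) with hS
  -- Strong induction by halving: up to one leftover term, the sum to `N` is the sum to `A = N / 2`
  -- plus the block `(A, 2A]`. The block and the leftover cost at most `ε A / 4` each, which the
  -- linear term pays for.
  have key : ∀ N, ‖S N‖ ≤ 2 * B + ε / 2 * N := by
    intro N
    induction N using Nat.strong_induction_on with
    | _ N ih =>
      by_cases hN : N < 2 * B
      · have : ‖S N‖ ≤ N := by
          refine (norm_sum_le_of_le _ (n := fun _ => (1 : ℝ)) fun n _ => hu _).trans ?_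
          simp
        have h2 : (N : ℝ) ≤ 2 * B := by exact_mod_cast hN.le
        have : 0 ≤ ε / 2 * N := by positivity
        linarith
      · push Not at hN
        have hB1 : 1 ≤ B := le_max_right _ _
        obtain ⟨A, r, hr, hNA⟩ : ∃ A r, r ≤ 1 ∧ N = A + A + r :=
          ⟨N / 2, N % 2, by omega, by omega⟩
        have hAB : B ≤ A := by omega
        have hA := hA₀ A (((le_max_left _ _).trans (le_max_left _ _)).trans hAB)
        have hsplit : ‖S N‖ ≤ ‖S A‖ + ε / 4 * A + 1 := by
          have e : S (A + A) = S A + ∑ n ∈ Finset.range A, u (A + 1 + n) := by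
            simp only [hS]
            rw [Finset.sum_range_add]
            congr 1
            refine Finset.sum_congr rfl fun n _ => ?_
            congr 1; ring
          have e2 : ‖S (A + A)‖ ≤ ‖S A‖ + ε / 4 * A := by
            rw [e]; exact (norm_add_le _ _).trans (by gcongr)
          interval_cases r
          · rw [hNA, add_zero]; linarith
          · rw [hNA]
            simp only [hS] at e2 ⊢
            rw [Finset.sum_range_succ]
            refine (norm_add_le _ _).trans ?_
            linarith [hu (A + A + 1)]
        have hih := ih A (by omega)
        have hA1 : (A₁ : ℝ) ≤ A := by
          exact_mod_cast ((le_max_right A₀ A₁).trans (le_max_left _ _)).trans hAB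
        have h1 : 1 ≤ ε / 4 * A := by
          have : 4 / ε < A := by linarith
          rw [div_lt_iff₀ hε] at this
          linarith
        have h2 : (2 : ℝ) * A ≤ N := by
          have : 2 * A ≤ N := by omega
          exact_mod_cast this
        nlinarith
  have hlim : Tendsto (fun N : ℕ => 2 * (B : ℝ) / N + ε / 2) atTop (𝓝 (0 + ε / 2)) :=
    (Tendsto.div_atTop tendsto_const_nhds tendsto_natCast_atTop_atTop).add tendsto_const_nhds
  filter_upwards [hlim.eventually (gt_mem_nhds (show 0 + ε / 2 < ε by linarith)),
    eventually_gt_atTop 0] with N hN hN0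
  have hN' : (0 : ℝ) < N := by exact_mod_cast hN0
  refine le_trans ?_ hN.le
  rw [norm_cesaro, sum_Icc_one_eq_sum_range, div_add' _ _ _ hN'.ne']
  gcongr
  exact key N

/-- Shifting the index by one multiplies the terms asymptotically by `e(α)` but does not change
Cesàro means in the limit. So `e(α) - 1`, which is nonzero, annihilates the limit. -/
lemma tendsto_cesaro_unitExp_of_sub_tendsto {b : ℕ → ℝ} {α : ℝ} (hα : ∀ k : ℤ, α ≠ k)
    (h : Tendsto (fun n => b (n + 1) - b n) atTop (𝓝 α)) :
    Tendsto (cesaro fun n => unitExp (b n)) atTop (𝓝 0) := by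
  have h1 : unitExp α - 1 ≠ 0 := by
    rw [sub_ne_zero]
    intro h
    obtain ⟨k, hk⟩ := unitExp_eq_one_iff.1 h
    exact hα k hk
  have hA : Tendsto (cesaro fun n => unitExp (b (n + 1)) - unitExp α * unitExp (b n)) atTop
      (𝓝 0) := by
    apply tendsto_cesaro_of_tendsto
    rw [tendsto_zero_iff_norm_tendsto_zero]
    have h2 : Tendsto (fun n => ‖unitExp (b (n + 1) - b n) - unitExp α‖) atTop (𝓝 0) := by
      simpa using ((continuous_unitExp.tendsto α).comp h).sub_const (unitExp α) |>.norm
    refine h2.congr fun n => ?_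
    have : unitExp (b (n + 1)) = unitExp (b (n + 1) - b n) * unitExp (b n) := by
      rw [← unitExp_add]; simp
    rw [this, ← sub_mul, norm_mul, norm_unitExp, mul_one]
  have hB : Tendsto (cesaro fun n => unitExp (b (n + 1)) - unitExp (b n)) atTop (𝓝 0) := by
    rw [tendsto_zero_iff_norm_tendsto_zero]
    have : Tendsto (fun N : ℕ => 2 / (N : ℝ)) atTop (𝓝 0) :=
      Tendsto.div_atTop tendsto_const_nhds tendsto_natCast_atTop_atTop
    refine squeeze_zero (fun N => norm_nonneg _) (fun N => ?_) this
    rw [norm_cesaro, sum_Icc_one_eq_sum_range, Finset.sum_sub_distrib]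
    gcongr
    simpa using norm_sum_shift_sub_le (u := fun n => unitExp (b (n + 1)))
      (fun n => (norm_unitExp _).le) N 1
  have hC := (hB.sub hA).const_mul (unitExp α - 1)⁻¹
  rw [sub_zero, mul_zero] at hC
  refine hC.congr fun N => ?_
  rw [← cesaro_sub]
  have : ∀ n, unitExp (b (n + 1)) - unitExp (b n) -
      (unitExp (b (n + 1)) - unitExp α * unitExp (b n)) = (unitExp α - 1) * unitExp (b n) :=
    fun n => by ring
  simp only [this]
  rw [cesaro_const_mul, inv_mul_cancel_left₀ h1]

lemma tendsto_cesaro_unitExp_neg {b : ℕ → ℝ}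
    (h : Tendsto (cesaro fun n => unitExp (-b n)) atTop (𝓝 0)) :
    Tendsto (cesaro fun n => unitExp (b n)) atTop (𝓝 0) := by
  have := (Complex.continuous_conj.tendsto 0).comp h
  rw [map_zero] at this
  refine this.congr fun N => ?_
  rw [Function.comp_apply, ← cesaro_star]
  simp only [star_unitExp, neg_neg]

/-! ### First and second derivative tests for exponential sums -/

namespace IsHardyRing

variable {R : Set (ℝ → ℝ)} (hR : IsHardyRing R) {b f : ℝ → ℝ}
include hR

lemma exists_antitoneOn (hf : f ∈ R) (hpos : ∀ᶠ x in atTop, 0 < f x)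
    (hlim : Tendsto f atTop (𝓝 0)) : ∃ X, AntitoneOn f (Set.Ici X) := by
  have : ∀ᶠ x in atTop, _root_.deriv f x ≤ 0 := by
    rcases hR.sign (hR.deriv hf) with h | h | h
    · exact h.mono fun x hx => hx.le
    · exfalso
      obtain ⟨X, hX⟩ := eventually_monotoneOn_of_deriv_nonneg (hR.diff hf) (h.mono fun x h => h.le)
      obtain ⟨Y, hY, hY'⟩ := (hpos.and (eventually_ge_atTop X)).exists
      have h1 : ∀ᶠ x in atTop, f Y ≤ f x := by
        filter_upwards [eventually_ge_atTop Y] with x hx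
        exact hX (Set.mem_Ici.2 hY') (Set.mem_Ici.2 (hY'.trans hx)) hx
      exact absurd (ge_of_tendsto hlim h1) (not_le.2 hY)
    · exact h.mono fun x hx => hx.le
  obtain ⟨X, hX⟩ := eventually_monotoneOn_of_deriv_nonneg (hR.diff (hR.neg hf))
    (this.mono fun x hx => by rw [deriv.fun_neg]; linarith)
  exact ⟨X, fun x hx y hy hxy => by simpa using hX hx hy hxy⟩

/-- The derivative decreases to 0, so the increments up to `N` decrease and are at least `b'(N +
1)`. Kusmin–Landau bounds the sum by `1 / b'(N + 1)` up to a constant number of initial terms, and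
dividing by `N` leaves a quantity of order `1 / (N b'(N + 1))`. -/
lemma tendsto_cesaro_of_deriv_pos (hb : b ∈ R) (hpos : ∀ᶠ x in atTop, 0 < _root_.deriv b x)
    (h0 : Tendsto (_root_.deriv b) atTop (𝓝 0))
    (hinf : Tendsto (fun x => |x * _root_.deriv b x|) atTop atTop) :
    Tendsto (cesaro fun n => unitExp (b n)) atTop (𝓝 0) := by
  obtain ⟨X, hX⟩ := hR.exists_antitoneOn (hR.deriv hb) hpos h0
  obtain ⟨Y, hY⟩ := eventually_atTop.1 (hpos.and ((eventually_exists_deriv_eq_slope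
    (hR.diff hb)).and (h0.eventually (gt_mem_nhds (show (0 : ℝ) < 1 / 2 by norm_num)))))
  obtain ⟨m, hm⟩ := exists_nat_ge (max X Y)
  have hmX : X ≤ m := (le_max_left _ _).trans hm
  have hmY : Y ≤ m := (le_max_right _ _).trans hm
  have hmvt : ∀ n : ℕ, m ≤ n → ∃ y : ℝ, (n : ℝ) < y ∧ y < n + 1 ∧
      b ((n + 1 : ℕ) : ℝ) - b n = _root_.deriv b y := by
    intro n hn
    obtain ⟨y, h1, h2, h3⟩ := (hY n (hmY.trans (by exact_mod_cast hn))).2.1 1 one_pos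
    exact ⟨y, h1, h2, by push_cast; rw [h3, one_mul]⟩
  have hbound : ∀ N : ℕ, m + 1 ≤ N → ‖cesaro (fun n => unitExp (b n)) N‖ ≤
      m / N + 2 / |((N + 1 : ℕ) : ℝ) * _root_.deriv b (N + 1 : ℕ)| := by
    intro N hN
    have hN0 : (1 : ℝ) ≤ N := by exact_mod_cast (by omega : 1 ≤ N)
    have hbpos : 0 < _root_.deriv b (N + 1 : ℕ) := (hY _ (hmY.trans (by
      exact_mod_cast (by omega : m ≤ N + 1)))).1
    have hkl := norm_sum_unitExp_le (b := fun n => b ((m + n + 1 : ℕ) : ℝ)) (N := N - m)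
      (δ := _root_.deriv b (N + 1 : ℕ)) hbpos ?_ ?_ ?_
    · rw [norm_cesaro, sum_Icc_one_eq_sum_range]
      have hs : N = m + (N - m) := by omega
      have e : ‖∑ n ∈ Finset.range N, unitExp (b ((n + 1 : ℕ) : ℝ))‖ ≤
          m + 1 / _root_.deriv b (N + 1 : ℕ) := by
        conv_lhs => rw [hs, Finset.sum_range_add]
        refine (norm_add_le _ _).trans (add_le_add ?_ hkl)
        refine (norm_sum_le_of_le _ (n := fun _ => (1 : ℝ)) fun n _ => (norm_unitExp _).le).trans ?_
        simp
      refine (div_le_div_of_nonneg_right e (by positivity)).trans ?_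
      rw [add_div, abs_of_nonneg (by positivity)]
      refine add_le_add le_rfl ?_
      rw [div_div, div_le_div_iff₀ (by positivity) (by positivity)]
      push_cast at hbpos ⊢
      nlinarith
    · intro n hn
      obtain ⟨y, h1, h2, h3⟩ := hmvt (m + n + 1) (by omega)
      rw [show m + (n + 1) + 1 = m + n + 1 + 1 by ring, h3]
      have hy : (m : ℝ) ≤ y := le_trans (by push_cast; linarith [Nat.cast_nonneg (α := ℝ) n]) h1.le
      refine hX (Set.mem_Ici.2 (hmX.trans hy)) (Set.mem_Ici.2 (hmX.trans ?_)) ?_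
      · exact_mod_cast (by omega : m ≤ N + 1)
      · have : ((m + n + 1 : ℕ) : ℝ) + 1 ≤ (N + 1 : ℕ) := by
          exact_mod_cast (by omega : m + n + 1 + 1 ≤ N + 1)
        linarith
    · intro n hn
      obtain ⟨y, h1, h2, h3⟩ := hmvt (m + n + 1) (by omega)
      rw [show m + (n + 1) + 1 = m + n + 1 + 1 by ring, h3]
      have hy : (m : ℝ) ≤ y := le_trans (by push_cast; linarith [Nat.cast_nonneg (α := ℝ) n]) h1.le
      exact (hY y (hmY.trans hy)).2.2.le
    · intro n hn
      obtain ⟨y, h1, h2, h3⟩ := hmvt (m + n + 1) (by omega)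
      obtain ⟨z, k1, k2, k3⟩ := hmvt (m + n + 1 + 1) (by omega)
      rw [show m + (n + 2) + 1 = m + n + 1 + 1 + 1 by ring,
        show m + (n + 1) + 1 = m + n + 1 + 1 by ring, h3, k3]
      have hy : (m : ℝ) ≤ y := le_trans (by push_cast; linarith [Nat.cast_nonneg (α := ℝ) n]) h1.le
      have hyz : y ≤ z := by push_cast at h2 k1; linarith
      exact hX (Set.mem_Ici.2 (hmX.trans hy)) (Set.mem_Ici.2 (hmX.trans (hy.trans hyz))) hyz
  rw [tendsto_zero_iff_norm_tendsto_zero]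
  have hlim : Tendsto (fun N : ℕ => (m : ℝ) / N + 2 / |((N + 1 : ℕ) : ℝ) *
      _root_.deriv b (N + 1 : ℕ)|) atTop (𝓝 (0 + 0)) := by
    refine (Tendsto.div_atTop tendsto_const_nhds tendsto_natCast_atTop_atTop).add
      (Tendsto.div_atTop tendsto_const_nhds ?_)
    exact hinf.comp (tendsto_natCast_atTop_atTop.comp (tendsto_add_atTop_nat 1))
  rw [add_zero] at hlim
  refine squeeze_zero' (Eventually.of_forall fun N => norm_nonneg _) ?_ hlim
  filter_upwards [eventually_ge_atTop (m + 1)] with N hN using hbound N hN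

/-- Exponential sums of slowly growing functions. -/
lemma tendsto_cesaro_of_deriv_tendsto_zero (hb : b ∈ R)
    (h0 : Tendsto (_root_.deriv b) atTop (𝓝 0))
    (hinf : Tendsto (fun x => |x * _root_.deriv b x|) atTop atTop) :
    Tendsto (cesaro fun n => unitExp (b n)) atTop (𝓝 0) := by
  rcases hR.sign (hR.deriv hb) with h | h | h
  · exfalso
    obtain ⟨x, h1, h2⟩ := (h.and (hinf.eventually (eventually_gt_atTop 0))).exists
    simp [h1] at h2
  · exact hR.tendsto_cesaro_of_deriv_pos hb h h0 hinf
  · have hd : _root_.deriv (fun x => -b x) = fun x => - _root_.deriv b x := by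
      ext x; exact deriv.fun_neg
    have hneg := hR.tendsto_cesaro_of_deriv_pos (b := fun x => -b x) (hR.neg hb)
      (by rw [hd]; exact h.mono fun x hx => neg_pos.2 hx)
      (by rw [hd]; simpa using h0.neg) (by rw [hd]; simpa using hinf)
    exact tendsto_cesaro_unitExp_neg (b := fun n => b n) hneg

/-- An eventual bound `x² f' ≤ C` would make `f + C / x` eventually nonincreasing, against its
divergence to infinity. Applied to a first derivative, this is the lower bound on the second
derivative that the van der Corput method needs. -/
lemma tendsto_sq_mul_of_deriv (hf : f ∈ R) (hinf : Tendsto f atTop atTop) :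
    Tendsto (fun x => x ^ 2 * _root_.deriv f x) atTop atTop := by
  have hmem : (fun x => x ^ 2 * _root_.deriv f x) ∈ R := hR.mul (hR.pow 2) (hR.deriv hf)
  have hnb : ∀ C : ℝ, ¬ ∀ᶠ x in atTop, x ^ 2 * _root_.deriv f x ≤ C := by
    intro C hC
    have hder : ∀ᶠ x in atTop, HasDerivAt (fun x => -(f x + C / x))
        (-(_root_.deriv f x + C * (-(x ^ 2)⁻¹))) x := by
      filter_upwards [hR.diff hf, eventually_gt_atTop 0] with x hx h0
      simpa [div_eq_mul_inv] using! (hx.hasDerivAt.add ((hasDerivAt_inv h0.ne').const_mul C)).neg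
    obtain ⟨X, hX⟩ := eventually_monotoneOn_of_deriv_nonneg
      (hder.mono fun x hx => hx.differentiableAt) (by
        filter_upwards [hder, hC, eventually_gt_atTop 0] with x hx hx' h0
        rw [hx.deriv]
        have : _root_.deriv f x ≤ C * (x ^ 2)⁻¹ := by
          rw [← div_eq_mul_inv, le_div_iff₀ (by positivity)]; linarith
        linarith)
    have hlim : Tendsto (fun x => f x + C / x) atTop atTop :=
      hinf.atTop_add (Tendsto.div_atTop tendsto_const_nhds tendsto_id)
    obtain ⟨x, h1, h2⟩ := ((hlim.eventually (eventually_gt_atTop (f X + C / X))).and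
      (eventually_ge_atTop X)).exists
    have := hX (Set.mem_Ici.2 le_rfl) (Set.mem_Ici.2 h2) h2
    simp only at this
    linarith
  rcases hR.tendsto_trichotomy hmem with ⟨l, hl⟩ | h | h
  · exact absurd ((hl.eventually (gt_mem_nhds (lt_add_one l))).mono fun x hx => hx.le) (hnb _)
  · exact h
  · exact absurd (h.eventually (eventually_le_atBot 0)) (hnb 0)

/-- The product `x³ f` tends to infinity and its derivative has a sign, which cannot be negative.
The monotonicity acts as a doubling property: moving from `A` to a point of size at most `4A` costs
at most a factor 64 in `f`. -/
lemma exists_monotoneOn_cube_mul (hf : f ∈ R)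
    (hinf : Tendsto (fun x => x ^ 2 * f x) atTop atTop) :
    ∃ X, MonotoneOn (fun x => x ^ 3 * f x) (Set.Ici X) := by
  have hmem : (fun x => x ^ 3 * f x) ∈ R := hR.mul (hR.pow 3) hf
  have hinf3 : Tendsto (fun x => x ^ 3 * f x) atTop atTop := by
    refine (tendsto_id.atTop_mul_atTop₀ hinf).congr fun x => ?_
    simp only [_root_.id]; ring
  refine eventually_monotoneOn_of_deriv_nonneg (hR.diff hmem) ?_
  rcases hR.sign (hR.deriv hmem) with h | h | h
  · exact h.mono fun x hx => hx.ge
  · exact h.mono fun x hx => hx.le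
  · exfalso
    obtain ⟨X, hX⟩ := eventually_monotoneOn_of_deriv_nonneg (hR.diff (hR.neg hmem))
      (h.mono fun x hx => by rw [deriv.fun_neg]; linarith)
    obtain ⟨x, h1, h2⟩ := ((hinf3.eventually (eventually_gt_atTop (X ^ 3 * f X))).and
      (eventually_ge_atTop X)).exists
    have := hX (Set.mem_Ici.2 le_rfl) (Set.mem_Ici.2 h2) h2
    simp only at this
    linarith

/-- Second differences in terms of the second derivative. -/
lemma correlation_bound (hb : b ∈ R) (hpos : ∀ᶠ x in atTop, 0 < _root_.deriv (_root_.deriv b) x)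
    (h0 : Tendsto (_root_.deriv (_root_.deriv b)) atTop (𝓝 0))
    (hinf : Tendsto (_root_.deriv b) atTop atTop) :
    ∀ᶠ A : ℕ in atTop, ∀ h : ℕ, 0 < h → h ≤ A →
      h * _root_.deriv (_root_.deriv b) A ≤ 1 / 2 →
      ‖∑ n ∈ Finset.range A, unitExp (b ((A + 1 + n + h : ℕ) : ℝ)) *
        (starRingEnd ℂ) (unitExp (b ((A + 1 + n : ℕ) : ℝ)))‖ ≤
        64 / (h * _root_.deriv (_root_.deriv b) A) := by
  set g := _root_.deriv b with hg
  set lam := _root_.deriv g with hlam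
  have hgR : g ∈ R := hR.deriv hb
  have hlR : lam ∈ R := hR.deriv hgR
  have hsq := hR.tendsto_sq_mul_of_deriv hgR hinf
  obtain ⟨X₁, hX₁⟩ := hR.exists_antitoneOn hlR hpos h0
  obtain ⟨X₂, hX₂⟩ := hR.exists_monotoneOn_cube_mul hlR hsq
  obtain ⟨X₃, hX₃⟩ := eventually_atTop.1 (hpos.and ((eventually_exists_deriv_eq_slope
    (hR.diff hgR)).and ((hR.diff hb).and (hR.diff hgR))))
  filter_upwards [eventually_ge_atTop ⌈max (max X₁ X₂) X₃⌉₊, eventually_gt_atTop 0] with A hA hA0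
  have hA' : max (max X₁ X₂) X₃ ≤ A := Nat.ceil_le.1 hA
  have hA1 : X₁ ≤ A := ((le_max_left _ _).trans (le_max_left _ _)).trans hA'
  have hA2 : X₂ ≤ A := ((le_max_right _ _).trans (le_max_left _ _)).trans hA'
  have hA3 : X₃ ≤ A := (le_max_right _ _).trans hA'
  have hAp : (1 : ℝ) ≤ A := by exact_mod_cast hA0
  intro h hh hhA hhl
  have hhp : (0 : ℝ) < h := by exact_mod_cast hh
  have hhA' : (h : ℝ) ≤ A := by exact_mod_cast hhA
  have hlA : 0 < lam A := (hX₃ A hA3).1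
  set D : ℝ → ℝ := fun x => b (x + h) - b x with hD
  have hDd : ∀ x, (A : ℝ) ≤ x → HasDerivAt D (g (x + h) - g x) x := by
    intro x hx
    have h1 := (hX₃ (x + h) (by linarith)).2.2.1.hasDerivAt.comp_add_const x h
    exact h1.sub (hX₃ x (by linarith)).2.2.1.hasDerivAt
  have hD2 : ∀ x, (A : ℝ) ≤ x → HasDerivAt (fun x => g (x + h) - g x) (lam (x + h) - lam x) x := by
    intro x hx
    have h1 := (hX₃ (x + h) (by linarith)).2.2.2.hasDerivAt.comp_add_const x h
    exact h1.sub (hX₃ x (by linarith)).2.2.2.hasDerivAt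
  have hDanti : AntitoneOn (fun x => g (x + h) - g x) (Set.Ici (A : ℝ)) := by
    refine antitoneOn_of_deriv_nonpos (convex_Ici _)
      (fun x hx => (hD2 x hx).continuousAt.continuousWithinAt)
      (fun x hx => (hD2 x (interior_subset hx)).differentiableAt.differentiableWithinAt) ?_
    intro x hx
    have hx' : (A : ℝ) ≤ x := interior_subset hx
    rw [(hD2 x hx').deriv]
    have := hX₁ (Set.mem_Ici.2 (hA1.trans hx')) (Set.mem_Ici.2 (show X₁ ≤ x + h by linarith))
      (show x ≤ x + h by linarith)
    linarith
  have hDs : ∀ x, (A : ℝ) ≤ x → ∃ y, x < y ∧ y < x + 1 ∧ D (x + 1) - D x = g (y + h) - g y := by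
    intro x hx
    obtain ⟨y, hy, hy'⟩ := exists_hasDerivAt_eq_slope D (fun x => g (x + h) - g x)
      (show x < x + 1 by linarith)
      (fun z hz => (hDd z (hx.trans hz.1)).continuousAt.continuousWithinAt)
      (fun z hz => hDd z (hx.trans hz.1.le))
    refine ⟨y, hy.1, hy.2, ?_⟩
    rw [hy']; simp
  have hgs : ∀ y, (A : ℝ) ≤ y → ∃ z, y < z ∧ z < y + h ∧ g (y + h) - g y = h * lam z :=
    fun y hy => (hX₃ y (hA3.trans hy)).2.1 h hhp
  have hcast : ∀ n : ℕ, b ((A + 1 + n + h : ℕ) : ℝ) - b ((A + 1 + n : ℕ) : ℝ) =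
      D ((A + 1 + n : ℕ) : ℝ) := by
    intro n; simp only [hD]; push_cast; rfl
  have hcast1 : ∀ n : ℕ, ((A + 1 + (n + 1) : ℕ) : ℝ) = ((A + 1 + n : ℕ) : ℝ) + 1 := by
    intro n; push_cast; ring
  have hcast2 : ∀ n : ℕ, (A : ℝ) ≤ ((A + 1 + n : ℕ) : ℝ) := by
    intro n; exact_mod_cast (by omega)
  simp only [← unitExp_sub, hcast]
  -- Kusmin–Landau for the differenced phase, whose increments are `h * lam z` with `A ≤ z ≤ 4A`.
  -- The factor `64 = 4³` is the loss from monotonicity of `x³ lam x`.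
  have hkl := norm_sum_unitExp_le (b := fun n => D ((A + 1 + n : ℕ) : ℝ)) (N := A)
    (δ := h * lam A / 64) (by positivity) ?_ ?_ ?_
  · refine hkl.trans (le_of_eq ?_)
    field_simp
  · intro n hn
    rw [hcast1]
    obtain ⟨y, hy1, hy2, hy3⟩ := hDs _ (hcast2 n)
    obtain ⟨z, hz1, hz2, hz3⟩ := hgs y ((hcast2 n).trans hy1.le)
    have hAz : (A : ℝ) ≤ z := ((hcast2 n).trans hy1.le).trans hz1.le
    have hz4 : z ≤ 4 * A := by
      have : ((A + 1 + n : ℕ) : ℝ) ≤ A + A := by exact_mod_cast (by omega : A + 1 + n ≤ A + A)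
      linarith
    rw [hy3, hz3]
    have hm := hX₂ (Set.mem_Ici.2 hA2) (Set.mem_Ici.2 (hA2.trans hAz)) hAz
    simp only at hm
    have hlz : 0 < lam z := (hX₃ z (hA3.trans hAz)).1
    have hz3' : z ^ 3 ≤ (4 * A) ^ 3 := pow_le_pow_left₀ (by linarith) hz4 3
    have h2 : (A : ℝ) ^ 3 * lam A ≤ (A : ℝ) ^ 3 * (64 * lam z) := by
      refine hm.trans ((mul_le_mul_of_nonneg_right hz3' hlz.le).trans (le_of_eq ?_))
      ring
    have h3 := le_of_mul_le_mul_left h2 (by positivity)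
    have h4 := mul_le_mul_of_nonneg_left h3 hhp.le
    linarith
  · intro n hn
    rw [hcast1]
    obtain ⟨y, hy1, hy2, hy3⟩ := hDs _ (hcast2 n)
    obtain ⟨z, hz1, hz2, hz3⟩ := hgs y ((hcast2 n).trans hy1.le)
    have hAz : (A : ℝ) ≤ z := ((hcast2 n).trans hy1.le).trans hz1.le
    rw [hy3, hz3]
    have := hX₁ (Set.mem_Ici.2 hA1) (Set.mem_Ici.2 (hA1.trans hAz)) hAz
    exact (mul_le_mul_of_nonneg_left this hhp.le).trans hhl
  · intro n hn
    rw [show n + 2 = n + 1 + 1 by ring, hcast1 (n + 1), hcast1 n]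
    obtain ⟨y, hy1, hy2, hy3⟩ := hDs _ (hcast2 n)
    obtain ⟨z, hz1, hz2, hz3⟩ := hDs (((A + 1 + n : ℕ) : ℝ) + 1) (by linarith [hcast2 n])
    rw [hy3, hz3]
    exact hDanti (Set.mem_Ici.2 ((hcast2 n).trans hy1.le))
      (Set.mem_Ici.2 (by linarith [hcast2 n])) (by linarith)

end IsHardyRing

namespace IsHardyRing

variable {R : Set (ℝ → ℝ)} (hR : IsHardyRing R) {b f : ℝ → ℝ}
include hR

-- On each dyadic block van der Corput's inequality is applied with `H` shifts. Lags below `ε H` are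
-- bounded trivially and the others by Kusmin–Landau. The choice of `H` is possible because the
-- second derivative `lam` tends to 0 while `x² lam x` tends to infinity.
set_option maxHeartbeats 1000000 in
lemma tendsto_cesaro_of_deriv_deriv_pos (hb : b ∈ R)
    (hpos : ∀ᶠ x in atTop, 0 < _root_.deriv (_root_.deriv b) x)
    (h0 : Tendsto (_root_.deriv (_root_.deriv b)) atTop (𝓝 0))
    (hinf : Tendsto (_root_.deriv b) atTop atTop) :
    Tendsto (cesaro fun n => unitExp (b n)) atTop (𝓝 0) := by
  refine tendsto_cesaro_of_dyadic (fun n => (norm_unitExp _).le) fun ε₀ hε₀ => ?_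
  have hcb := hR.correlation_bound hb hpos h0 hinf
  have hsq := hR.tendsto_sq_mul_of_deriv (hR.deriv hb) hinf
  set lam := _root_.deriv (_root_.deriv b) with hlam
  -- The constant is `21 = 8 + 4 + 4 + 4 + 1`, one term for each of the five error terms collected
  -- at the end.
  obtain ⟨ε, hε, hε1, hεε⟩ : ∃ ε : ℝ, 0 < ε ∧ ε ≤ 1 ∧ 21 * ε ≤ ε₀ ^ 2 :=
    ⟨min 1 (ε₀ ^ 2 / 21), lt_min one_pos (by positivity), min_le_left _ _, by
      have := min_le_right 1 (ε₀ ^ 2 / 21); linarith⟩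
  -- The first summand forces `1 / H ≤ ε`, the second makes `H * lam A * A` at least `256 / ε²`, and
  -- the last keeps `M ≥ 2` so that rounding down loses at most a factor 2.
  set M : ℝ := 2 / ε + 1024 / ε ^ 3 + 2 with hM
  have hMpos : 2 ≤ M := by
    have : 0 < 2 / ε + 1024 / ε ^ 3 := by positivity
    linarith
  have hcast := tendsto_natCast_atTop_atTop (R := ℝ)
  have hlam_small : ∀ᶠ A : ℕ in atTop, lam A < 1 / (2 * M) :=
    (h0.comp hcast).eventually (gt_mem_nhds (by positivity))
  filter_upwards [hcb, hlam_small, hcast.eventually hpos,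
    (hsq.comp hcast).eventually (eventually_ge_atTop M), eventually_ge_atTop ⌈M / ε⌉₊]
    with A hA hAl hAp hAsq hAM
  simp only [Function.comp_apply] at hAsq hAp
  have hAM' : M ≤ ε * A := by
    have := Nat.ceil_le.1 hAM
    rwa [div_le_iff₀ hε, mul_comm] at this
  have hA0 : (0 : ℝ) < A := by
    by_contra hneg
    nlinarith
  set L := lam A with hL
  have hLM : M ≤ 1 / (2 * L) := by
    rw [le_div_iff₀ (by positivity)]
    rw [lt_div_iff₀ (by positivity)] at hAl
    linarith
  set q := min (ε * A) (1 / (2 * L)) with hq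
  have hqM : M ≤ q := le_min hAM' hLM
  obtain ⟨H, hHq, hqH⟩ : ∃ H : ℕ, (H : ℝ) ≤ q ∧ q ≤ 2 * H := by
    refine ⟨⌊q⌋₊, Nat.floor_le (by linarith), ?_⟩
    have := Nat.lt_floor_add_one q
    linarith
  have hHM : M / 2 ≤ H := by linarith
  have hH0 : (0 : ℝ) < H := by linarith
  have hHN : 0 < H := by exact_mod_cast hH0
  have hHA : (H : ℝ) ≤ ε * A := hHq.trans (min_le_left _ _)
  have hHL : (H : ℝ) * L ≤ 1 / 2 := by
    have := hHq.trans (min_le_right _ _)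
    rw [le_div_iff₀ (by positivity)] at this
    linarith
  have hHle : H ≤ A := by
    have : (H : ℝ) ≤ A := hHA.trans (by nlinarith)
    exact_mod_cast this
  have hHinv : 1 / (H : ℝ) ≤ ε := by
    rw [div_le_iff₀ hH0]
    have : 2 / ε ≤ M := by
      have : 0 < 1024 / ε ^ 3 := by positivity
      linarith
    have h2 : 1 / ε ≤ H := by
      have : 1 / ε = 2 / ε / 2 := by ring
      linarith
    rw [div_le_iff₀ hε] at h2
    linarith
  have hHLA : 256 / ε ^ 2 ≤ H * L * A := by
    have h1 : 1024 / ε ^ 3 ≤ M := by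
      have : 0 < 2 / ε := by positivity
      linarith
    have h2 : q * (L * A) ≤ 2 * (H * L * A) := by
      have := mul_le_mul_of_nonneg_right hqH (by positivity : 0 ≤ L * A)
      linarith
    have h3 : 512 / ε ^ 2 ≤ q * (L * A) := by
      have e1 : 1024 / ε ^ 3 = 1024 / ε ^ 2 / ε := by field_simp
      have e2 : 1024 / ε ^ 2 ≤ ε * M := by
        rw [e1, div_le_iff₀ hε] at h1; linarith
      rcases min_choice (ε * A) (1 / (2 * L)) with hc | hc
      · rw [hq, hc]
        have : ε * M ≤ ε * A * (L * A) := by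
          have := mul_le_mul_of_nonneg_left hAsq hε.le
          linarith
        have e3 : 512 / ε ^ 2 ≤ 1024 / ε ^ 2 := by gcongr; norm_num
        linarith
      · rw [hq, hc]
        have : 1 / (2 * L) * (L * A) = A / 2 := by field_simp
        rw [this]
        have e3 : 512 / ε ^ 2 = 1024 / ε ^ 2 / 2 := by ring
        have e4 : ε * M ≤ A := by nlinarith
        linarith
    have e5 : 512 / ε ^ 2 = 2 * (256 / ε ^ 2) := by ring
    linarith
  have hvdc := vanDerCorput_inequality (u := fun n => unitExp (b ((A + 1 + n : ℕ) : ℝ)))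
    (fun n => (norm_unitExp _).le) A hHN
  set S : ℕ → ℝ := fun h => ‖∑ n ∈ Finset.range A, unitExp (b ((A + 1 + (n + h) : ℕ) : ℝ)) *
        (starRingEnd ℂ) (unitExp (b ((A + 1 + n : ℕ) : ℝ)))‖ with hS
  have hS1 : ∀ h, S h ≤ A := by
    intro h
    refine (norm_sum_le_of_le _ (n := fun _ => (1 : ℝ)) fun n _ => ?_).trans (by simp)
    rw [norm_mul, RCLike.norm_conj, norm_unitExp, norm_unitExp, one_mul]
  -- Short lags take the trivial bound `A`; for `h ≥ ε H` the denominator in the correlation bound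
  -- is at least `ε * H * L`.
  have hS2 : ∀ h ∈ Finset.range H, S h ≤
      (if (h : ℝ) < ε * H then (A : ℝ) else 0) + 64 / (ε * H * L) := by
    intro h hh
    have hh := Finset.mem_range.1 hh
    split_ifs with hc
    · have : 0 < 64 / (ε * H * L) := by positivity
      linarith [hS1 h]
    · push Not at hc
      have hh0 : (0 : ℝ) < h := lt_of_lt_of_le (by positivity) hc
      have hhH : (h : ℝ) ≤ H := by exact_mod_cast hh.le
      have := hA h (by exact_mod_cast hh0) (hh.le.trans hHle)
        ((mul_le_mul_of_nonneg_right hhH hAp.le).trans hHL)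
      rw [zero_add]
      simp only [← add_assoc, hS]
      refine this.trans ?_
      gcongr
  have hcount : ∑ h ∈ Finset.range H, (if (h : ℝ) < ε * H then (A : ℝ) else 0) ≤
      (ε * H + 1) * A := by
    rw [← Finset.sum_filter, Finset.sum_const, nsmul_eq_mul]
    gcongr
    have hsub : (Finset.range H).filter (fun h : ℕ => (h : ℝ) < ε * H) ⊆
        Finset.range ⌈ε * (H : ℝ)⌉₊ := by
      intro h hh
      rw [Finset.mem_filter] at hh
      exact Finset.mem_range.2 (Nat.lt_ceil.2 hh.2)
    have h1 := Finset.card_le_card hsub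
    rw [Finset.card_range] at h1
    have h2 := Nat.ceil_lt_add_one (show 0 ≤ ε * (H : ℝ) by positivity)
    have h3 : (((Finset.range H).filter (fun h : ℕ => (h : ℝ) < ε * H)).card : ℝ) ≤
      ⌈ε * (H : ℝ)⌉₊ := by exact_mod_cast h1
    linarith
  have hSsum : ∑ h ∈ Finset.range H, S h ≤ (ε * H + 1) * A + H * (64 / (ε * H * L)) := by
    refine (Finset.sum_le_sum hS2).trans ?_
    rw [Finset.sum_add_distrib, Finset.sum_const, Finset.card_range, nsmul_eq_mul]
    linarith
  have hfinal : ‖∑ n ∈ Finset.range A, unitExp (b ((A + 1 + n : ℕ) : ℝ))‖ ^ 2 ≤ (ε₀ * A) ^ 2 := by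
    refine hvdc.trans ?_
    have h1 : 4 * (A : ℝ) / H * ∑ h ∈ Finset.range H, S h ≤
        4 * A / H * ((ε * H + 1) * A + H * (64 / (ε * H * L))) := by gcongr
    have h2 : 4 * (A : ℝ) / H * ((ε * H + 1) * A + H * (64 / (ε * H * L))) =
        4 * ε * A ^ 2 + 4 * (1 / H) * A ^ 2 + 256 * A / (ε * H * L) := by
      field_simp
      ring
    have h3 : 256 * A / (ε * H * L) ≤ ε * A ^ 2 := by
      rw [div_le_iff₀ (by positivity)]
      rw [div_le_iff₀ (by positivity)] at hHLA
      have := mul_le_mul_of_nonneg_left hHLA hA0.le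
      linarith
    have h4 : 4 * (1 / (H : ℝ)) * A ^ 2 ≤ 4 * ε * A ^ 2 := by gcongr
    have h5 : 8 * (H : ℝ) ^ 2 ≤ 8 * (ε * A ^ 2) := by
      have : (H : ℝ) ^ 2 ≤ (ε * A) ^ 2 := pow_le_pow_left₀ hH0.le hHA 2
      have h6 : (ε * A) ^ 2 ≤ ε * A ^ 2 := by
        have : ε ^ 2 ≤ ε := by nlinarith
        rw [mul_pow]; gcongr
      linarith
    have h6 : 4 * (A : ℝ) * H ≤ 4 * (ε * A ^ 2) := by
      have := mul_le_mul_of_nonneg_left hHA hA0.le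
      linarith
    have h7 : 21 * ε * A ^ 2 ≤ ε₀ ^ 2 * A ^ 2 := by gcongr
    rw [mul_pow]
    linarith
  exact le_of_sq_le_sq hfinal (by positivity)

/-- Exponential sums of functions whose derivative tends to infinity with vanishing second
derivative. -/
lemma tendsto_cesaro_of_deriv_atTop (hb : b ∈ R)
    (h0 : Tendsto (_root_.deriv (_root_.deriv b)) atTop (𝓝 0))
    (hinf : Tendsto (fun x => |_root_.deriv b x|) atTop atTop) :
    Tendsto (cesaro fun n => unitExp (b n)) atTop (𝓝 0) := by
  have key : ∀ b ∈ R, Tendsto (_root_.deriv (_root_.deriv b)) atTop (𝓝 0) →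
      Tendsto (_root_.deriv b) atTop atTop →
      Tendsto (cesaro fun n => unitExp (b n)) atTop (𝓝 0) := by
    intro b hb h0 hinf
    refine hR.tendsto_cesaro_of_deriv_deriv_pos hb ?_ h0 hinf
    have hsq := hR.tendsto_sq_mul_of_deriv (hR.deriv hb) hinf
    filter_upwards [hsq.eventually (eventually_gt_atTop 0), eventually_gt_atTop 0] with x hx hx0
    exact pos_of_mul_pos_right hx (by positivity)
  rcases hR.tendsto_trichotomy (hR.deriv hb) with ⟨l, hl⟩ | h | h
  · exact absurd hinf (not_tendsto_atTop_of_tendsto_nhds hl.abs)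
  · exact key b hb h0 h
  · have hd : _root_.deriv (fun x => -b x) = fun x => - _root_.deriv b x := by
      ext x; exact deriv.fun_neg
    have hdd : _root_.deriv (fun x => - _root_.deriv b x) =
        fun x => - _root_.deriv (_root_.deriv b) x := by
      ext x; exact deriv.fun_neg
    have hneg := key (fun x => -b x) (hR.neg hb)
      (by rw [hd, hdd]; simpa using h0.neg)
      (by rw [hd]; exact tendsto_neg_atBot_atTop.comp h)
    exact tendsto_cesaro_unitExp_neg (b := fun n => b n) hneg

end IsHardyRing

/-! ### Equidistribution for Hardy functions of polynomial growth -/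

/-- `g` is unbounded or converges to an irrational number. -/
def NonratLimit (g : ℝ → ℝ) : Prop :=
  Tendsto (fun x => |g x|) atTop atTop ∨ ∃ α, Irrational α ∧ Tendsto g atTop (𝓝 α)

/-- A derivative version of staying logarithmically away from rational polynomials. -/
def AwayFromRatPoly (b : ℝ → ℝ) : Prop :=
  ∀ p : Polynomial ℚ,
    Tendsto (fun x => |x * (deriv b x - Polynomial.aeval x (Polynomial.derivative p))|) atTop atTop

lemma NonratLimit.congr {f g : ℝ → ℝ} (hf : NonratLimit f) (h : f =ᶠ[atTop] g) :
    NonratLimit g := by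
  rcases hf with hf | ⟨α, hα, hf⟩
  · exact Or.inl (hf.congr' (h.mono fun x hx => by simp only [hx]))
  · exact Or.inr ⟨α, hα, hf.congr' h⟩

lemma NonratLimit.add_rat {f : ℝ → ℝ} (hf : NonratLimit f) (c : ℚ) :
    NonratLimit fun x => f x + c := by
  rcases hf with hf | ⟨α, hα, hf⟩
  · refine Or.inl (tendsto_atTop_mono (fun x => ?_)
      (tendsto_atTop_add_const_right _ (-|(c : ℝ)|) hf))
    have h1 := abs_sub (f x + c) c
    rw [add_sub_cancel_right] at h1
    linarith
  · exact Or.inr ⟨α + c, hα.add_ratCast c, hf.add_const _⟩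

lemma iterate_deriv_const_mul_pow (k : ℕ) (c : ℝ) :
    deriv^[k] (fun x => c * x ^ k) = fun _ => c * k.factorial := by
  induction k generalizing c with
  | zero => ext x; simp
  | succ k ih =>
    have : deriv (fun x : ℝ => c * x ^ (k + 1)) = fun x => (c * (k + 1)) * x ^ k := by
      ext x
      rw [deriv_const_mul _ (by fun_prop), deriv_pow_field]
      push_cast
      ring
    rw [Function.iterate_succ_apply, this, ih]
    ext x
    rw [Nat.factorial_succ]
    push_cast
    ring

namespace IsHardyRing

variable {R : Set (ℝ → ℝ)} (hR : IsHardyRing R) {b f g : ℝ → ℝ}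
include hR

lemma exists_sub_eq_mul_deriv (hf : f ∈ R) {h : ℕ} (hh : 0 < h) :
    ∃ ξ : ℝ → ℝ, Tendsto ξ atTop atTop ∧
      ∀ᶠ x in atTop, f (x + h) - f x = h * _root_.deriv f (ξ x) := by
  have hh' : (0 : ℝ) < h := by exact_mod_cast hh
  have : ∀ x, ∃ y, x ≤ y ∧ ((∀ h : ℝ, 0 < h → ∃ y, x < y ∧ y < x + h ∧
      f (x + h) - f x = h * _root_.deriv f y) → f (x + h) - f x = h * _root_.deriv f y) := by
    intro x
    by_cases hx : ∀ h : ℝ, 0 < h → ∃ y, x < y ∧ y < x + h ∧ f (x + h) - f x = h * _root_.deriv f y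
    · obtain ⟨y, h1, -, h3⟩ := hx h hh'
      exact ⟨y, h1.le, fun _ => h3⟩
    · exact ⟨x, le_rfl, fun h => absurd h hx⟩
  choose ξ hξ hξ' using this
  exact ⟨ξ, tendsto_atTop_mono hξ tendsto_id,
    (eventually_exists_deriv_eq_slope (hR.diff hf)).mono fun x hx => hξ' x hx⟩

lemma tendsto_sub_of_deriv (hf : f ∈ R) {h : ℕ} (hh : 0 < h) {α : ℝ}
    (hα : Tendsto (_root_.deriv f) atTop (𝓝 α)) :
    Tendsto (fun x => f (x + h) - f x) atTop (𝓝 (h * α)) := by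
  obtain ⟨ξ, hξ, he⟩ := hR.exists_sub_eq_mul_deriv hf hh
  exact ((hα.comp hξ).const_mul (h : ℝ)).congr' (he.mono fun x hx => hx.symm)

/-- By the mean value theorem, a difference with step `h` is `h` times a value of the derivative far
out, and multiplication by a positive integer preserves both unboundedness and irrationality of the
limit. -/
lemma nonratLimit_sub (hf : f ∈ R) {h : ℕ} (hh : 0 < h) (hn : NonratLimit (_root_.deriv f)) :
    NonratLimit fun x => f (x + h) - f x := by
  rcases hn with hn | ⟨α, hα, hn⟩
  · obtain ⟨ξ, hξ, he⟩ := hR.exists_sub_eq_mul_deriv hf hh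
    refine Or.inl (((hn.comp hξ).const_mul_atTop (show (0 : ℝ) < h by exact_mod_cast hh)).congr'
      (he.mono fun x hx => ?_))
    simp only [Function.comp_apply]
    rw [hx, abs_mul, Nat.abs_cast]
  · exact Or.inr ⟨h * α, hα.natCast_mul hh.ne', hR.tendsto_sub_of_deriv hf hh hn⟩

lemma tendsto_natCast_sub (hf : f ∈ R) {α : ℝ} (hα : Tendsto (_root_.deriv f) atTop (𝓝 α)) :
    Tendsto (fun n : ℕ => f ((n + 1 : ℕ) : ℝ) - f n) atTop (𝓝 α) := by
  have := (hR.tendsto_sub_of_deriv hf one_pos hα).comp tendsto_natCast_atTop_atTop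
  rw [Nat.cast_one, one_mul] at this
  simpa [Function.comp_def] using this

lemma iterate_deriv_sub (hf : f ∈ R) (hg : g ∈ R) (k : ℕ) :
    _root_.deriv^[k] (fun x => f x - g x) =ᶠ[atTop]
      fun x => _root_.deriv^[k] f x - _root_.deriv^[k] g x := by
  induction k with
  | zero => simp
  | succ k ih =>
    rw [Function.iterate_succ_apply', Function.iterate_succ_apply', Function.iterate_succ_apply']
    refine (deriv_congr_atTop ih).trans ?_
    filter_upwards [hR.diff (hR.iterate_deriv hf k), hR.diff (hR.iterate_deriv hg k)] with x h1 h2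
    exact deriv_fun_sub h1 h2

omit hR in
lemma iterate_deriv_shift (f : ℝ → ℝ) (h : ℝ) (k : ℕ) :
    _root_.deriv^[k] (fun x => f (x + h)) = fun x => _root_.deriv^[k] f (x + h) := by
  induction k with
  | zero => rfl
  | succ k ih =>
    rw [Function.iterate_succ_apply', Function.iterate_succ_apply', ih]
    ext x
    exact deriv_comp_add_const _ _ _

lemma exists_iterate_deriv_add_rat_mul (hf : f ∈ R) (q : ℚ) (k : ℕ) :
    ∃ c : ℚ, _root_.deriv^[k + 1] (fun x => f x + q * x) =ᶠ[atTop]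
      fun x => _root_.deriv^[k + 1] f x + c := by
  induction k with
  | zero =>
    refine ⟨q, ?_⟩
    filter_upwards [hR.diff hf] with x hx
    simp only [zero_add, Function.iterate_one]
    rw [deriv_fun_add hx (by fun_prop), deriv_const_mul _ (by fun_prop)]
    simp
  | succ k ih =>
    obtain ⟨c, hc⟩ := ih
    refine ⟨0, ?_⟩
    rw [Function.iterate_succ_apply', Function.iterate_succ_apply' _ (k + 1) f]
    refine (deriv_congr_atTop hc).trans (Eventually.of_forall fun x => ?_)
    simp

/-- Iterated van der Corput: exponential sums of functions some derivative of which is unbounded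
or converges to an irrational, and whose next derivative vanishes at infinity. -/
lemma tendsto_cesaro_of_nonratLimit (k : ℕ) : ∀ b ∈ R, NonratLimit (_root_.deriv^[k + 1] b) →
    Tendsto (_root_.deriv^[k + 2] b) atTop (𝓝 0) →
    Tendsto (cesaro fun n => unitExp (b n)) atTop (𝓝 0) := by
  induction k with
  | zero =>
    intro b hb hn h0
    rcases hn with hn | ⟨α, hα, hn⟩
    · exact hR.tendsto_cesaro_of_deriv_atTop hb h0 hn
    · exact tendsto_cesaro_unitExp_of_sub_tendsto (b := fun n => b n) (fun k => hα.ne_int k)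
        (hR.tendsto_natCast_sub hb hn)
  | succ k ih =>
    intro b hb hn h0
    -- The correlations of `e(b n)` are the exponentials of `b (n + h) - b n`, which satisfies the
    -- hypotheses with one derivative fewer.
    refine tendsto_cesaro_of_correlations (fun n => (norm_unitExp _).le) fun h hh => ?_
    have hmem : (fun x => b (x + h) - b x) ∈ R := hR.sub (hR.shift hb h) hb
    have hit : ∀ j, _root_.deriv^[j] (fun x => b (x + h) - b x) =ᶠ[atTop]
        fun x => _root_.deriv^[j] b (x + h) - _root_.deriv^[j] b x := by
      intro j
      have := hR.iterate_deriv_sub (hR.shift hb h) hb j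
      rwa [iterate_deriv_shift] at this
    have := ih (fun x => b (x + h) - b x) hmem
      (NonratLimit.congr (hR.nonratLimit_sub (hR.iterate_deriv hb (k + 1)) hh
        (by rwa [← Function.iterate_succ_apply' (f := _root_.deriv)])) (hit (k + 1)).symm)
      (Tendsto.congr' (hit (k + 2)).symm (by
        have := hR.tendsto_sub_of_deriv (hR.iterate_deriv hb (k + 2)) hh
          (by rw [← Function.iterate_succ_apply' (f := _root_.deriv)]; exact h0)
        rwa [mul_zero] at this))
    refine this.congr fun N => ?_
    congr 1
    ext n
    rw [unitExp_sub]
    push_cast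
    rfl

end IsHardyRing

/-! ### Periodic sequences and the equidistribution theorem -/

lemma sum_unitExp_div {Q : ℕ} (hQ : 0 < Q) (m : ℤ) :
    ∑ j ∈ Finset.range Q, unitExp (j * m / Q) = if (Q : ℤ) ∣ m then (Q : ℂ) else 0 := by
  have hQ' : (Q : ℝ) ≠ 0 := by exact_mod_cast hQ.ne'
  have hpow : ∀ j : ℕ, unitExp (j * m / Q) = unitExp (m / Q) ^ j := by
    intro j
    induction j with
    | zero => simp
    | succ j ih =>
      rw [pow_succ, ← ih, ← unitExp_add]
      congr 1
      push_cast
      ring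
  simp only [hpow]
  split_ifs with h
  · obtain ⟨t, rfl⟩ := h
    have : unitExp (((Q * t : ℤ) : ℝ) / Q) = 1 := by
      rw [unitExp_eq_one_iff]
      exact ⟨t, by push_cast; field_simp⟩
    simp only [this]
    simp
  · have hne : unitExp (m / Q) ≠ 1 := by
      intro h1
      obtain ⟨t, ht⟩ := unitExp_eq_one_iff.1 h1
      apply h
      refine ⟨t, ?_⟩
      rw [div_eq_iff hQ'] at ht
      have : m = t * Q := by exact_mod_cast ht
      rw [this, mul_comm]
    rw [geom_sum_eq hne, ← hpow]
    have : unitExp (Q * m / Q) = 1 := by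
      rw [unitExp_eq_one_iff]
      exact ⟨m, by field_simp⟩
    rw [this, sub_self, zero_div]

/-- Finite Fourier expansion of periodic sequences. -/
lemma exists_fourier_of_periodic {χ : ℕ → ℂ} {Q : ℕ} (hQ : 0 < Q) (hχ : Function.Periodic χ Q) :
    ∃ c : ℕ → ℂ, ∀ n : ℕ, χ n = ∑ j ∈ Finset.range Q, c j * unitExp (j / Q * n) := by
  have hQ' : (Q : ℂ) ≠ 0 := by exact_mod_cast hQ.ne'
  refine ⟨fun j => (Q : ℂ)⁻¹ * ∑ r ∈ Finset.range Q, χ r * unitExp (-(j * r / Q)), fun n => ?_⟩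
  have h1 : ∀ j : ℕ, (Q : ℂ)⁻¹ * (∑ r ∈ Finset.range Q, χ r * unitExp (-(j * r / Q))) *
      unitExp (j / Q * n) =
      (Q : ℂ)⁻¹ * ∑ r ∈ Finset.range Q, χ r * unitExp (j * ((n - r : ℤ) : ℝ) / Q) := by
    intro j
    rw [mul_assoc, Finset.sum_mul]
    congr 1
    refine Finset.sum_congr rfl fun r _ => ?_
    rw [mul_assoc, ← unitExp_add]
    congr 2
    push_cast
    ring
  simp only [h1]
  rw [← Finset.mul_sum, Finset.sum_comm]
  simp only [← Finset.mul_sum, sum_unitExp_div hQ]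
  rw [Finset.sum_eq_single (n % Q)]
  · rw [if_pos, hχ.map_mod_nat]
    · field_simp
    · have := Int.natCast_mod n Q
      rw [this]
      exact Int.dvd_self_sub_emod
  · intro r hr hne
    rw [if_neg, mul_zero]
    intro hd
    apply hne
    have h2 : (r : ℤ) ≡ n [ZMOD Q] := (Int.modEq_iff_dvd).2 hd
    have h3 : r ≡ n [MOD Q] := (Int.natCast_modEq_iff).1 h2
    rw [← h3, Nat.mod_eq_of_lt (Finset.mem_range.1 hr)]
  · intro h
    exact absurd (Finset.mem_range.2 (Nat.mod_lt _ hQ)) h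

lemma tendsto_cesaro_periodic_mul {χ : ℕ → ℂ} {Q : ℕ} (hQ : 0 < Q) (hχ : Function.Periodic χ Q)
    {b : ℕ → ℝ} (h : ∀ j ∈ Finset.range Q,
      Tendsto (cesaro fun n => unitExp (b n + j / Q * n)) atTop (𝓝 0)) :
    Tendsto (cesaro fun n => χ n * unitExp (b n)) atTop (𝓝 0) := by
  obtain ⟨c, hc⟩ := exists_fourier_of_periodic hQ hχ
  have e : (cesaro fun n => χ n * unitExp (b n)) = fun N => ∑ j ∈ Finset.range Q,
      c j * cesaro (fun n => unitExp (b n + j / Q * n)) N := by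
    ext N
    simp only [← cesaro_const_mul]
    rw [← cesaro_sum]
    congr 1
    ext n
    rw [hc, Finset.sum_mul]
    refine Finset.sum_congr rfl fun j _ => ?_
    rw [unitExp_add]; ring
  rw [e]
  have := tendsto_finsetSum (Finset.range Q) fun j hj => (h j hj).const_mul (c j)
  simpa using this

/-- Shifting by a multiple of the denominator changes the power by a multiple of that denominator.
The free factor `Q` lets the period be common with that of another sequence. -/
lemma periodic_unitExp_monomial (c : ℚ) (k : ℕ) (Q : ℕ) :
    Function.Periodic (fun n : ℕ => unitExp (c * (n : ℝ) ^ k)) (Q * c.den) := by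
  intro n
  obtain ⟨t, ht⟩ := sub_dvd_pow_sub_pow ((n : ℤ) + Q * c.den) n k
  have h1 : (c * (((n + Q * c.den : ℕ) : ℝ)) ^ k) = c * (n : ℝ) ^ k + ((c.num * Q * t : ℤ) : ℝ) := by
    have h2 : (((n : ℤ) + Q * c.den : ℤ) : ℝ) ^ k - (n : ℝ) ^ k = Q * c.den * t := by
      have := congrArg (Int.cast (R := ℝ)) ht
      push_cast at this ⊢
      rw [this]; ring
    have h3 : (c : ℝ) * c.den = c.num := by exact_mod_cast Rat.mul_den_eq_num c
    push_cast at h2 ⊢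
    linear_combination c * h2 + Q * t * h3
  simp only
  rw [h1, unitExp_add_int]

namespace IsHardyRing

variable {R : Set (ℝ → ℝ)} (hR : IsHardyRing R) {b f g : ℝ → ℝ}
include hR

/-- **Equidistribution theorem**: exponential sums, twisted by a periodic sequence, of a function of
polynomial growth in a Hardy ring which stays away from rational polynomials. -/
theorem tendsto_cesaro_periodic_mul_unitExp (k : ℕ) : ∀ b ∈ R,
    Tendsto (_root_.deriv^[k + 1] b) atTop (𝓝 0) → AwayFromRatPoly b →
    ∀ (χ : ℕ → ℂ) (Q : ℕ), 0 < Q → Function.Periodic χ Q →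
    Tendsto (cesaro fun n => χ n * unitExp (b n)) atTop (𝓝 0) := by
  induction k with
  | zero =>
    intro b hb h0 haway χ Q hQ hχ
    refine tendsto_cesaro_periodic_mul hQ hχ fun j hj => ?_
    rcases Nat.eq_zero_or_pos j with rfl | hj0
    -- The untwisted term needs growth beyond the logarithm, supplied by the zero polynomial. Every
    -- other term has increments tending to the nonintegral number `j / Q`.
    · simpa using hR.tendsto_cesaro_of_deriv_tendsto_zero hb h0 (by simpa using haway 0)
    · have hQ' : (0 : ℝ) < Q := by exact_mod_cast hQ
      refine tendsto_cesaro_unitExp_of_sub_tendsto (α := 0 + j / Q) (fun t ht => ?_) ?_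
      · rw [zero_add, div_eq_iff hQ'.ne'] at ht
        have h1 : (j : ℤ) = t * Q := by exact_mod_cast ht
        have h2 : (Q : ℤ) ∣ j := ⟨t, by rw [h1, mul_comm]⟩
        have h3 := Nat.le_of_dvd hj0 (Int.natCast_dvd_natCast.1 h2)
        exact absurd (Finset.mem_range.1 hj) (not_lt.2 h3)
      · have := (hR.tendsto_natCast_sub hb h0).add_const ((j : ℝ) / Q)
        refine this.congr fun n => ?_
        push_cast
        ring
  | succ k ih =>
    intro b hb h0 haway χ Q hQ hχ
    have hg := hR.iterate_deriv hb (k + 1)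
    -- If this derivative is unbounded or has an irrational limit, van der Corput differencing
    -- applies, and the linear phases of the periodic factor shift the derivative only by a
    -- rational. Otherwise the limit is rational and the leading monomial can be removed.
    by_cases hn : NonratLimit (_root_.deriv^[k + 1] b)
    · refine tendsto_cesaro_periodic_mul hQ hχ fun j _ => ?_
      obtain ⟨c, hc⟩ := hR.exists_iterate_deriv_add_rat_mul hb (j / Q : ℚ) k
      have hmem : (fun x => b x + ((j / Q : ℚ) : ℝ) * x) ∈ R :=
        hR.add hb (hR.const_mul hR.id _)
      have := hR.tendsto_cesaro_of_nonratLimit k _ hmem ((hn.add_rat c).congr hc.symm) (by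
        rw [Function.iterate_succ_apply']
        refine Tendsto.congr' (deriv_congr_atTop hc).symm ?_
        rw [Function.iterate_succ_apply'] at h0
        refine h0.congr fun x => ?_
        simp)
      simpa using this
    · obtain ⟨α, hα⟩ : ∃ α : ℚ, Tendsto (_root_.deriv^[k + 1] b) atTop (𝓝 α) := by
        rcases hR.tendsto_or_abs_atTop hg with ⟨l, hl⟩ | h
        · by_cases hirr : Irrational l
          · exact absurd (Or.inr ⟨l, hirr, hl⟩) hn
          · rw [Irrational, not_not] at hirr
            obtain ⟨α, rfl⟩ := hirr
            exact ⟨α, hl⟩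
        · exact absurd (Or.inl h) hn
      -- With this coefficient the monomial has the same limiting derivative as `b`. Its exponential
      -- is periodic and joins `χ`, which is why the induction carries a periodic factor.
      set c : ℚ := α / (k + 1).factorial with hc
      have hmono : (fun x : ℝ => (c : ℝ) * x ^ (k + 1)) ∈ R := hR.const_mul (hR.pow _) _
      have hlim : Tendsto (_root_.deriv^[k + 1] fun x => b x - c * x ^ (k + 1)) atTop (𝓝 0) := by
        refine Tendsto.congr' (hR.iterate_deriv_sub hb hmono (k + 1)).symm ?_
        rw [iterate_deriv_const_mul_pow]
        have h1 : (c : ℝ) * (k + 1).factorial = α := by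
          rw [hc]; push_cast
          rw [div_mul_cancel₀]
          exact_mod_cast (k + 1).factorial_ne_zero
        rw [h1]
        simpa using hα.sub_const (α : ℝ)
      have haway' : AwayFromRatPoly fun x => b x - c * x ^ (k + 1) := by
        intro p
        refine (haway (p + Polynomial.monomial (k + 1) c)).congr' ?_
        filter_upwards [hR.diff hb] with x hx
        rw [deriv_fun_sub hx (by fun_prop), deriv_const_mul _ (by fun_prop), deriv_pow_field]
        simp only [map_add, Polynomial.derivative_monomial,
          Polynomial.aeval_monomial, map_mul]
        congr 2
        simp
        ring
      have := ih _ (hR.sub hb hmono) hlim haway'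
        (fun n => χ n * unitExp (c * (n : ℝ) ^ (k + 1))) (Q * c.den)
        (Nat.mul_pos hQ c.den_pos) (by
          refine Function.Periodic.mul ?_ (periodic_unitExp_monomial c (k + 1) Q)
          have := hχ.nat_mul c.den
          rwa [mul_comm] at this)
      refine this.congr fun N => ?_
      congr 1
      ext n
      rw [mul_assoc, ← unitExp_add]
      congr 2
      ring

theorem tendsto_cesaro_unitExp {k : ℕ} (hb : b ∈ R)
    (h0 : Tendsto (_root_.deriv^[k + 1] b) atTop (𝓝 0)) (h : AwayFromRatPoly b) :
    Tendsto (cesaro fun n => unitExp (b n)) atTop (𝓝 0) := by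
  simpa using hR.tendsto_cesaro_periodic_mul_unitExp k b hb h0 h (fun _ => 1) 1 one_pos
    (fun _ => rfl)

lemma mul_deriv_sub_aeval_mem (hb : b ∈ R) (p : Polynomial ℚ) :
    (fun x => x * (_root_.deriv b x - Polynomial.aeval x (Polynomial.derivative p))) ∈ R :=
  hR.mul hR.id (hR.sub (hR.deriv hb) (hR.aeval_rat _))

/-- The expression `x * (b - p)'` converges or has modulus tending to infinity. Were it convergent,
hence bounded, integration would give `b - p = O(log x)`, against the hypothesis. -/
lemma awayFromRatPoly_of_staysLogAway (hb : b ∈ R) (h : StaysLogAwayFromRatPoly b) :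
    AwayFromRatPoly b := by
  intro p
  refine (hR.tendsto_or_abs_atTop (hR.mul_deriv_sub_aeval_mem hb p)).resolve_left ?_
  rintro ⟨l, hl⟩
  set C : ℝ := |l| + 1 with hC
  have hCpos : 0 < C := by positivity
  set F : ℝ → ℝ := fun x => b x - Polynomial.aeval x p with hF
  have hFd : ∀ᶠ x in atTop, HasDerivAt F
      (_root_.deriv b x - Polynomial.aeval x (Polynomial.derivative p)) x :=
    (hR.diff hb).mono fun x hx => hx.hasDerivAt.sub (p.hasDerivAt_aeval x)
  have hbd : ∀ᶠ x in atTop,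
      |x * (_root_.deriv b x - Polynomial.aeval x (Polynomial.derivative p))| < C :=
    hl.abs.eventually (gt_mem_nhds (lt_add_one _))
  have key : ∀ s : ℝ, |s| = 1 → ∃ K, ∀ᶠ x in atTop, s * F x ≤ C * Real.log x + K := by
    intro s hs
    have hder : ∀ᶠ x in atTop, HasDerivAt (fun x => C * Real.log x - s * F x)
        (C * x⁻¹ - s * (_root_.deriv b x - Polynomial.aeval x (Polynomial.derivative p))) x := by
      filter_upwards [hFd, eventually_gt_atTop 0] with x hx h0
      exact ((Real.hasDerivAt_log h0.ne').const_mul C).sub (hx.const_mul s)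
    obtain ⟨X, hX⟩ := eventually_monotoneOn_of_deriv_nonneg
      (hder.mono fun x hx => hx.differentiableAt) (by
        filter_upwards [hder, hbd, eventually_gt_atTop 0] with x hx hx' h0
        rw [hx.deriv]
        set d := _root_.deriv b x - Polynomial.aeval x (Polynomial.derivative p)
        have h1 : x * (s * d) ≤ C := by
          refine (le_abs_self _).trans ?_
          rw [show x * (s * d) = s * (x * d) by ring, abs_mul, hs, one_mul]
          exact hx'.le
        have h2 : s * d ≤ C * x⁻¹ := by
          rw [← div_eq_mul_inv, le_div_iff₀ h0]; linarith
        linarith)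
    refine ⟨-(C * Real.log X - s * F X), ?_⟩
    filter_upwards [eventually_ge_atTop X] with x hx
    have := hX (Set.mem_Ici.2 le_rfl) (Set.mem_Ici.2 hx) hx
    simp only at this
    linarith
  obtain ⟨K₁, h₁⟩ := key 1 (by simp)
  obtain ⟨K₂, h₂⟩ := key (-1) (by simp)
  have hlog := (h p).bound (show (0 : ℝ) < 1 / (2 * C) by positivity)
  obtain ⟨x, e1, e2, e3, e4⟩ := (h₁.and (h₂.and (hlog.and
    (Real.tendsto_log_atTop.eventually (eventually_gt_atTop (max 0 (max K₁ K₂ / C))))))).exists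
  have hl0 : 0 < Real.log x := (le_max_left _ _).trans_lt e4
  have hl1 : max K₁ K₂ < C * Real.log x := by
    have := (le_max_right _ _).trans_lt e4
    rw [div_lt_iff₀ hCpos] at this
    linarith
  have hF1 : |F x| ≤ C * Real.log x + max K₁ K₂ :=
    abs_le.2 ⟨by linarith [le_max_right K₁ K₂], by linarith [le_max_left K₁ K₂]⟩
  rw [Real.norm_of_nonneg hl0.le, Real.norm_eq_abs] at e3
  have hF2 : 2 * C * Real.log x ≤ |F x| := by
    rw [div_mul_eq_mul_div, one_mul, le_div_iff₀ (by positivity)] at e3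
    linarith
  linarith

/-- All but countably many multiples of a function growing faster than the logarithm stay away
from rational polynomials. -/
lemma exists_countable_awayFromRatPoly (hb : b ∈ R)
    (hinf : Tendsto (fun x => |x * _root_.deriv b x|) atTop atTop) :
    ∃ Z : Set ℝ, Z.Countable ∧ ∀ ξ ∉ Z, AwayFromRatPoly fun x => ξ * b x := by
  refine ⟨⋃ p : Polynomial ℚ, {ξ : ℝ | ¬ Tendsto (fun x => |x * (_root_.deriv (fun x => ξ * b x) x -
    Polynomial.aeval x (Polynomial.derivative p))|) atTop atTop}, ?_, ?_⟩
  · have : Countable (Polynomial ℚ) := by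
      rw [← Cardinal.mk_le_aleph0_iff]
      refine (Polynomial.cardinalMk_le_max (R := ℚ)).trans ?_
      simp
    -- There are countably many polynomials, and each excludes at most one multiple: for two
    -- exceptions `ξ ≠ η` the polynomial cancels in the difference, and `(ξ - η) * x * b'(x)` would
    -- converge.
    refine Set.countable_iUnion fun p => Set.Subsingleton.countable ?_
    intro ξ hξ η hη
    by_contra hne
    have h1 := (hR.tendsto_or_abs_atTop (hR.mul_deriv_sub_aeval_mem
      (hR.const_mul hb ξ) p)).resolve_right hξ
    have h2 := (hR.tendsto_or_abs_atTop (hR.mul_deriv_sub_aeval_mem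
      (hR.const_mul hb η) p)).resolve_right hη
    obtain ⟨l, hl⟩ := h1
    obtain ⟨m, hm⟩ := h2
    have h3 : Tendsto (fun x => x * _root_.deriv b x) atTop (𝓝 ((ξ - η)⁻¹ * (l - m))) := by
      refine ((hl.sub hm).const_mul (ξ - η)⁻¹).congr' ?_
      filter_upwards [hR.diff hb] with x hx
      rw [deriv_const_mul _ hx, deriv_const_mul _ hx]
      have : ξ - η ≠ 0 := sub_ne_zero.2 hne
      field_simp
      ring
    exact not_tendsto_atTop_of_tendsto_nhds h3.abs hinf
  · intro ξ hξ p
    by_contra h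
    exact hξ (Set.mem_iUnion.2 ⟨p, h⟩)

end IsHardyRing

/-! ### Spectral measures of stationary families indexed by `ℤ ^ d` -/

section Herglotz

open UnitAddTorus

variable {d : Type*} [Fintype d]

/-- The Haar probability measure on the torus. -/
noncomputable def torusHaar (d : Type*) [Fintype d] : Measure (UnitAddTorus d) :=
  Measure.pi fun _ => AddCircle.haarAddCircle

instance : IsProbabilityMeasure (torusHaar d) := by unfold torusHaar; infer_instance

lemma integral_fourier_haarAddCircle (n : ℤ) :
    ∫ x : UnitAddCircle, fourier n x ∂AddCircle.haarAddCircle = if n = 0 then 1 else 0 := by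
  split_ifs with h
  · simp [h]
  · exact integral_eq_zero_of_add_right_eq_neg (μ := AddCircle.haarAddCircle)
      (fourier_add_half_inv_index h one_pos)

lemma integral_mFourier_torusHaar (n : d → ℤ) :
    ∫ x, mFourier n x ∂(torusHaar d) = if n = 0 then 1 else 0 := by
  have h1 : ∫ x, mFourier n x ∂(torusHaar d) =
      ∏ i, ∫ x : UnitAddCircle, fourier (n i) x ∂AddCircle.haarAddCircle :=
    integral_fintype_prod_eq_prod (fun i x => fourier (n i) x)
  rw [h1]
  simp only [integral_fourier_haarAddCircle]
  split_ifs with h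
  · simp [h]
  · obtain ⟨i, hi⟩ := Function.ne_iff.1 h
    exact Finset.prod_eq_zero (Finset.mem_univ i) (if_neg hi)

open Classical in
/-- The box `[0, N) ^ d`. -/
noncomputable def intBox (d : Type*) [Fintype d] (N : ℕ) : Finset (d → ℤ) :=
  Fintype.piFinset fun _ => Finset.Ico (0 : ℤ) N

lemma mem_intBox {N : ℕ} {m : d → ℤ} : m ∈ intBox d N ↔ ∀ i, 0 ≤ m i ∧ m i < N := by
  classical
  simp [intBox]

lemma card_intBox (N : ℕ) : (intBox d N).card = N ^ Fintype.card d := by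
  classical
  rw [intBox, Fintype.card_piFinset]
  simp

-- The Følner property of boxes: in each coordinate the overlap with the shifted interval has
-- proportion `1 - |k i| / N`.
open Classical in
lemma tendsto_card_intBox_inter (k : d → ℤ) :
    Tendsto (fun N : ℕ => (((intBox d N).filter fun m => m + k ∈ intBox d N).card : ℝ) /
      (intBox d N).card) atTop (𝓝 1) := by
  have hset : ∀ N : ℕ, (intBox d N).filter (fun m => m + k ∈ intBox d N) =
      Fintype.piFinset fun i => Finset.Ico (max 0 (-k i)) (min (N : ℤ) (N - k i)) := by
    intro N
    ext m
    simp only [Finset.mem_filter, mem_intBox, Fintype.mem_piFinset, Finset.mem_Ico, Pi.add_apply]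
    rw [← forall_and]
    refine forall_congr' fun i => ?_
    omega
  have h1 : ∀ i, Tendsto (fun N : ℕ => (((min (N : ℤ) (N - k i)) - max 0 (-k i)).toNat : ℝ) / N)
      atTop (𝓝 1) := by
    intro i
    have h2 : Tendsto (fun N : ℕ => 1 - ((k i).natAbs : ℝ) / N) atTop (𝓝 (1 - 0)) :=
      tendsto_const_nhds.sub (Tendsto.div_atTop tendsto_const_nhds tendsto_natCast_atTop_atTop)
    rw [sub_zero] at h2
    refine h2.congr' ?_
    filter_upwards [eventually_gt_atTop (k i).natAbs] with N hN
    have hN0 : (N : ℝ) ≠ 0 := by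
      have : 0 < N := by omega
      exact_mod_cast this.ne'
    have : ((min (N : ℤ) (N - k i)) - max 0 (-k i)).toNat = N - (k i).natAbs := by omega
    rw [this, Nat.cast_sub hN.le]
    field_simp
  have h2 := tendsto_finsetProd (Finset.univ : Finset d) fun i _ => h1 i
  rw [Finset.prod_const_one] at h2
  refine h2.congr fun N => ?_
  rw [hset, card_intBox, Fintype.card_piFinset, Finset.prod_div_distrib]
  simp

variable {E : Type*} [NormedAddCommGroup E] [InnerProductSpace ℂ E]

/-- The Fejér density of a family of vectors. -/
noncomputable def fejerDensity (V : (d → ℤ) → E) (N : ℕ) (x : UnitAddTorus d) : ℝ :=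
  ‖∑ m ∈ intBox d N, mFourier (-m) x • V m‖ ^ 2 / (intBox d N).card

lemma fejerDensity_nonneg (V : (d → ℤ) → E) (N : ℕ) (x : UnitAddTorus d) :
    0 ≤ fejerDensity V N x := by unfold fejerDensity; positivity

lemma continuous_fejerDensity (V : (d → ℤ) → E) (N : ℕ) : Continuous (fejerDensity V N) := by
  unfold fejerDensity
  fun_prop

lemma fejerDensity_eq (V : (d → ℤ) → E) (N : ℕ) (x : UnitAddTorus d) :
    (fejerDensity V N x : ℂ) = (∑ m ∈ intBox d N, ∑ n ∈ intBox d N,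
      inner ℂ (V m) (V n) * mFourier (m - n) x) / (intBox d N).card := by
  rw [fejerDensity]
  push_cast
  congr 1
  have := inner_self_eq_norm_sq_to_K (𝕜 := ℂ) (∑ m ∈ intBox d N, mFourier (-m) x • V m)
  simp only [Complex.coe_algebraMap] at this
  rw [← this, sum_inner]
  refine Finset.sum_congr rfl fun m _ => ?_
  rw [inner_sum]
  refine Finset.sum_congr rfl fun n _ => ?_
  rw [inner_smul_left, inner_smul_right, ← mFourier_neg, neg_neg, sub_eq_add_neg, mFourier_add]
  ring

-- Orthogonality of characters selects the pairs with `n = m + k`, and stationarity makes all their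
-- inner products equal. The density thus has the prescribed Fourier coefficients up to the
-- proportion of the box that stays in the box under the shift.
open Classical in
lemma integral_fejerDensity_mul {V : (d → ℤ) → E}
    (hV : ∀ m n k, inner ℂ (V (m + k)) (V (n + k)) = inner ℂ (V m) (V n)) (N : ℕ) (k : d → ℤ) :
    ∫ x, (fejerDensity V N x : ℂ) * mFourier k x ∂(torusHaar d) =
      inner ℂ (V 0) (V k) * ((((intBox d N).filter fun m => m + k ∈ intBox d N).card : ℝ) /
      (intBox d N).card : ℝ) := by
  have hint : ∀ (c : ℂ) (j : d → ℤ), Integrable (fun x => c * mFourier j x) (torusHaar d) :=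
    fun c j => ((mFourier j).continuous.integrable_of_hasCompactSupport
      (HasCompactSupport.of_compactSpace _)).const_mul c
  have e : ∀ x, (fejerDensity V N x : ℂ) * mFourier k x = ((intBox d N).card : ℂ)⁻¹ *
      ∑ m ∈ intBox d N, ∑ n ∈ intBox d N, inner ℂ (V m) (V n) * mFourier (m - n + k) x := by
    intro x
    rw [fejerDensity_eq, div_eq_inv_mul, mul_assoc, Finset.sum_mul]
    congr 1
    refine Finset.sum_congr rfl fun m _ => ?_
    rw [Finset.sum_mul]
    refine Finset.sum_congr rfl fun n _ => ?_
    rw [mFourier_add, mul_assoc]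
  simp only [e]
  rw [integral_const_mul, integral_finsetSum _ fun m _ => integrable_finsetSum _ fun n _ => hint _ _]
  have h1 : ∀ m ∈ intBox d N, ∫ x, ∑ n ∈ intBox d N, inner ℂ (V m) (V n) * mFourier (m - n + k) x
      ∂(torusHaar d) = if m + k ∈ intBox d N then inner ℂ (V 0) (V k) else 0 := by
    intro m _
    rw [integral_finsetSum _ fun n _ => hint _ _]
    simp only [integral_const_mul, integral_mFourier_torusHaar]
    have h2 : ∀ n, m - n + k = 0 ↔ n = m + k := fun n => by
      rw [sub_add_eq_add_sub, sub_eq_zero]; exact eq_comm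
    simp only [h2, mul_ite, mul_one, mul_zero]
    rw [Finset.sum_ite_eq' ]
    split_ifs with h3
    · have := hV 0 k m
      rw [zero_add, add_comm k m] at this
      exact this
    · rfl
  rw [Finset.sum_congr rfl h1, ← Finset.sum_filter, Finset.sum_const, nsmul_eq_mul]
  push_cast
  ring

/-- **Herglotz's theorem** for stationary families of vectors indexed by `ℤ ^ d`. -/
theorem exists_spectralMeasure {V : (d → ℤ) → E}
    (hV : ∀ m n k, inner ℂ (V (m + k)) (V (n + k)) = inner ℂ (V m) (V n)) :
    ∃ σ : Measure (UnitAddTorus d), IsFiniteMeasure σ ∧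
      ∀ m n, ∫ x, mFourier (n - m) x ∂σ = inner ℂ (V m) (V n) := by
  classical
  set ρ : ℕ → Measure (UnitAddTorus d) := fun N =>
    (torusHaar d).withDensity fun x => ((fejerDensity V N x).toNNReal : ℝ≥0∞) with hρ
  have hmeas : ∀ N, Measurable fun x => (fejerDensity V N x).toNNReal := fun N =>
    (continuous_real_toNNReal.comp (continuous_fejerDensity V N)).measurable
  have hρfin : ∀ N, IsFiniteMeasure (ρ N) := by
    intro N
    refine isFiniteMeasure_withDensity_ofReal (Integrable.hasFiniteIntegral ?_)
    exact (continuous_fejerDensity V N).integrable_of_hasCompactSupport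
      (HasCompactSupport.of_compactSpace _)
  have hρint : ∀ N (k : d → ℤ), ∫ x, mFourier k x ∂(ρ N) =
      inner ℂ (V 0) (V k) * ((((intBox d N).filter fun m => m + k ∈ intBox d N).card : ℝ) /
      (intBox d N).card : ℝ) := by
    intro N k
    rw [hρ, integral_withDensity_eq_integral_smul (hmeas N), ← integral_fejerDensity_mul hV]
    refine integral_congr_ae (Eventually.of_forall fun x => ?_)
    simp only [NNReal.smul_def, Real.coe_toNNReal _ (fejerDensity_nonneg V N x),
      Complex.real_smul]
  set Ρ : ℕ → FiniteMeasure (UnitAddTorus d) := fun N => ⟨ρ N, hρfin N⟩ with hΡ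
  set C : NNReal := ‖V 0‖₊ ^ 2 with hC
  have hmass : ∀ N, (Ρ N).mass ≤ C := by
    intro N
    have h1 := hρint N 0
    have h2 : ∫ x, mFourier (0 : d → ℤ) x ∂(ρ N) = ((ρ N).real Set.univ : ℂ) := by
      rw [mFourier_zero]; simp
    rw [h2, inner_self_eq_norm_sq_to_K] at h1
    have h3 : (ρ N).real Set.univ = ‖V 0‖ ^ 2 *
        ((((intBox d N).filter fun m => m + 0 ∈ intBox d N).card : ℝ) / (intBox d N).card) := by
      simp only [Complex.coe_algebraMap] at h1
      exact_mod_cast h1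
    have h4 : ((((intBox d N).filter fun m => m + 0 ∈ intBox d N).card : ℝ) /
        (intBox d N).card) ≤ 1 := by
      apply div_le_one_of_le₀ _ (Nat.cast_nonneg _)
      exact_mod_cast Finset.card_filter_le _ _
    have h5 : (ρ N).real Set.univ ≤ ‖V 0‖ ^ 2 := by
      rw [h3]; exact mul_le_of_le_one_right (by positivity) h4
    rw [← NNReal.coe_le_coe, hC]
    push_cast
    exact h5
  -- The Fejér measures have mass at most `‖V 0‖ ^ 2`, so they lie in a weakly compact set. A limit
  -- along an ultrafilter exists, and its Fourier coefficients are the limits of theirs.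
  obtain ⟨𝒰, h𝒰⟩ : ∃ 𝒰 : Ultrafilter ℕ, (𝒰 : Filter ℕ) ≤ atTop :=
    ⟨Ultrafilter.of atTop, Ultrafilter.of_le _⟩
  have hcomp := isCompact_setOfPred_finiteMeasure_le_of_compactSpace (UnitAddTorus d) C
  obtain ⟨σ, -, hσ⟩ := isCompact_iff_ultrafilter_le_nhds.1 hcomp (𝒰.map Ρ) (by
    rw [le_principal_iff, Ultrafilter.mem_coe, Ultrafilter.mem_map]
    exact Filter.univ_mem' hmass)
  have hlim : Tendsto Ρ 𝒰 (𝓝 σ) := hσ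
  rw [FiniteMeasure.tendsto_iff_forall_integral_rclike_tendsto ℂ] at hlim
  refine ⟨σ, inferInstance, fun m n => ?_⟩
  have h1 := hlim (BoundedContinuousFunction.mkOfCompact (mFourier (n - m)))
  have h2 : Tendsto (fun N => ∫ x, mFourier (n - m) x ∂(ρ N)) 𝒰
      (𝓝 (inner ℂ (V 0) (V (n - m)) * ((1 : ℝ) : ℂ))) := by
    simp only [hρint]
    exact ((Complex.continuous_ofReal.tendsto _).comp
      ((tendsto_card_intBox_inter (n - m)).mono_left h𝒰)).const_mul _
  have h3 := tendsto_nhds_unique h1 h2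
  have h4 := hV 0 (n - m) m
  rw [zero_add, sub_add_cancel] at h4
  rw [h4, ← mul_one (inner ℂ (V 0) (V (n - m)))]
  exact_mod_cast h3

/-- The spectral isometry for finite linear combinations. -/
lemma norm_sq_sum_eq_integral {V : (d → ℤ) → E} {σ : Measure (UnitAddTorus d)} [IsFiniteMeasure σ]
    (hσ : ∀ m n, ∫ x, mFourier (n - m) x ∂σ = inner ℂ (V m) (V n)) {ι : Type*} (s : Finset ι)
    (c : ι → ℂ) (m : ι → d → ℤ) :
    ‖∑ i ∈ s, c i • V (m i)‖ ^ 2 = ∫ x, ‖∑ i ∈ s, c i * mFourier (m i) x‖ ^ 2 ∂σ := by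
  have hint : ∀ (c : ℂ) (j : d → ℤ), Integrable (fun x => c * mFourier j x) σ :=
    fun c j => ((mFourier j).continuous.integrable_of_hasCompactSupport
      (HasCompactSupport.of_compactSpace _)).const_mul c
  have h1 : ((‖∑ i ∈ s, c i • V (m i)‖ ^ 2 : ℝ) : ℂ) =
      ((∫ x, ‖∑ i ∈ s, c i * mFourier (m i) x‖ ^ 2 ∂σ : ℝ) : ℂ) := by
    have h2 : ∀ x, ((‖∑ i ∈ s, c i * mFourier (m i) x‖ ^ 2 : ℝ) : ℂ) = ∑ i ∈ s, ∑ j ∈ s,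
        ((starRingEnd ℂ) (c i) * c j) * mFourier (m j - m i) x := by
      intro x
      push_cast
      rw [← Complex.conj_mul', map_sum, Finset.sum_mul_sum]
      refine Finset.sum_congr rfl fun i _ => Finset.sum_congr rfl fun j _ => ?_
      rw [map_mul, ← mFourier_neg, sub_eq_neg_add, mFourier_add]
      ring
    rw [← integral_complex_ofReal]
    simp only [h2]
    rw [integral_finsetSum _ fun m _ => integrable_finsetSum _ fun n _ => hint _ _]
    have := inner_self_eq_norm_sq_to_K (𝕜 := ℂ) (∑ i ∈ s, c i • V (m i))
    simp only [Complex.coe_algebraMap] at this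
    push_cast
    rw [← this, sum_inner]
    refine Finset.sum_congr rfl fun i _ => ?_
    rw [inner_sum, integral_finsetSum _ fun n _ => hint _ _]
    refine Finset.sum_congr rfl fun j _ => ?_
    rw [integral_const_mul, hσ, inner_smul_left, inner_smul_right]
    ring
  exact_mod_cast h1

end Herglotz

/-! ### Decay of correlations of continuous measures along integer parts -/

lemma fourier_coe_eq_unitExp (n : ℤ) (t : ℝ) : fourier n (t : UnitAddCircle) = unitExp (n * t) := by
  rw [fourier_coe_apply, unitExp]
  push_cast
  ring_nf

/-- Double Cesàro means. -/
noncomputable def cesaro₂ (u : ℕ → ℕ → ℂ) (N : ℕ) : ℂ :=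
  (∑ n ∈ Finset.Icc 1 N, ∑ m ∈ Finset.Icc 1 N, u n m) / (N : ℂ) ^ 2

lemma norm_cesaro₂_le {u : ℕ → ℕ → ℂ} {C : ℝ} (hC : 0 ≤ C) (h : ∀ n m, ‖u n m‖ ≤ C) (N : ℕ) :
    ‖cesaro₂ u N‖ ≤ C := by
  rcases Nat.eq_zero_or_pos N with rfl | hN
  · simpa [cesaro₂] using hC
  have hN' : (0 : ℝ) < N := by exact_mod_cast hN
  rw [cesaro₂, norm_div, norm_pow, Complex.norm_natCast, div_le_iff₀ (by positivity)]
  refine (norm_sum_le_of_le _ fun n _ => norm_sum_le_of_le _ fun m _ => h n m).trans ?_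
  simp
  apply le_of_eq; ring

lemma cesaro₂_add (u v : ℕ → ℕ → ℂ) (N : ℕ) :
    cesaro₂ (fun n m => u n m + v n m) N = cesaro₂ u N + cesaro₂ v N := by
  simp [cesaro₂, Finset.sum_add_distrib, add_div]

lemma cesaro₂_const_mul (c : ℂ) (u : ℕ → ℕ → ℂ) (N : ℕ) :
    cesaro₂ (fun n m => c * u n m) N = c * cesaro₂ u N := by
  simp only [cesaro₂, ← Finset.mul_sum]
  ring

lemma cesaro₂_mul_star (u : ℕ → ℂ) (N : ℕ) :
    cesaro₂ (fun n m => u n * (starRingEnd ℂ) (u m)) N =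
      cesaro u N * (starRingEnd ℂ) (cesaro u N) := by
  simp only [cesaro₂, cesaro, ← Finset.mul_sum, ← Finset.sum_mul, ← map_sum, map_mul]
  simp
  ring

/-- For a character `G` of index `k` the double mean is the squared modulus of the mean of `e((t +
k) a n)`. Density of trigonometric polynomials extends this to continuous `G`. -/
lemma tendsto_cesaro₂_unitExp_mul {a : ℕ → ℝ} {t : ℝ}
    (h : ∀ k : ℤ, Tendsto (cesaro fun n => unitExp ((t + k) * a n)) atTop (𝓝 0))
    (G : C(UnitAddCircle, ℂ)) :
    Tendsto (cesaro₂ fun n m => unitExp (t * (a n - a m)) * G ((a n - a m : ℝ) : UnitAddCircle))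
      atTop (𝓝 0) := by
  have hG : G ∈ (Submodule.span ℂ (Set.range (fourier (T := (1 : ℝ))))).topologicalClosure := by
    rw [span_fourier_closure_eq_top]; trivial
  have hspan : ∀ F ∈ Submodule.span ℂ (Set.range (fourier (T := (1 : ℝ)))),
      Tendsto (cesaro₂ fun n m => unitExp (t * (a n - a m)) *
        F ((a n - a m : ℝ) : UnitAddCircle)) atTop (𝓝 0) := by
    intro F hF
    induction hF using Submodule.span_induction with
    | mem F hF =>
      obtain ⟨k, rfl⟩ := hF
      have h1 := (h k).mul ((Complex.continuous_conj.tendsto 0).comp (h k))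
      rw [zero_mul] at h1
      refine h1.congr fun N => ?_
      rw [Function.comp_apply, ← cesaro₂_mul_star]
      congr 1
      ext n m
      rw [fourier_coe_eq_unitExp, ← unitExp_sub, ← unitExp_add]
      congr 1
      ring
    | zero =>
      have : (cesaro₂ fun _ _ => 0) = fun _ => 0 := by ext N; simp [cesaro₂]
      simp [this]
    | add F F' _ _ hF hF' =>
      have := hF.add hF'
      rw [add_zero] at this
      refine this.congr fun N => ?_
      rw [← cesaro₂_add]
      simp only [ContinuousMap.add_apply, mul_add]
    | smul c F _ hF =>
      have := hF.const_mul c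
      rw [mul_zero] at this
      refine this.congr fun N => ?_
      rw [← cesaro₂_const_mul]
      simp only [ContinuousMap.smul_apply, smul_eq_mul, mul_left_comm c]
  rw [Metric.tendsto_nhds]
  intro ε hε
  obtain ⟨F, hF, hFG⟩ := Metric.mem_closure_iff.1 hG (ε / 2) (by positivity)
  filter_upwards [Metric.tendsto_nhds.1 (hspan F hF) (ε / 2) (by positivity)] with N hN
  rw [dist_zero_right] at hN ⊢
  have e : cesaro₂ (fun n m => unitExp (t * (a n - a m)) * G ((a n - a m : ℝ) : UnitAddCircle)) N =
      cesaro₂ (fun n m => unitExp (t * (a n - a m)) * (G - F) ((a n - a m : ℝ) : UnitAddCircle)) N +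
      cesaro₂ (fun n m => unitExp (t * (a n - a m)) * F ((a n - a m : ℝ) : UnitAddCircle)) N := by
    rw [← cesaro₂_add]
    simp only [ContinuousMap.sub_apply, ← mul_add, sub_add_cancel]
  rw [e]
  refine (norm_add_le _ _).trans_lt ?_
  have h1 : ‖cesaro₂ (fun n m => unitExp (t * (a n - a m)) *
      (G - F) ((a n - a m : ℝ) : UnitAddCircle)) N‖ ≤ ‖G - F‖ := by
    refine norm_cesaro₂_le (norm_nonneg _) (fun n m => ?_) N
    rw [norm_mul, norm_unitExp, one_mul]
    exact (G - F).norm_coe_le_norm _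
  rw [dist_eq_norm] at hFG
  linarith

/-- An interpolation of `fourier` in the frequency variable, with a tent of integral four. -/
noncomputable def tentKernel (θ : UnitAddCircle) (z : ℝ) : ℂ :=
  (1 - Int.fract z : ℝ) * fourier (⌊z⌋ - 1) θ + (2 - Int.fract z : ℝ) * fourier ⌊z⌋ θ +
    (1 + Int.fract z : ℝ) * fourier (⌊z⌋ + 1) θ + (Int.fract z : ℝ) * fourier (⌊z⌋ + 2) θ

lemma norm_tentKernel_le (θ : UnitAddCircle) (z : ℝ) : ‖tentKernel θ z‖ ≤ 4 := by
  have h0 := Int.fract_nonneg z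
  have h1 := (Int.fract_lt_one z).le
  have hf : ∀ (c : ℝ) (k : ℤ), 0 ≤ c → ‖(c : ℂ) * fourier k θ‖ = c := by
    intro c k hc
    rw [norm_mul, Complex.norm_real, Real.norm_of_nonneg hc, fourier_apply, Circle.norm_coe,
      mul_one]
  unfold tentKernel
  refine (norm_add_le _ _).trans ?_
  refine (add_le_add (norm_add_le _ _) le_rfl).trans ?_
  refine (add_le_add (add_le_add (norm_add_le _ _) le_rfl) le_rfl).trans ?_
  rw [hf _ _ (by linarith), hf _ _ (by linarith), hf _ _ (by linarith), hf _ _ h0]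
  linarith

lemma continuous_tentKernel (z : ℝ) : Continuous fun θ => tentKernel θ z := by
  unfold tentKernel
  fun_prop

/-- After `e(t z)` is factored out, the kernel depends only on the fractional part of `z`, and the
tent weights make the values at 0 and 1 agree. The cofactor is therefore continuous on the circle,
unlike the one obtained from an integer part alone. -/
lemma exists_tentKernel_eq (t : ℝ) : ∃ G : C(UnitAddCircle, ℂ), ∀ z : ℝ,
    tentKernel (t : UnitAddCircle) z = unitExp (t * z) * G (z : UnitAddCircle) := by
  set g : ℝ → ℂ := fun r => (1 - r : ℝ) * unitExp (-t * (r + 1)) + (2 - r : ℝ) * unitExp (-t * r) +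
    (1 + r : ℝ) * unitExp (-t * (r - 1)) + (r : ℝ) * unitExp (-t * (r - 2)) with hg
  have hgc : Continuous g := by
    have := continuous_unitExp
    simp only [hg]
    fun_prop
  have h01 : g 0 = g (0 + 1) := by
    simp only [hg]
    norm_num
  refine ⟨⟨AddCircle.liftIco 1 0 g, AddCircle.liftIco_continuous h01 hgc.continuousOn⟩,
    fun z => ?_⟩
  have hr : Int.fract z ∈ Set.Ico (0 : ℝ) (0 + 1) :=
    ⟨Int.fract_nonneg z, by rw [zero_add]; exact Int.fract_lt_one z⟩
  have hG : AddCircle.liftIco 1 0 g (z : UnitAddCircle) = g (Int.fract z) := by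
    rw [← AddCircle.coe_fract z]
    exact AddCircle.liftIco_coe_apply hr
  rw [ContinuousMap.coe_mk, hG]
  simp only [hg, tentKernel, fourier_coe_eq_unitExp, mul_add]
  have hz : z = ⌊z⌋ + Int.fract z := (Int.floor_add_fract z).symm
  have hsplit : ∀ (c : ℂ) (x : ℝ), unitExp (t * z) * (c * unitExp x) = c * unitExp (t * z + x) := by
    intro c x; rw [unitExp_add]; ring
  simp only [hsplit]
  have e : t * z = t * ⌊z⌋ + t * Int.fract z := by rw [← mul_add, ← hz]
  rw [e]
  push_cast
  congr 1
  · congr 1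
    · congr 1
      · congr 2; ring
      · congr 2; ring
    · congr 2; ring
  · congr 2; ring

/-- Squared Fourier coefficients are coefficients of the distribution of the difference of two
independent points. Their nonnegativity is what allows domination by the tent kernel. -/
lemma integral_fourier_sub {τ : Measure UnitAddCircle} [IsFiniteMeasure τ] (k : ℤ) :
    ∫ p, fourier k (p.1 - p.2) ∂(τ.prod τ) = ((‖∫ x, fourier k x ∂τ‖ ^ 2 : ℝ) : ℂ) := by
  have h : ∀ p : UnitAddCircle × UnitAddCircle, fourier k (p.1 - p.2) =
      fourier k p.1 * (starRingEnd ℂ) (fourier k p.2) := by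
    intro p
    rw [← fourier_neg, sub_eq_add_neg]
    simp only [fourier_apply, smul_add, neg_smul, smul_neg, AddCircle.toCircle_add,
      Circle.coe_mul]
  simp only [h]
  rw [integral_prod_mul (fun x => fourier k x) (fun x => (starRingEnd ℂ) (fourier k x)),
    integral_conj, Complex.mul_conj']
  push_cast
  rfl

lemma integrable_of_continuous {Y : Type*} [TopologicalSpace Y] [CompactSpace Y]
    [MeasurableSpace Y] [BorelSpace Y] {ν : Measure Y} [IsFiniteMeasure ν] {F : Type*}
    [NormedAddCommGroup F] [SecondCountableTopologyEither Y F] {f : Y → F} (hf : Continuous f) :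
    Integrable f ν :=
  hf.integrable_of_hasCompactSupport (HasCompactSupport.of_compactSpace _)

lemma integral_tentKernel {τ : Measure UnitAddCircle} [IsFiniteMeasure τ] (z : ℝ) :
    ∫ p, tentKernel (p.1 - p.2) z ∂(τ.prod τ) =
      (((1 - Int.fract z) * ‖∫ x, fourier (⌊z⌋ - 1) x ∂τ‖ ^ 2 +
        (2 - Int.fract z) * ‖∫ x, fourier ⌊z⌋ x ∂τ‖ ^ 2 +
        (1 + Int.fract z) * ‖∫ x, fourier (⌊z⌋ + 1) x ∂τ‖ ^ 2 +
        Int.fract z * ‖∫ x, fourier (⌊z⌋ + 2) x ∂τ‖ ^ 2 : ℝ) : ℂ) := by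
  have hc : ∀ (c : ℂ) (k : ℤ), Integrable (fun p : UnitAddCircle × UnitAddCircle =>
      c * fourier k (p.1 - p.2)) (τ.prod τ) := fun c k =>
    integrable_of_continuous (by fun_prop)
  unfold tentKernel
  rw [integral_add (((hc _ _).fun_add (hc _ _)).fun_add (hc _ _)) (hc _ _),
    integral_add ((hc _ _).fun_add (hc _ _)) (hc _ _), integral_add (hc _ _) (hc _ _)]
  simp only [integral_const_mul, integral_fourier_sub]
  push_cast
  rfl

/-- Positivity: the correlation at an integer part is dominated by the tent kernel. -/
lemma norm_sq_integral_fourier_floor_sub_le {τ : Measure UnitAddCircle} [IsFiniteMeasure τ]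
    (x y : ℝ) : ((‖∫ s, fourier (⌊x⌋ - ⌊y⌋) s ∂τ‖ ^ 2 : ℝ)) ≤
      (∫ p, tentKernel (p.1 - p.2) (x - y) ∂(τ.prod τ)).re := by
  rw [integral_tentKernel, Complex.ofReal_re]
  set z := x - y with hz
  have h0 := Int.fract_nonneg z
  have h1 := (Int.fract_lt_one z).le
  have hw : ∀ k : ℤ, 0 ≤ ‖∫ s, fourier k s ∂τ‖ ^ 2 := fun k => by positivity
  -- With `z = x - y`, only these two frequencies can occur, and their tent weights `2 - fract z`
  -- and `1 + fract z` are both at least 1. All other weights are nonnegative.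
  have hcase : ⌊x⌋ - ⌊y⌋ = ⌊z⌋ ∨ ⌊x⌋ - ⌊y⌋ = ⌊z⌋ + 1 := by
    have a1 := Int.floor_le x
    have a2 := Int.lt_floor_add_one x
    have b1 := Int.floor_le y
    have b2 := Int.lt_floor_add_one y
    have c1 : ⌊z⌋ ≤ ⌊x⌋ - ⌊y⌋ := by
      rw [← Int.lt_add_one_iff, Int.floor_lt]; push_cast; linarith
    have c2 : ⌊x⌋ - ⌊y⌋ - 1 ≤ ⌊z⌋ := by
      rw [Int.le_floor]; push_cast; linarith
    omega
  have w1 := hw (⌊z⌋ - 1)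
  have w2 := hw ⌊z⌋
  have w3 := hw (⌊z⌋ + 1)
  have w4 := hw (⌊z⌋ + 2)
  have p1 := mul_nonneg (sub_nonneg.2 h1) w1
  have p2 := mul_nonneg (sub_nonneg.2 h1) w2
  have p3 := mul_nonneg h0 w3
  have p4 := mul_nonneg h0 w4
  rcases hcase with h | h <;> rw [h] <;> linarith

/-- Along integer parts of a sequence almost all of whose multiples have vanishing exponential
means, the correlations of a continuous measure on the circle vanish in the mean. -/
theorem tendsto_correlations_of_noAtoms {a : ℕ → ℝ} {Z : Set ℝ} (hZ : Z.Countable)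
    (ha : ∀ ξ ∉ Z, Tendsto (cesaro fun n => unitExp (ξ * a n)) atTop (𝓝 0))
    (τ : Measure UnitAddCircle) [IsFiniteMeasure τ] [NullSingletonClass τ] :
    Tendsto (fun N : ℕ => (∑ n ∈ Finset.Icc 1 N, ∑ m ∈ Finset.Icc 1 N,
      ‖∫ x, fourier (⌊a n⌋ - ⌊a m⌋) x ∂τ‖ ^ 2) / (N : ℝ) ^ 2) atTop (𝓝 0) := by
  set Z' : Set UnitAddCircle := (fun ξ : ℝ => (ξ : UnitAddCircle)) '' Z with hZ'
  have hZc : Z'.Countable := hZ.image _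
  -- For a fixed first coordinate the exceptional second coordinates form a countable set, which is
  -- null because `τ` has no atoms.
  have hnull : ∀ᵐ p ∂(τ.prod τ), p.1 - p.2 ∉ Z' := by
    have hm : MeasurableSet {p : UnitAddCircle × UnitAddCircle | p.1 - p.2 ∈ Z'} :=
      (measurable_fst.sub measurable_snd) hZc.measurableSet
    have : (τ.prod τ) {p : UnitAddCircle × UnitAddCircle | p.1 - p.2 ∈ Z'} = 0 := by
      rw [Measure.measure_prod_null hm]
      refine Eventually.of_forall fun s => ?_
      refine Set.Countable.measure_zero ?_ τ
      have : Prod.mk s ⁻¹' {p : UnitAddCircle × UnitAddCircle | p.1 - p.2 ∈ Z'} ⊆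
          (fun θ => s - θ) '' Z' := by
        intro t ht
        exact ⟨s - t, ht, by simp⟩
      exact (hZc.image _).mono this
    exact measure_eq_zero_iff_ae_notMem.1 this
  have hptw : ∀ θ : UnitAddCircle, θ ∉ Z' →
      Tendsto (cesaro₂ fun n m => tentKernel θ (a n - a m)) atTop (𝓝 0) := by
    intro θ hθ
    obtain ⟨t, rfl⟩ := QuotientAddGroup.mk_surjective θ
    obtain ⟨G, hG⟩ := exists_tentKernel_eq t
    have hG' : ∀ z : ℝ, tentKernel (QuotientAddGroup.mk t : UnitAddCircle) z =
      unitExp (t * z) * G (z : UnitAddCircle) := hG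
    simp only [hG']
    refine tendsto_cesaro₂_unitExp_mul (fun k => ha _ fun hk => hθ ⟨_, hk, ?_⟩) G
    show ((t + k : ℝ) : UnitAddCircle) = (t : UnitAddCircle)
    rw [AddCircle.coe_add]
    have : ((k : ℝ) : UnitAddCircle) = 0 := by
      rw [AddCircle.coe_eq_zero_iff]
      exact ⟨k, by simp⟩
    rw [this, add_zero]
  have hcont : ∀ N, Continuous fun p : UnitAddCircle × UnitAddCircle =>
      cesaro₂ (fun n m => tentKernel (p.1 - p.2) (a n - a m)) N := by
    intro N
    unfold cesaro₂
    refine Continuous.div_const (continuous_finsetSum _ fun n _ => continuous_finsetSum _ fun m _ =>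
      (continuous_tentKernel _).comp (continuous_fst.sub continuous_snd)) _
  have hlim : Tendsto (fun N => ∫ p, cesaro₂ (fun n m => tentKernel (p.1 - p.2) (a n - a m)) N
      ∂(τ.prod τ)) atTop (𝓝 (∫ _, (0 : ℂ) ∂(τ.prod τ))) := by
    refine tendsto_integral_of_dominated_convergence (fun _ => 4)
      (fun N => (hcont N).aestronglyMeasurable) (integrable_const _)
      (fun N => Eventually.of_forall fun p =>
        norm_cesaro₂_le (by norm_num) (fun n m => norm_tentKernel_le _ _) N) ?_
    filter_upwards [hnull] with p hp using hptw _ hp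
  rw [integral_zero] at hlim
  have hre := (Complex.continuous_re.tendsto 0).comp hlim
  rw [Complex.zero_re] at hre
  refine squeeze_zero (fun N => by positivity) (fun N => ?_) hre
  have hint : ∀ n m : ℕ, Integrable (fun p : UnitAddCircle × UnitAddCircle =>
      tentKernel (p.1 - p.2) (a n - a m)) (τ.prod τ) := fun n m =>
    integrable_of_continuous ((continuous_tentKernel _).comp (continuous_fst.sub continuous_snd))
  have e : (∫ p, cesaro₂ (fun n m => tentKernel (p.1 - p.2) (a n - a m)) N ∂(τ.prod τ)).re =
      (∑ n ∈ Finset.Icc 1 N, ∑ m ∈ Finset.Icc 1 N,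
        (∫ p, tentKernel (p.1 - p.2) (a n - a m) ∂(τ.prod τ)).re) / (N : ℝ) ^ 2 := by
    unfold cesaro₂
    rw [integral_div, integral_finsetSum _ fun n _ => integrable_finsetSum _ fun m _ => hint n m]
    have h2 : ((N : ℂ) ^ 2) = (((N : ℝ) ^ 2 : ℝ) : ℂ) := by push_cast; rfl
    rw [h2, Complex.div_ofReal_re, Complex.re_sum]
    congr 1
    refine Finset.sum_congr rfl fun n _ => ?_
    rw [integral_finsetSum _ fun m _ => hint n m, Complex.re_sum]
  rw [Function.comp_apply, e]
  gcongr with n _ m _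
  exact norm_sq_integral_fourier_floor_sub_le _ _

/-! ### Koopman operators and averages in `L²` -/

section Koopman

variable {Y : Type*} [MeasurableSpace Y] {ν : Measure Y}

/-- The Koopman operator of a measure preserving map. -/
noncomputable def koopman (S : Y → Y) (hS : MeasurePreserving S ν ν) : Lp ℂ 2 ν →L[ℂ] Lp ℂ 2 ν :=
  (Lp.compMeasurePreservingₗᵢ ℂ S hS).toContinuousLinearMap

lemma koopman_coeFn {S : Y → Y} (hS : MeasurePreserving S ν ν) (v : Lp ℂ 2 ν) :
    koopman S hS v =ᵐ[ν] v ∘ S := Lp.coeFn_compMeasurePreserving v hS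

lemma koopman_toLp {S : Y → Y} (hS : MeasurePreserving S ν ν) {f : Y → ℂ} (hf : MemLp f 2 ν) :
    koopman S hS (hf.toLp f) = (hf.comp_measurePreserving hS).toLp (f ∘ S) := rfl

lemma norm_koopman {S : Y → Y} (hS : MeasurePreserving S ν ν) (v : Lp ℂ 2 ν) :
    ‖koopman S hS v‖ = ‖v‖ := Lp.norm_compMeasurePreserving v hS

lemma inner_toLp_toLp {f g : Y → ℂ} (hf : MemLp f 2 ν) (hg : MemLp g 2 ν) :
    inner ℂ (hf.toLp f) (hg.toLp g) = ∫ y, (starRingEnd ℂ) (f y) * g y ∂ν := by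
  rw [L2.inner_def]
  refine integral_congr_ae ?_
  filter_upwards [hf.coeFn_toLp, hg.coeFn_toLp] with y h1 h2
  rw [h1, h2, RCLike.inner_apply']

variable {S : ℕ → Y → Y}

/-- The averages of the Koopman operators of a sequence of measure preserving maps. -/
noncomputable def koopmanAvg (S : ℕ → Y → Y) (hS : ∀ n, MeasurePreserving (S n) ν ν) (N : ℕ) :
    Lp ℂ 2 ν →L[ℂ] Lp ℂ 2 ν :=
  (1 / (N : ℂ)) • ∑ n ∈ Finset.Icc 1 N, koopman (S n) (hS n)

lemma koopmanAvg_apply (hS : ∀ n, MeasurePreserving (S n) ν ν) (N : ℕ) (v : Lp ℂ 2 ν) :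
    koopmanAvg S hS N v = (1 / (N : ℂ)) • ∑ n ∈ Finset.Icc 1 N, koopman (S n) (hS n) v := by
  simp [koopmanAvg]

lemma norm_koopmanAvg_le (hS : ∀ n, MeasurePreserving (S n) ν ν) (N : ℕ) (v : Lp ℂ 2 ν) :
    ‖koopmanAvg S hS N v‖ ≤ ‖v‖ := by
  rw [koopmanAvg_apply, norm_smul]
  rcases Nat.eq_zero_or_pos N with rfl | hN
  · simp
  have hN' : (0 : ℝ) < N := by exact_mod_cast hN
  have : ‖∑ n ∈ Finset.Icc 1 N, koopman (S n) (hS n) v‖ ≤ N * ‖v‖ := by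
    refine (norm_sum_le_of_le _ fun n _ => (norm_koopman (hS n) v).le).trans ?_
    simp
  rw [norm_div, norm_one, Complex.norm_natCast, div_mul_eq_mul_div, one_mul, div_le_iff₀ hN']
  linarith

lemma koopmanAvg_toLp_coeFn (hS : ∀ n, MeasurePreserving (S n) ν ν) (N : ℕ) {f : Y → ℂ}
    (hf : MemLp f 2 ν) : koopmanAvg S hS N (hf.toLp f) =ᵐ[ν]
      fun y => (1 / (N : ℂ)) * ∑ n ∈ Finset.Icc 1 N, f (S n y) := by
  have h1 : ∀ᵐ y ∂ν, ∀ n : ℕ, koopman (S n) (hS n) (hf.toLp f) y = f (S n y) := by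
    rw [ae_all_iff]
    intro n
    rw [koopman_toLp]
    exact (hf.comp_measurePreserving (hS n)).coeFn_toLp
  rw [koopmanAvg_apply]
  filter_upwards [h1, Lp.coeFn_smul (1 / (N : ℂ))
    (∑ n ∈ Finset.Icc 1 N, koopman (S n) (hS n) (hf.toLp f)),
    Lp.coeFn_finsetSum (Finset.Icc 1 N) (fun n => koopman (S n) (hS n) (hf.toLp f))] with y h1 h2 h3
  rw [h2, Pi.smul_apply, h3, Finset.sum_apply]
  simp only [h1, smul_eq_mul]

variable [IsProbabilityMeasure ν]

/-- The constant function `1` in `L²`. -/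
noncomputable def oneLp (ν : Measure Y) [IsProbabilityMeasure ν] : Lp ℂ 2 ν :=
  indicatorConstLp 2 MeasurableSet.univ (measure_ne_top ν _) 1

lemma oneLp_coeFn : oneLp ν =ᵐ[ν] fun _ => (1 : ℂ) := by
  have := indicatorConstLp_coeFn (p := 2) (hs := MeasurableSet.univ) (hμs := measure_ne_top ν _)
    (c := (1 : ℂ))
  simpa [oneLp] using this

lemma inner_oneLp (v : Lp ℂ 2 ν) : inner ℂ (oneLp ν) v = ∫ y, v y ∂ν := by
  rw [oneLp, L2.inner_indicatorConstLp_one, Measure.restrict_univ]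

lemma inner_oneLp_toLp {f : Y → ℂ} (hf : MemLp f 2 ν) :
    inner ℂ (oneLp ν) (hf.toLp f) = ∫ y, f y ∂ν := by
  rw [inner_oneLp]
  exact integral_congr_ae hf.coeFn_toLp

lemma norm_oneLp : ‖oneLp ν‖ = 1 := by
  have : inner ℂ (oneLp ν) (oneLp ν) = (1 : ℂ) := by
    rw [inner_oneLp, integral_congr_ae oneLp_coeFn]; simp
  rw [inner_self_eq_norm_sq_to_K] at this
  have h2 : ‖oneLp ν‖ ^ 2 = 1 := by
    simp only [Complex.coe_algebraMap] at this
    exact_mod_cast this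

  nlinarith [norm_nonneg (oneLp ν)]

/-- The orthogonal projection to the constants. -/
noncomputable def meanProj (ν : Measure Y) [IsProbabilityMeasure ν] : Lp ℂ 2 ν →L[ℂ] Lp ℂ 2 ν :=
  (innerSL ℂ (oneLp ν)).smulRight (oneLp ν)

lemma meanProj_apply (v : Lp ℂ 2 ν) : meanProj ν v = inner ℂ (oneLp ν) v • oneLp ν := rfl

/-- Pythagoras. Since averages keep the mean, their convergence to it is reduced to the convergence
of their norms, which spectral measures compute. -/
lemma norm_sub_meanProj_sq (v w : Lp ℂ 2 ν) (h : inner ℂ (oneLp ν) w = inner ℂ (oneLp ν) v) :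
    ‖w - meanProj ν v‖ ^ 2 = ‖w‖ ^ 2 - ‖inner ℂ (oneLp ν) v‖ ^ 2 := by
  rw [meanProj_apply, @norm_sub_sq ℂ, inner_smul_right, ← inner_conj_symm w (oneLp ν), h,
    RCLike.mul_conj, norm_smul, norm_oneLp]
  norm_cast
  ring

lemma koopman_inner_oneLp {S : Y → Y} (hS : MeasurePreserving S ν ν) (v : Lp ℂ 2 ν) :
    inner ℂ (oneLp ν) (koopman S hS v) = inner ℂ (oneLp ν) v := by
  rw [inner_oneLp, inner_oneLp, integral_congr_ae (koopman_coeFn hS v)]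
  have h := integral_map (f := (v : Y → ℂ)) hS.measurable.aemeasurable
    (by rw [hS.map_eq]; exact Lp.aestronglyMeasurable v)
  rw [hS.map_eq] at h
  exact h.symm

lemma inner_oneLp_koopmanAvg (hS : ∀ n, MeasurePreserving (S n) ν ν) {N : ℕ} (hN : 0 < N)
    (v : Lp ℂ 2 ν) : inner ℂ (oneLp ν) (koopmanAvg S hS N v) = inner ℂ (oneLp ν) v := by
  have hN' : (N : ℂ) ≠ 0 := by exact_mod_cast hN.ne'
  rw [koopmanAvg_apply, inner_smul_right, inner_sum]
  simp only [koopman_inner_oneLp]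
  simp [hN']

lemma eLpNorm_average_sub (hS : ∀ n, MeasurePreserving (S n) ν ν) (N : ℕ) {f : Y → ℂ}
    (hf : MemLp f 2 ν) :
    eLpNorm (fun y => (1 / (N : ℂ)) * (∑ n ∈ Finset.Icc 1 N, f (S n y)) - ∫ z, f z ∂ν) 2 ν =
      ‖koopmanAvg S hS N (hf.toLp f) - meanProj ν (hf.toLp f)‖ₑ := by
  rw [Lp.enorm_def]
  refine eLpNorm_congr_ae ?_
  filter_upwards [koopmanAvg_toLp_coeFn hS N hf, Lp.coeFn_sub (koopmanAvg S hS N (hf.toLp f))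
    (meanProj ν (hf.toLp f)), Lp.coeFn_smul (inner ℂ (oneLp ν) (hf.toLp f)) (oneLp ν),
    oneLp_coeFn (ν := ν)] with y h1 h2 h3 h4
  rw [h2, Pi.sub_apply, h1, meanProj_apply, h3, Pi.smul_apply, h4, inner_oneLp_toLp]
  simp

lemma ergodicSeq_iff (hS : ∀ n, MeasurePreserving (S n) ν ν) :
    ErgodicSeq ν S ↔ ∀ (f : Y → ℂ) (hf : MemLp f ∞ ν), Tendsto (fun N => koopmanAvg S hS N
      ((hf.mono_exponent le_top : MemLp f 2 ν).toLp f)) atTop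
      (𝓝 (meanProj ν ((hf.mono_exponent le_top : MemLp f 2 ν).toLp f))) := by
  unfold ErgodicSeq
  refine forall₂_congr fun f hf => ?_
  simp only [eLpNorm_average_sub hS _ (hf.mono_exponent le_top : MemLp f 2 ν)]
  conv_rhs => rw [← tendsto_sub_nhds_zero_iff, tendsto_zero_iff_norm_tendsto_zero]
  rw [← ENNReal.tendsto_toReal_iff (fun _ => enorm_ne_top) ENNReal.zero_ne_top]
  simp

/-- The vectors whose averages converge to their mean. -/
noncomputable def ergodicVectors (S : ℕ → Y → Y) (hS : ∀ n, MeasurePreserving (S n) ν ν) :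
    Submodule ℂ (Lp ℂ 2 ν) where
  carrier := {v | Tendsto (fun N => koopmanAvg S hS N v) atTop (𝓝 (meanProj ν v))}
  add_mem' := by
    intro v w hv hw
    simpa using hv.add hw
  zero_mem' := by simp
  smul_mem' := by
    intro c v hv
    simpa using hv.const_smul c

lemma mem_ergodicVectors (hS : ∀ n, MeasurePreserving (S n) ν ν) {v : Lp ℂ 2 ν} :
    v ∈ ergodicVectors S hS ↔ Tendsto (fun N => koopmanAvg S hS N v) atTop (𝓝 (meanProj ν v)) :=
  Iff.rfl

/-- The averages and the projection are contractions, so convergence passes to limits of vectors. -/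
lemma isClosed_ergodicVectors (hS : ∀ n, MeasurePreserving (S n) ν ν) :
    IsClosed (ergodicVectors S hS : Set (Lp ℂ 2 ν)) := by
  refine isClosed_of_closure_subset fun v hv => ?_
  rw [SetLike.mem_coe, mem_ergodicVectors, Metric.tendsto_nhds]
  intro ε hε
  obtain ⟨w, hw, hvw⟩ := Metric.mem_closure_iff.1 hv (ε / 3) (by positivity)
  have hw' := Metric.tendsto_nhds.1 ((mem_ergodicVectors hS).1 hw) (ε / 3) (by positivity)
  filter_upwards [hw'] with N hN
  have h1 : dist (koopmanAvg S hS N v) (koopmanAvg S hS N w) ≤ dist v w := by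
    rw [dist_eq_norm, dist_eq_norm, ← map_sub]
    exact norm_koopmanAvg_le hS N _
  have h2 : dist (meanProj ν w) (meanProj ν v) ≤ dist v w := by
    rw [dist_eq_norm, dist_comm, dist_eq_norm, ← map_sub, meanProj_apply, norm_smul, norm_oneLp,
      mul_one]
    refine (norm_inner_le_norm _ _).trans ?_
    rw [norm_oneLp, one_mul]
  calc dist (koopmanAvg S hS N v) (meanProj ν v) ≤ dist (koopmanAvg S hS N v) (koopmanAvg S hS N w)
        + dist (koopmanAvg S hS N w) (meanProj ν w) + dist (meanProj ν w) (meanProj ν v) :=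
        dist_triangle4 _ _ _ _
    _ < ε := by linarith

lemma oneLp_mem_ergodicVectors (hS : ∀ n, MeasurePreserving (S n) ν ν) :
    oneLp ν ∈ ergodicVectors S hS := by
  rw [mem_ergodicVectors]
  have h1 : ∀ n, koopman (S n) (hS n) (oneLp ν) = oneLp ν := by
    intro n
    refine Lp.ext ?_
    filter_upwards [koopman_coeFn (hS n) (oneLp ν), oneLp_coeFn (ν := ν),
      (hS n).quasiMeasurePreserving.ae (oneLp_coeFn (ν := ν))] with y e1 e2 e3
    rw [e1, e2, Function.comp_apply, e3]
  have h2 : meanProj ν (oneLp ν) = oneLp ν := by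
    rw [meanProj_apply, inner_self_eq_norm_sq_to_K, norm_oneLp]; simp
  rw [h2]
  apply tendsto_const_nhds.congr'
  filter_upwards [eventually_gt_atTop 0] with N hN
  have hN' : (N : ℂ) ≠ 0 := by exact_mod_cast hN.ne'
  rw [koopmanAvg_apply]
  simp only [h1, Finset.sum_const, Nat.card_Icc, Nat.add_sub_cancel]
  rw [← Nat.cast_smul_eq_nsmul ℂ, smul_smul, one_div, inv_mul_cancel₀ hN', one_smul]

/-- The indicator function of a measurable set in `L²`. -/
noncomputable def indLp (ν : Measure Y) [IsProbabilityMeasure ν] {s : Set Y}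
    (hs : MeasurableSet s) : Lp ℂ 2 ν := indicatorConstLp 2 hs (measure_ne_top ν _) 1

/-- A sequence of measure preserving maps is ergodic as soon as the averages of the indicators of
the sets of a generating `π`-system converge. -/
lemma ergodicSeq_of_generateFrom (hS : ∀ n, MeasurePreserving (S n) ν ν) {C : Set (Set Y)}
    (hC : ‹MeasurableSpace Y› = MeasurableSpace.generateFrom C) (hpi : IsPiSystem C)
    (h : ∀ s ∈ C, ∀ hs : MeasurableSet s, indLp ν hs ∈ ergodicVectors S hS) :
    ErgodicSeq ν S := by
  have key : ∀ s (hs : MeasurableSet s), indLp ν hs ∈ ergodicVectors S hS := by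
    intro s hs
    induction s, hs using MeasurableSpace.induction_on_inter hC hpi with
    | empty =>
      have : indLp ν MeasurableSet.empty = 0 := indicatorConstLp_empty
      rw [this]
      exact zero_mem _
    | basic t ht => exact h t ht _
    | compl t ht ih =>
      have : indLp ν ht.compl = oneLp ν - indLp ν ht := by
        have := indicatorConstLp_disjoint_union (p := 2) (μ := ν) ht ht.compl
          (measure_ne_top _ _) (measure_ne_top _ _) disjoint_compl_right (1 : ℂ)
        rw [eq_sub_iff_add_eq, add_comm]
        simp only [indLp, oneLp]
        rw [← this]
        congr 1
        exact Set.union_compl_self t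
      rw [this]
      exact sub_mem (oneLp_mem_ergodicVectors hS) ih
    | iUnion t hd ht ih =>
      have hU : ∀ n, MeasurableSet (⋃ i ∈ Finset.range n, t i) := fun n =>
        Finset.measurableSet_biUnion _ fun i _ => ht i
      have h1 : ∀ n, indLp ν (hU n) ∈ ergodicVectors S hS := by
        intro n
        induction n with
        | zero =>
          have : indLp ν (hU 0) = 0 := by
            have : (⋃ i ∈ Finset.range 0, t i) = ∅ := by simp
            simp only [indLp]
            rw [← indicatorConstLp_empty (p := 2) (μ := ν) (c := (1 : ℂ))]
            congr 1
          rw [this]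
          exact zero_mem _
        | succ n ihn =>
          have : indLp ν (hU (n + 1)) = indLp ν (hU n) + indLp ν (ht n) := by
            have := indicatorConstLp_disjoint_union (p := 2) (μ := ν) (hU n) (ht n)
              (measure_ne_top _ _) (measure_ne_top _ _) (by
                rw [Set.disjoint_iUnion₂_left]
                intro i hi
                exact hd (Finset.mem_range.1 hi).ne) (1 : ℂ)
            simp only [indLp]
            rw [← this]
            congr 1
            rw [Finset.range_add_one, Finset.set_biUnion_insert, Set.union_comm]
          rw [this]
          exact add_mem ihn (ih n)
      refine (isClosed_ergodicVectors hS).mem_of_tendsto (b := atTop) ?_ (Eventually.of_forall h1)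
      refine tendsto_indicatorConstLp_set (by simp) ?_
      have h2 : Tendsto (fun n => ν ((⋃ i, t i) \ ⋃ i ∈ Finset.range n, t i)) atTop (𝓝 0) := by
        have : (⋂ n, (⋃ i, t i) \ ⋃ i ∈ Finset.range n, t i) = ∅ := by
          ext y
          simp only [Set.mem_iInter, Set.mem_sdiff, Set.mem_iUnion, Finset.mem_range,
            Set.mem_empty_iff_false, iff_false]
          intro hy
          obtain ⟨i, hi⟩ := (hy 0).1
          exact (hy (i + 1)).2 ⟨i, Nat.lt_succ_self i, hi⟩
        rw [← measure_empty (μ := ν), ← this]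
        refine tendsto_measure_iInter_atTop (fun n => ((MeasurableSet.iUnion ht).diff
          (hU n)).nullMeasurableSet) ?_ ⟨0, measure_ne_top _ _⟩
        intro m n hmn
        refine Set.sdiff_subset_sdiff_right ?_
        exact Set.biUnion_subset_biUnion_left fun i hi =>
          Finset.mem_range.2 ((Finset.mem_range.1 hi).trans_le hmn)
      refine h2.congr fun n => ?_
      congr 1
      rw [symmDiff_def]
      have : (⋃ i ∈ Finset.range n, t i) \ ⋃ i, t i = ∅ := by
        rw [Set.sdiff_eq_empty]
        exact Set.iUnion₂_subset fun i _ => Set.subset_iUnion t i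
      rw [this]
      exact (Set.empty_union _).symm
  have hall : ∀ v : Lp ℂ 2 ν, v ∈ ergodicVectors S hS := by
    intro v
    refine Lp.induction (p := 2) (by simp) (fun v => v ∈ ergodicVectors S hS) ?_ ?_
      (isClosed_ergodicVectors hS) v
    · intro c s hs hμ
      have : (Lp.simpleFunc.indicatorConst 2 hs hμ.ne c : Lp ℂ 2 ν) = c • indLp ν hs := by
        rw [Lp.simpleFunc.coe_indicatorConst]
        refine Lp.ext ?_
        filter_upwards [indicatorConstLp_coeFn (p := 2) (hs := hs) (hμs := hμ.ne) (c := c),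
          Lp.coeFn_smul c (indLp ν hs), indicatorConstLp_coeFn (p := 2) (hs := hs)
            (hμs := hμ.ne) (c := (1 : ℂ))] with y h1 h2 h3
        rw [h1, h2, Pi.smul_apply, indLp, h3]
        by_cases hy : y ∈ s <;> simp [Set.indicator, hy]
      rw [this]
      exact Submodule.smul_mem _ _ (key _ hs)
    · intro f g hf hg hd h1 h2
      exact add_mem h1 h2
  rw [ergodicSeq_iff hS]
  exact fun f hf => hall _

end Koopman

/-! ### Spectral measures on the circle and eigenvectors -/

section CircleSpectral

variable {E : Type*} [NormedAddCommGroup E] [InnerProductSpace ℂ E]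

lemma fourier_sub_apply (n m : ℤ) (x : UnitAddCircle) :
    fourier (n - m) x = fourier n x * (starRingEnd ℂ) (fourier m x) := by
  rw [sub_eq_add_neg, fourier_add, fourier_neg]

/-- `σ` is a spectral measure of the stationary family `V`. -/
def IsSpectralMeasure (σ : Measure UnitAddCircle) (V : ℤ → E) : Prop :=
  ∀ m n, ∫ x, fourier (n - m) x ∂σ = inner ℂ (V m) (V n)

lemma exists_isSpectralMeasure {V : ℤ → E}
    (hV : ∀ m n k, inner ℂ (V (m + k)) (V (n + k)) = inner ℂ (V m) (V n)) :
    ∃ σ : Measure UnitAddCircle, IsFiniteMeasure σ ∧ IsSpectralMeasure σ V := by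
  obtain ⟨σ, hfin, hσ⟩ := exists_spectralMeasure (d := Unit) (V := fun m => V (m ()))
    (fun m n k => hV (m ()) (n ()) (k ()))
  refine ⟨σ.map fun x => x (), inferInstance, fun m n => ?_⟩
  rw [integral_map (measurable_pi_apply ()).aemeasurable
    (map_continuous (fourier (n - m))).aestronglyMeasurable]
  rw [← hσ (fun _ => m) (fun _ => n)]
  simp [UnitAddTorus.mFourier]

lemma IsSpectralMeasure.norm_sq_sum {V : ℤ → E} {σ : Measure UnitAddCircle} [IsFiniteMeasure σ]
    (hσ : IsSpectralMeasure σ V) {ι : Type*} (s : Finset ι) (c : ι → ℂ) (m : ι → ℤ) :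
    ‖∑ i ∈ s, c i • V (m i)‖ ^ 2 = ∫ x, ‖∑ i ∈ s, c i * fourier (m i) x‖ ^ 2 ∂σ := by
  have hint : ∀ (c : ℂ) (j : ℤ), Integrable (fun x => c * fourier j x) σ :=
    fun c j => (integrable_of_continuous (map_continuous (fourier j))).const_mul c
  have h1 : ((‖∑ i ∈ s, c i • V (m i)‖ ^ 2 : ℝ) : ℂ) =
      ((∫ x, ‖∑ i ∈ s, c i * fourier (m i) x‖ ^ 2 ∂σ : ℝ) : ℂ) := by
    have h2 : ∀ x : UnitAddCircle, ((‖∑ i ∈ s, c i * fourier (m i) x‖ ^ 2 : ℝ) : ℂ) = ∑ i ∈ s, ∑ j ∈ s,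
        ((starRingEnd ℂ) (c i) * c j) * fourier (m j - m i) x := by
      intro x
      push_cast
      rw [← Complex.conj_mul', map_sum, Finset.sum_mul_sum]
      refine Finset.sum_congr rfl fun i _ => Finset.sum_congr rfl fun j _ => ?_
      rw [map_mul, fourier_sub_apply]
      ring
    rw [← integral_complex_ofReal]
    simp only [h2]
    rw [integral_finsetSum _ fun m _ => integrable_finsetSum _ fun n _ => hint _ _]
    have := inner_self_eq_norm_sq_to_K (𝕜 := ℂ) (∑ i ∈ s, c i • V (m i))
    simp only [Complex.coe_algebraMap] at this
    push_cast
    rw [← this, sum_inner]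
    refine Finset.sum_congr rfl fun i _ => ?_
    rw [inner_sum, integral_finsetSum _ fun n _ => hint _ _]
    refine Finset.sum_congr rfl fun j _ => ?_
    rw [integral_const_mul, hσ, inner_smul_left, inner_smul_right]
    ring
  exact_mod_cast h1

lemma fourier_one_eq_one_iff {x : UnitAddCircle} : fourier 1 x = 1 ↔ x = 0 := by
  rw [fourier_one]
  constructor
  · intro h
    refine AddCircle.injective_toCircle one_ne_zero ?_
    rw [AddCircle.toCircle_zero]
    exact Circle.ext (by simpa using h)
  · rintro rfl
    simp

lemma fourier_eq_zpow (n : ℤ) (x : UnitAddCircle) : fourier n x = (fourier 1 x) ^ n := by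
  rw [fourier_one, fourier_apply, AddCircle.toCircle_zsmul, Circle.coe_zpow]

lemma norm_fourier (n : ℤ) (x : UnitAddCircle) : ‖fourier n x‖ = 1 := by
  rw [fourier_apply]; exact Circle.norm_coe _

lemma fourier_mul_conj (n : ℤ) (x : UnitAddCircle) :
    fourier n x * (starRingEnd ℂ) (fourier n x) = 1 := by
  rw [Complex.mul_conj', norm_fourier]; simp

lemma fourier_apply_sub (n : ℤ) (x y : UnitAddCircle) :
    fourier n (x - y) = fourier n x * (starRingEnd ℂ) (fourier n y) := by
  rw [← fourier_neg]
  simp [fourier_apply, sub_eq_add_neg, AddCircle.toCircle_add]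

lemma tendsto_average_fourier {x : UnitAddCircle} :
    Tendsto (fun N : ℕ => (N : ℂ)⁻¹ * ∑ n ∈ Finset.range N, fourier (n : ℤ) x) atTop
      (𝓝 (if x = 0 then 1 else 0)) := by
  split_ifs with hx
  · subst hx
    apply tendsto_const_nhds.congr'
    filter_upwards [eventually_gt_atTop 0] with N hN
    have : (N : ℂ) ≠ 0 := by exact_mod_cast hN.ne'
    simp [this]
  · have hw : fourier 1 x - 1 ≠ 0 := sub_ne_zero.2 fun h => hx (fourier_one_eq_one_iff.1 h)
    rw [tendsto_zero_iff_norm_tendsto_zero]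
    have hb : ∀ N : ℕ, ‖(N : ℂ)⁻¹ * ∑ n ∈ Finset.range N, fourier (n : ℤ) x‖ ≤
        2 / ‖fourier 1 x - 1‖ / N := by
      intro N
      have : ∑ n ∈ Finset.range N, fourier (n : ℤ) x =
          ((fourier 1 x) ^ N - 1) / (fourier 1 x - 1) := by
        rw [← geom_sum_eq (sub_ne_zero.1 hw)]
        refine Finset.sum_congr rfl fun n _ => ?_
        rw [fourier_eq_zpow, zpow_natCast]
      rw [this, norm_mul, norm_inv, Complex.norm_natCast, norm_div, inv_mul_eq_div]
      gcongr
      refine (norm_sub_le _ _).trans ?_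
      rw [norm_pow, norm_fourier]
      norm_num
    exact squeeze_zero (fun _ => norm_nonneg _) hb
      (tendsto_const_nhds.div_atTop tendsto_natCast_atTop_atTop)

lemma inner_zpow_add (U : E ≃ₗᵢ[ℂ] E) (f : E) (m n k : ℤ) :
    inner ℂ ((U ^ (m + k)) f) ((U ^ (n + k)) f) = inner ℂ ((U ^ m) f) ((U ^ n) f) := by
  rw [add_comm m, add_comm n, zpow_add, zpow_add]
  exact (U ^ k).inner_map_map _ _

variable [CompleteSpace E]

/-- Atoms of the spectral measure of a vector give eigenvectors. -/
lemma exists_eigenvector_of_isSpectralMeasure (U : E ≃ₗᵢ[ℂ] E) {f : E} {σ : Measure UnitAddCircle}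
    [IsFiniteMeasure σ] (hσ : IsSpectralMeasure σ fun n => (U ^ n) f) (t : UnitAddCircle) :
    ∃ g, U g = fourier 1 t • g ∧ ‖g‖ ^ 2 = σ.real {t} ∧
      ∀ e, U e = fourier 1 t • e → inner ℂ e g = inner ℂ e f := by
  set w : ℂ := fourier 1 t with hw
  have hww : w * (starRingEnd ℂ) w = 1 := fourier_mul_conj 1 t
  set W : E →L[ℂ] E := (starRingEnd ℂ) w • (U : E →L[ℂ] E) with hW
  have hWa : ∀ e, W e = (starRingEnd ℂ) w • U e := fun e => rfl
  have hW1 : ‖W‖ ≤ 1 := by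
    refine ContinuousLinearMap.opNorm_le_bound _ zero_le_one fun e => ?_
    rw [hWa, norm_smul, RCLike.norm_conj, hw, norm_fourier, LinearIsometryEquiv.norm_map]
  have hfix : ∀ e, W e = e ↔ U e = w • e := by
    intro e
    rw [hWa]
    constructor
    · intro h
      conv_rhs => rw [← h, smul_smul, hww, one_smul]
    · intro h
      rw [h, smul_smul, mul_comm, hww, one_smul]
  -- Von Neumann's mean ergodic theorem for the operator twisted by the conjugate eigenvalue, whose
  -- fixed vectors are the eigenvectors of `U`.
  have hlim := W.tendsto_birkhoffAverage_orthogonalProjection hW1 f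
  set K := W.eqLocus (1 : E →L[ℂ] E) with hK
  set g : E := (K.orthogonalProjectionOnto f : E) with hg
  have hgK : g ∈ K := (K.orthogonalProjectionOnto f).2
  have hmemK : ∀ e, e ∈ K ↔ W e = e := fun e => Iff.rfl
  refine ⟨g, (hfix g).1 ((hmemK g).1 hgK), ?_, fun e he => ?_⟩
  · have hiter : ∀ n : ℕ, W^[n] f = (starRingEnd ℂ) (fourier (n : ℤ) t) • (U ^ (n : ℤ)) f := by
      intro n
      induction n with
      | zero => simp
      | succ n ih =>
        rw [Function.iterate_succ_apply', ih, hWa, map_smul, smul_smul]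
        congr 1
        · push_cast
          rw [fourier_add, map_mul, mul_comm, hw]
        · push_cast
          rw [add_comm, zpow_one_add]
          rfl
    have h1 : ∀ N : ℕ, ‖birkhoffAverage ℂ W _root_.id N f‖ ^ 2 =
        ∫ x, ‖(N : ℂ)⁻¹ * ∑ n ∈ Finset.range N, fourier (n : ℤ) (x - t)‖ ^ 2 ∂σ := by
      intro N
      have := hσ.norm_sq_sum (Finset.range N)
        (fun n => (N : ℂ)⁻¹ * (starRingEnd ℂ) (fourier (n : ℤ) t)) (fun n => (n : ℤ))
      rw [birkhoffAverage, birkhoffSum, Finset.smul_sum]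
      simp only [id, hiter, smul_smul]
      rw [this]
      refine integral_congr_ae (Eventually.of_forall fun x => ?_)
      simp only [Finset.mul_sum, fourier_apply_sub]
      congr 2
      refine Finset.sum_congr rfl fun n _ => ?_
      ring
    have h2 : Tendsto (fun N => ‖birkhoffAverage ℂ W _root_.id N f‖ ^ 2) atTop (𝓝 (‖g‖ ^ 2)) :=
      hlim.norm.pow 2
    -- On the spectral side the twisted averages converge boundedly to the indicator of `t`, so the
    -- squared norm of the projection is the mass of that point.
    have h3 : Tendsto (fun N : ℕ => ∫ x, ‖(N : ℂ)⁻¹ * ∑ n ∈ Finset.range N,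
        fourier (n : ℤ) (x - t)‖ ^ 2 ∂σ) atTop (𝓝 (∫ x, Set.indicator {t} (fun _ => (1 : ℝ)) x ∂σ)) := by
      refine tendsto_integral_of_dominated_convergence (fun _ => 1) ?_ (integrable_const _) ?_ ?_
      · intro N
        refine Continuous.aestronglyMeasurable ?_
        refine Continuous.pow (Continuous.norm (continuous_const.mul
          (continuous_finsetSum _ fun n _ => ?_))) 2
        exact (map_continuous (fourier (n : ℤ))).comp (continuous_id.sub continuous_const)
      · intro N
        refine Eventually.of_forall fun x => ?_
        rw [norm_pow, norm_norm]
        refine pow_le_one₀ (norm_nonneg _) ?_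
        rw [norm_mul, norm_inv, Complex.norm_natCast]
        have : ‖∑ n ∈ Finset.range N, fourier (n : ℤ) (x - t)‖ ≤ N := by
          refine (norm_sum_le_of_le _ fun n _ => (norm_fourier _ _).le).trans ?_
          simp
        rw [inv_mul_eq_div]
        exact div_le_one_of_le₀ this (Nat.cast_nonneg _)
      · refine Eventually.of_forall fun x => ?_
        have := (tendsto_average_fourier (x := x - t)).norm.pow 2
        convert this using 2
        by_cases hx : x = t <;> simp [hx, sub_eq_zero]
    rw [tendsto_nhds_unique (h2.congr h1) h3]
    exact integral_indicator_one (measurableSet_singleton t)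
  · have h1 : inner ℂ e (f - g) = 0 := by
      have := Submodule.starProjection_inner_eq_zero (K := K) f e ((hmemK e).2 ((hfix e).2 he))
      rw [← inner_conj_symm]
      exact (congrArg _ this).trans (map_zero _)
    rw [inner_sub_right, sub_eq_zero] at h1
    exact h1.symm

end CircleSpectral

/-! ### Integer powers of an invertible measure preserving transformation -/

section Powers

variable {X : Type*} [MeasurableSpace X] {μ : Measure X} {T : X ≃ᵐ X}

lemma iterZ_add_one (k : ℤ) (x : X) : iterZ T (k + 1) x = T (iterZ T k x) := by
  unfold iterZ
  rw [add_comm, zpow_add, zpow_one]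
  rfl

lemma iterZ_sub_one (k : ℤ) (x : X) : iterZ T (k - 1) x = T.symm (iterZ T k x) := by
  rw [T.eq_symm_apply, ← iterZ_add_one, sub_add_cancel]

lemma measurePreserving_iterZ (hT : MeasurePreserving T μ μ) (k : ℤ) :
    MeasurePreserving (iterZ T k) μ μ := by
  induction k using Int.induction_on with
  | zero => exact MeasurePreserving.id μ
  | succ k ih =>
    have : iterZ T (k + 1) = T ∘ iterZ T k := funext fun x => iterZ_add_one _ x
    rw [this]
    exact hT.comp ih
  | pred k ih =>
    have : iterZ T (-k - 1) = T.symm ∘ iterZ T (-k) := funext fun x => iterZ_sub_one _ x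
    rw [this]
    exact (hT.symm T).comp ih

/-- The unitary Koopman operator of an invertible measure preserving transformation. -/
noncomputable def koopmanEquiv (T : X ≃ᵐ X) (hT : MeasurePreserving T μ μ) :
    Lp ℂ 2 μ ≃ₗᵢ[ℂ] Lp ℂ 2 μ :=
  LinearIsometryEquiv.ofSurjective (Lp.compMeasurePreservingₗᵢ ℂ T hT) fun v =>
    ⟨koopman T.symm (hT.symm T) v, by
      refine Lp.ext ?_
      filter_upwards [koopman_coeFn hT (koopman T.symm (hT.symm T) v),
        hT.quasiMeasurePreserving.ae (koopman_coeFn (hT.symm T) v)] with x h1 h2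
      refine Eq.trans h1 ?_
      rw [Function.comp_apply, h2, Function.comp_apply, T.symm_apply_apply]⟩

lemma koopmanEquiv_coeFn (hT : MeasurePreserving T μ μ) (v : Lp ℂ 2 μ) :
    koopmanEquiv T hT v =ᵐ[μ] v ∘ T := koopman_coeFn hT v

lemma koopmanEquiv_zpow_apply (hT : MeasurePreserving T μ μ) (k : ℤ) (v : Lp ℂ 2 μ) :
    (koopmanEquiv T hT ^ k) v = koopman (iterZ T k) (measurePreserving_iterZ hT k) v := by
  have step : ∀ (k : ℤ) (v : Lp ℂ 2 μ), koopman (iterZ T (k + 1)) (measurePreserving_iterZ hT _) v =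
      koopman (iterZ T k) (measurePreserving_iterZ hT k) (koopmanEquiv T hT v) := by
    intro k v
    refine Lp.ext ?_
    filter_upwards [koopman_coeFn (measurePreserving_iterZ hT (k + 1)) v,
      koopman_coeFn (measurePreserving_iterZ hT k) (koopmanEquiv T hT v),
      (measurePreserving_iterZ hT k).quasiMeasurePreserving.ae (koopmanEquiv_coeFn hT v)]
      with x h1 h2 h3
    rw [h1, h2, Function.comp_apply, Function.comp_apply, h3, iterZ_add_one]
    rfl
  induction k using Int.induction_on generalizing v with
  | zero =>
    refine Lp.ext ?_
    filter_upwards [koopman_coeFn (measurePreserving_iterZ hT 0) v] with x h1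
    rw [h1]
    rfl
  | succ k ih =>
    rw [step, ← ih, zpow_add_one]
    rfl
  | pred k ih =>
    have h := step (-k - 1) ((koopmanEquiv T hT)⁻¹ v)
    have e : koopmanEquiv T hT ((koopmanEquiv T hT)⁻¹ v) = v :=
      (koopmanEquiv T hT).apply_symm_apply v
    rw [e] at h
    rw [← h, zpow_sub_one]
    refine Eq.trans (ih _) ?_
    congr 2
    simp
  
end Powers

/-! ### Eigenfunctions and joint ergodicity -/

section Eigenfunctions

variable {X : Type*} [MeasurableSpace X] {μ : Measure X}

/-- `h` is a unimodular eigenfunction of `T` with eigenvalue determined by `t`. -/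
def IsUnimodularEigenfunction (μ : Measure X) (T : X ≃ᵐ X) (t : UnitAddCircle) (h : X → ℂ) : Prop :=
  AEStronglyMeasurable h μ ∧ (∀ᵐ x ∂μ, ‖h x‖ = 1) ∧ ∀ᵐ x ∂μ, h (T x) = fourier 1 t * h x

lemma IsUnimodularEigenfunction.iterZ {T : X ≃ᵐ X} (hT : MeasurePreserving T μ μ)
    {t : UnitAddCircle} {h : X → ℂ} (hh : IsUnimodularEigenfunction μ T t h) (k : ℤ) :
    ∀ᵐ x ∂μ, h (iterZ T k x) = fourier k t * h x := by
  induction k using Int.induction_on with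
  | zero => exact Eventually.of_forall fun x => by simp [_root_.iterZ]
  | succ k ih =>
    filter_upwards [ih, (measurePreserving_iterZ hT k).quasiMeasurePreserving.ae hh.2.2] with x h1 h2
    rw [iterZ_add_one, h2, h1, add_comm, fourier_add, mul_assoc]
  | pred k ih =>
    filter_upwards [ih, (measurePreserving_iterZ hT (-k - 1)).quasiMeasurePreserving.ae hh.2.2]
      with x h1 h2
    rw [← iterZ_add_one, sub_add_cancel, h1] at h2
    rw [fourier_sub_apply, mul_right_comm, h2, mul_right_comm, fourier_mul_conj, one_mul]

/-- Invariance of the measure makes the integral fixed under multiplication by the eigenvalue, which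
is not 1. -/
lemma IsUnimodularEigenfunction.integral_eq_zero {T : X ≃ᵐ X} (hT : MeasurePreserving T μ μ)
    {t : UnitAddCircle} (ht : t ≠ 0) {h : X → ℂ} (hh : IsUnimodularEigenfunction μ T t h) :
    ∫ x, h x ∂μ = 0 := by
  have h1 : ∫ x, h (T x) ∂μ = ∫ x, h x ∂μ := hT.integral_comp' h
  rw [integral_congr_ae hh.2.2, integral_const_mul] at h1
  have h2 : (fourier 1 t - 1) * ∫ x, h x ∂μ = 0 := by rw [sub_mul, h1]; ring
  exact (mul_eq_zero.1 h2).resolve_left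
    (sub_ne_zero.2 fun h => ht (fourier_one_eq_one_iff.1 h))

variable [IsProbabilityMeasure μ]

lemma memLp_top_of_norm_le {f : X → ℂ} (hf : AEStronglyMeasurable f μ) {C : ℝ}
    (h : ∀ᵐ x ∂μ, ‖f x‖ ≤ C) : MemLp f ∞ μ := MemLp.of_bound hf C h

/-- An invariant vector is fixed by all powers, so its averages are constant and equal to their
limit. Boundedness is required since ergodicity of a sequence is tested on essentially bounded
functions. -/
lemma eq_meanProj_of_koopmanEquiv_eq {T : X ≃ᵐ X} (hT : MeasurePreserving T μ μ) {c : ℕ → ℤ}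
    (hc : ErgodicSeq μ fun n => iterZ T (c n)) {v : Lp ℂ 2 μ} (hv : MemLp v ∞ μ)
    (hinv : koopmanEquiv T hT v = v) : v = meanProj μ v := by
  have hS : ∀ n, MeasurePreserving (iterZ T (c n)) μ μ := fun n => measurePreserving_iterZ hT _
  have h1 := (ergodicSeq_iff hS).1 hc v hv
  have h2 : MemLp.toLp v (hv.mono_exponent le_top : MemLp v 2 μ) = v := Lp.toLp_coeFn v _
  rw [h2] at h1
  refine tendsto_nhds_unique (tendsto_const_nhds.congr' ?_) h1
  filter_upwards [eventually_gt_atTop 0] with N hN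
  have hN' : (N : ℂ) ≠ 0 := by exact_mod_cast hN.ne'
  have h3 : ∀ n, koopman (iterZ T (c n)) (hS n) v = v := by
    intro n
    rw [← koopmanEquiv_zpow_apply]
    have : ∀ k : ℤ, (koopmanEquiv T hT ^ k) v = v := by
      intro k
      induction k using Int.induction_on with
      | zero => rfl
      | succ k ih =>
        rw [zpow_add_one]
        exact Eq.trans (congrArg (koopmanEquiv T hT ^ (k : ℤ)) hinv) ih
      | pred k ih =>
        rw [zpow_sub_one]
        exact Eq.trans (congrArg (koopmanEquiv T hT ^ (-k : ℤ))
          (((koopmanEquiv T hT).symm_apply_eq).2 hinv.symm)) ih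
    exact this _
  rw [koopmanAvg_apply]
  simp only [h3, Finset.sum_const, Nat.card_Icc, Nat.add_sub_cancel]
  rw [← Nat.cast_smul_eq_nsmul ℂ, smul_smul, one_div, inv_mul_cancel₀ hN', one_smul]

lemma ae_eq_const_of_comp_eq {T : X ≃ᵐ X} (hT : MeasurePreserving T μ μ) {c : ℕ → ℤ}
    (hc : ErgodicSeq μ fun n => iterZ T (c n)) {f : X → ℂ} (hf : MemLp f ∞ μ)
    (hinv : ∀ᵐ x ∂μ, f (T x) = f x) : ∃ C : ℂ, ∀ᵐ x ∂μ, f x = C := by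
  have hf2 : MemLp f 2 μ := hf.mono_exponent le_top
  have hv : koopmanEquiv T hT (hf2.toLp f) = hf2.toLp f := by
    refine Lp.ext ?_
    filter_upwards [koopmanEquiv_coeFn hT (hf2.toLp f), hf2.coeFn_toLp,
      hT.quasiMeasurePreserving.ae hf2.coeFn_toLp, hinv] with x h1 h2 h3 h4
    rw [h1, h2, Function.comp_apply, h3, h4]
  have h := eq_meanProj_of_koopmanEquiv_eq hT hc ((memLp_congr_ae hf2.coeFn_toLp).2 hf) hv
  refine ⟨inner ℂ (oneLp μ) (hf2.toLp f), ?_⟩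
  rw [meanProj_apply] at h
  filter_upwards [hf2.coeFn_toLp, oneLp_coeFn (ν := μ), Lp.coeFn_smul
    (inner ℂ (oneLp μ) (hf2.toLp f)) (oneLp μ), (Lp.ext_iff.1 h)] with x h1 h2 h3 h4
  rw [← h1, h4, h3, Pi.smul_apply, h2, smul_eq_mul, mul_one]

/-- The modulus of an eigenvector is invariant but perhaps unbounded, so the invariance argument is
applied to the bounded function `‖g‖ / (1 + ‖g‖)`, which determines `‖g‖`. -/
lemma exists_norm_ae_eq_of_eigenvector {T : X ≃ᵐ X} (hT : MeasurePreserving T μ μ) {c : ℕ → ℤ}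
    (hc : ErgodicSeq μ fun n => iterZ T (c n)) {g : Lp ℂ 2 μ} {w : ℂ} (hw : ‖w‖ = 1)
    (hg : koopmanEquiv T hT g = w • g) : ∃ r : ℝ, ∀ᵐ x ∂μ, ‖g x‖ = r := by
  have hinv : ∀ᵐ x ∂μ, g (T x) = w * g x := by
    filter_upwards [koopmanEquiv_coeFn hT g, Lp.ext_iff.1 hg, Lp.coeFn_smul w g] with x h1 h2 h3
    rw [← Function.comp_apply (f := g), ← h1, h2, h3, Pi.smul_apply, smul_eq_mul]
  have hmeas : AEStronglyMeasurable (fun x => ((‖g x‖ / (1 + ‖g x‖) : ℝ) : ℂ)) μ := by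
    refine Complex.continuous_ofReal.comp_aestronglyMeasurable ?_
    have hg : AEStronglyMeasurable g μ := Lp.aestronglyMeasurable g
    have h2 : Continuous fun y : ℂ => ‖y‖ / (1 + ‖y‖) :=
      continuous_norm.div (continuous_const.add continuous_norm) fun y => by positivity
    exact h2.comp_aestronglyMeasurable hg
  obtain ⟨C, hC⟩ := ae_eq_const_of_comp_eq hT hc
    (memLp_top_of_norm_le hmeas (C := 1) (Eventually.of_forall fun x => by
      rw [Complex.norm_real, Real.norm_of_nonneg (by positivity)]
      exact div_le_one_of_le₀ (by linarith [norm_nonneg (g x)]) (by positivity)))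
    (by filter_upwards [hinv] with x hx; rw [hx, norm_mul, hw, one_mul])
  -- The inverse of `y ↦ y / (1 + y)`.
  refine ⟨C.re / (1 - C.re), ?_⟩
  filter_upwards [hC] with x hx
  rw [← hx, Complex.ofReal_re]
  have : 0 < 1 + ‖g x‖ := by positivity
  field_simp
  ring_nf

lemma koopmanEquiv_fixed_eq {T : X ≃ᵐ X} (hT : MeasurePreserving T μ μ) {c : ℕ → ℤ}
    (hc : ErgodicSeq μ fun n => iterZ T (c n)) {g : Lp ℂ 2 μ}
    (hg : koopmanEquiv T hT g = g) : g = meanProj μ g := by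
  obtain ⟨r, hr⟩ := exists_norm_ae_eq_of_eigenvector hT hc (w := 1) (by simp) (by simpa using hg)
  exact eq_meanProj_of_koopmanEquiv_eq hT hc
    (memLp_top_of_norm_le (Lp.aestronglyMeasurable g) (hr.mono fun x hx => hx.le)) hg

lemma exists_unimodularEigenfunction {T : X ≃ᵐ X} (hT : MeasurePreserving T μ μ) {c : ℕ → ℤ}
    (hc : ErgodicSeq μ fun n => iterZ T (c n)) {f : Lp ℂ 2 μ} {σ : Measure UnitAddCircle}
    [IsFiniteMeasure σ] (hσ : IsSpectralMeasure σ fun n => (koopmanEquiv T hT ^ n) f)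
    {t : UnitAddCircle} (ht : σ {t} ≠ 0) : ∃ h, IsUnimodularEigenfunction μ T t h := by
  obtain ⟨g, hg, hg2, -⟩ := exists_eigenvector_of_isSpectralMeasure _ hσ t
  have hg0 : g ≠ 0 := by
    rintro rfl
    rw [norm_zero, zero_pow two_ne_zero] at hg2
    exact ht ((measureReal_eq_zero_iff).1 hg2.symm)
  obtain ⟨r, hr⟩ := exists_norm_ae_eq_of_eigenvector hT hc (norm_fourier 1 t) hg
  have hr0 : r ≠ 0 := by
    rintro rfl
    refine hg0 (Lp.ext ?_)
    filter_upwards [hr, Lp.coeFn_zero ℂ 2 μ] with x h1 h2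
    rw [h2, norm_eq_zero.1 h1]
    rfl
  have hrpos : 0 ≤ r := by
    obtain ⟨x, hx⟩ := hr.exists
    rw [← hx]; positivity
  refine ⟨fun x => (r : ℂ)⁻¹ * g x, (Lp.aestronglyMeasurable g).const_mul _, ?_, ?_⟩
  · filter_upwards [hr] with x hx
    rw [norm_mul, hx, norm_inv, Complex.norm_real, Real.norm_of_nonneg hrpos, inv_mul_cancel₀ hr0]
  · filter_upwards [koopmanEquiv_coeFn hT g, Lp.ext_iff.1 hg, Lp.coeFn_smul (fourier 1 t) g]
      with x h1 h2 h3
    rw [← Function.comp_apply (f := g), ← h1, h2, h3, Pi.smul_apply, smul_eq_mul]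
    ring

/-- The atom at 0 is the squared norm of the projection to the fixed vectors, and by ergodicity
these are the constants. -/
lemma measureReal_singleton_zero_of_isSpectralMeasure {T : X ≃ᵐ X} (hT : MeasurePreserving T μ μ)
    {c : ℕ → ℤ} (hc : ErgodicSeq μ fun n => iterZ T (c n)) {f : Lp ℂ 2 μ}
    {σ : Measure UnitAddCircle} [IsFiniteMeasure σ]
    (hσ : IsSpectralMeasure σ fun n => (koopmanEquiv T hT ^ n) f) :
    σ.real {0} = ‖inner ℂ (oneLp μ) f‖ ^ 2 := by
  obtain ⟨g, hg, hg2, hg3⟩ := exists_eigenvector_of_isSpectralMeasure _ hσ 0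
  rw [fourier_eval_zero, one_smul] at hg
  have h1 : koopmanEquiv T hT (oneLp μ) = oneLp μ := by
    refine Lp.ext ?_
    filter_upwards [koopmanEquiv_coeFn hT (oneLp μ), oneLp_coeFn (ν := μ),
      hT.quasiMeasurePreserving.ae (oneLp_coeFn (ν := μ))] with x e1 e2 e3
    rw [e1, e2, Function.comp_apply, e3]
  rw [← hg3 (oneLp μ) (by rw [fourier_eval_zero, one_smul, h1]), ← hg2]
  conv_lhs => rw [koopmanEquiv_fixed_eq hT hc hg, meanProj_apply, norm_smul, norm_oneLp, mul_one]

end Eigenfunctions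

/-! ### Joint ergodicity tested on single functions and on eigenfunctions -/

section Joint

variable {X : Type*} [MeasurableSpace X] {μ : Measure X} [IsProbabilityMeasure μ] {ℓ : ℕ}
  {T : Fin ℓ → X ≃ᵐ X} {b : Fin ℓ → ℕ → ℝ}

lemma JointlyErgodic.ergodicSeq (hj : JointlyErgodic μ T b) (j : Fin ℓ) :
    ErgodicSeq μ fun n => iterZ (T j) ⌊b j n⌋ := by
  intro f hf
  have h := hj (fun i => if i = j then f else fun _ => 1) (fun i => by
    split_ifs
    · exact hf
    · exact memLp_const 1)
  have h1 : ∀ g : Fin ℓ → X, ∏ i, (if i = j then f else fun _ => (1 : ℂ)) (g i) = f (g j) := by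
    intro g
    rw [Finset.prod_eq_single j (fun i _ hi => by simp [hi]) (by simp)]
    simp
  have h2 : ∏ i, ∫ z, (if i = j then f else fun _ => (1 : ℂ)) z ∂μ = ∫ z, f z ∂μ := by
    rw [Finset.prod_eq_single j (fun i _ hi => by simp [hi]) (by simp)]
    simp
  simp only [h2] at h
  refine h.congr fun N => ?_
  congr 1
  ext x
  congr 2
  exact Finset.sum_congr rfl fun n _ => h1 fun i => iterZ (T i) ⌊b i n⌋ x

/-- On eigenfunctions the multiple average is a scalar Cesàro mean times a function of modulus one.
A nonzero frequency makes one of the integrals vanish, so the mean tends to 0. -/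
lemma JointlyErgodic.tendsto_cesaro_fourier (hj : JointlyErgodic μ T b)
    (hT : ∀ j, MeasurePreserving (T j) μ μ) {t : Fin ℓ → UnitAddCircle}
    (ht : ∀ j, ∃ h, IsUnimodularEigenfunction μ (T j) (t j) h) :
    Tendsto (cesaro fun n => ∏ j, fourier ⌊b j n⌋ (t j)) atTop (𝓝 (if t = 0 then 1 else 0)) := by
  split_ifs with h0
  · subst h0
    simpa using cesaro_const 1
  obtain ⟨i, hi⟩ := Function.ne_iff.1 h0
  choose h hh using ht
  have h1 := hj h fun j => memLp_top_of_norm_le (hh j).1 ((hh j).2.1.mono fun x hx => hx.le)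
  have h2 : ∏ j, ∫ z, h j z ∂μ = 0 :=
    Finset.prod_eq_zero (Finset.mem_univ i) ((hh i).integral_eq_zero (hT i) hi)
  rw [h2] at h1
  rw [tendsto_zero_iff_norm_tendsto_zero]
  refine ((ENNReal.tendsto_toReal ENNReal.zero_ne_top).comp h1).congr fun N => ?_
  have e1 : ∀ᵐ x ∂μ, ∀ n : ℕ, ∀ j, h j (iterZ (T j) ⌊b j n⌋ x) = fourier ⌊b j n⌋ (t j) * h j x :=
    ae_all_iff.2 fun n => ae_all_iff.2 fun j => (hh j).iterZ (hT j) _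
  have e2 : ∀ᵐ x ∂μ, ∀ j, ‖h j x‖ = 1 := ae_all_iff.2 fun j => (hh j).2.1
  rw [Function.comp_apply, eLpNorm_congr_norm_ae (g := fun _ => cesaro (fun n => ∏ j, fourier ⌊b j n⌋ (t j)) N),
    eLpNorm_const _ two_ne_zero (IsProbabilityMeasure.ne_zero μ)]
  · simp
  filter_upwards [e1, e2] with x h3 h4
  simp only [h3, sub_zero, Finset.prod_mul_distrib]
  rw [← Finset.sum_mul, ← mul_assoc, norm_mul, norm_prod, cesaro]
  simp [h4]

end Joint

/-! ### Spectral measures along integer parts of Hardy functions -/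

section SlowGrowth

/-- An integer sequence which is constant on one of any two consecutive long blocks. -/
def IsBlockwiseConst (c : ℕ → ℤ) : Prop :=
  ∃ K : ℕ, ∀ᶠ m : ℕ in atTop,
    (∀ n ∈ Finset.Ioc (K * m) (K * m + m), c n = c (K * m + m)) ∨
      ∀ n ∈ Finset.Ioc (K * m + m) (K * m + m + m), c n = c (K * m + m + m)

/-- The sum over a constant block has modulus `m`, yet it is a difference of the partial sums at `M
+ m` and `M`. As the block is comparable in length to its position, the two Cesàro means cannot both
be small. -/
lemma one_le_of_const_block {u : ℕ → ℂ} (hu : ∀ n, ‖u n‖ = 1) {M m K : ℕ} (hm : 0 < m)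
    (hMK : M + m ≤ (K + 2) * m) (hc : ∀ n ∈ Finset.Ioc M (M + m), u n = u (M + m)) :
    1 ≤ 2 * ((K : ℝ) + 2) ^ 2 * (‖cesaro u M‖ ^ 2 + ‖cesaro u (M + m)‖ ^ 2) := by
  have hm' : (0 : ℝ) < m := by exact_mod_cast hm
  have hmul : ∀ N : ℕ, (N : ℂ) * cesaro u N = ∑ n ∈ Finset.Icc 1 N, u n := by
    intro N
    rcases Nat.eq_zero_or_pos N with rfl | hN
    · simp
    · have : (N : ℂ) ≠ 0 := by exact_mod_cast hN.ne'
      rw [cesaro]; field_simp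
  have hsum : ((M + m : ℕ) : ℂ) * cesaro u (M + m) - (M : ℂ) * cesaro u M = m * u (M + m) := by
    rw [hmul, hmul]
    have h1 : ∑ n ∈ Finset.Ioc M (M + m), u n = m * u (M + m) := by
      rw [Finset.sum_congr rfl hc]; simp
    rw [← h1]
    have h2 := Finset.sum_Ioc_consecutive u (Nat.zero_le M) (Nat.le_add_right M m)
    have h3 : ∀ N, Finset.Icc 1 N = Finset.Ioc 0 N := fun N => by ext; simp; omega
    rw [h3, h3, ← h2]
    ring
  have hle : (m : ℝ) ≤ (M + m : ℕ) * ‖cesaro u (M + m)‖ + M * ‖cesaro u M‖ := by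
    have := norm_sub_le (((M + m : ℕ) : ℂ) * cesaro u (M + m)) ((M : ℂ) * cesaro u M)
    rw [hsum] at this
    simpa only [norm_mul, hu, mul_one, Complex.norm_natCast] using this
  have b1 : ((M + m : ℕ) : ℝ) ≤ (K + 2) * m := by exact_mod_cast hMK
  have b2 : (M : ℝ) ≤ (K + 2) * m := by
    refine le_trans ?_ b1
    exact_mod_cast Nat.le_add_right M m
  have hle2 : (m : ℝ) ≤ (K + 2) * m * (‖cesaro u (M + m)‖ + ‖cesaro u M‖) := by
    refine hle.trans ?_
    rw [mul_add]
    gcongr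
  have hle3 : 1 ≤ ((K : ℝ) + 2) * (‖cesaro u (M + m)‖ + ‖cesaro u M‖) := by
    by_contra! h
    have := mul_lt_mul_of_pos_right h hm'
    linarith
  have h4 : (1 : ℝ) ≤ (((K : ℝ) + 2) * (‖cesaro u (M + m)‖ + ‖cesaro u M‖)) ^ 2 :=
    one_le_pow₀ hle3
  refine h4.trans ?_
  rw [mul_pow, mul_comm (2 : ℝ), mul_assoc]
  gcongr
  nlinarith [sq_nonneg (‖cesaro u (M + m)‖ - ‖cesaro u M‖)]

lemma continuous_cesaro_fourier (c : ℕ → ℤ) (N : ℕ) :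
    Continuous fun z : UnitAddCircle => cesaro (fun n => fourier (c n) z) N := by
  unfold cesaro
  exact continuous_const.mul (continuous_finsetSum _ fun n _ => map_continuous (fourier (c n)))

/-- The lower bound on a constant block is uniform in the frequency, so integrating it bounds the
total mass by a constant times integrals that tend to 0. -/
lemma IsBlockwiseConst.measure_eq_zero {c : ℕ → ℤ} (hc : IsBlockwiseConst c)
    {τ : Measure UnitAddCircle} [IsFiniteMeasure τ]
    (h : Tendsto (fun N => ∫ z, ‖cesaro (fun n => fourier (c n) z) N‖ ^ 2 ∂τ) atTop (𝓝 0)) :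
    τ = 0 := by
  obtain ⟨K, hK⟩ := hc
  set I : ℕ → ℝ := fun N => ∫ z, ‖cesaro (fun n => fourier (c n) z) N‖ ^ 2 ∂τ with hI
  have hint : ∀ N, Integrable (fun z => ‖cesaro (fun n => fourier (c n) z) N‖ ^ 2) τ := fun N =>
    integrable_of_continuous ((continuous_cesaro_fourier c N).norm.pow 2)
  have hI0 : ∀ N, 0 ≤ I N := fun N => integral_nonneg fun z => by positivity
  have key : ∀ M m : ℕ, 0 < m → M + m ≤ (K + 2) * m →
      (∀ n ∈ Finset.Ioc M (M + m), c n = c (M + m)) →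
      τ.real Set.univ ≤ 2 * ((K : ℝ) + 2) ^ 2 * (I M + I (M + m)) := by
    intro M m hm hMK hcc
    have h1 : τ.real Set.univ = ∫ _, (1 : ℝ) ∂τ := by simp
    rw [h1, hI]
    simp only
    rw [← integral_add (hint _) (hint _), ← integral_const_mul]
    refine integral_mono (integrable_const _) (((hint _).add (hint _)).const_mul _) fun z => ?_
    exact one_le_of_const_block (fun n => norm_fourier _ _) hm hMK fun n hn => by rw [hcc n hn]
  have hlim : Tendsto (fun m : ℕ => 2 * ((K : ℝ) + 2) ^ 2 *
      (I (K * m) + I (K * m + m) + I (K * m + m + m))) atTop (𝓝 0) := by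
    have t2 : Tendsto (fun m : ℕ => K * m + m) atTop atTop :=
      tendsto_atTop_mono (fun m => Nat.le_add_left m (K * m)) tendsto_id
    have t3 : Tendsto (fun m : ℕ => K * m + m + m) atTop atTop :=
      tendsto_atTop_mono (fun m => Nat.le_add_left m (K * m + m)) tendsto_id
    rcases Nat.eq_zero_or_pos K with rfl | hKpos
    · have hI00 : I 0 = 0 := by simp [hI, cesaro]
      have := (((h.comp t2).add (h.comp t3)).const_mul (2 * (((0 : ℕ) : ℝ) + 2) ^ 2))
      simpa [hI00, Function.comp_def] using this
    · have t1 : Tendsto (fun m : ℕ => K * m) atTop atTop :=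
        tendsto_atTop_mono (fun m => Nat.le_mul_of_pos_left m hKpos) tendsto_id
      have := ((((h.comp t1).add (h.comp t2)).add (h.comp t3)).const_mul (2 * ((K : ℝ) + 2) ^ 2))
      simpa [Function.comp_def] using this
  have hle : τ.real Set.univ ≤ 0 := by
    refine ge_of_tendsto hlim ?_
    filter_upwards [hK, eventually_gt_atTop 0] with m hm hm0
    have p1 := hI0 (K * m)
    have p3 := hI0 (K * m + m + m)
    rcases hm with hm | hm
    · refine (key (K * m) m hm0 (by nlinarith) hm).trans ?_
      exact mul_le_mul_of_nonneg_left (by linarith) (by positivity)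
    · refine (key (K * m + m) m hm0 (by nlinarith) hm).trans ?_
      exact mul_le_mul_of_nonneg_left (by linarith) (by positivity)
  exact Measure.measure_univ_eq_zero.1 ((measureReal_eq_zero_iff).1
    (le_antisymm hle measureReal_nonneg))

/-- If `|x a'(x)| < C`, the variation of `a` over `[K m, (K + 2) m]` is at most `2C / K`, which is
below 1 for `K > 2C`. Since `a` is eventually monotone, the integer part jumps at most once there,
so it is constant on one of the two halves. -/
lemma IsHardyRing.isBlockwiseConst_floor {R : Set (ℝ → ℝ)} (hR : IsHardyRing R) {a : ℝ → ℝ}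
    (ha : a ∈ R) {l : ℝ} (hl : Tendsto (fun x => x * deriv a x) atTop (𝓝 l)) :
    IsBlockwiseConst fun n => ⌊a n⌋ := by
  have hmono : ∃ X, MonotoneOn a (Set.Ici X) ∨ AntitoneOn a (Set.Ici X) := by
    rcases hR.sign (hR.deriv ha) with h | h | h
    · obtain ⟨X, hX⟩ := eventually_monotoneOn_of_deriv_nonneg (hR.diff ha) (h.mono fun x hx => hx.ge)
      exact ⟨X, Or.inl hX⟩
    · obtain ⟨X, hX⟩ := eventually_monotoneOn_of_deriv_nonneg (hR.diff ha) (h.mono fun x hx => hx.le)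
      exact ⟨X, Or.inl hX⟩
    · obtain ⟨X, hX⟩ := eventually_monotoneOn_of_deriv_nonneg (hR.diff (hR.neg ha))
        (h.mono fun x hx => by rw [deriv.fun_neg]; linarith)
      exact ⟨X, Or.inr fun x hx y hy hxy => neg_le_neg_iff.1 (hX hx hy hxy)⟩
  obtain ⟨X, hX⟩ := hmono
  set C : ℝ := |l| + 1 with hC
  have hbd : ∀ᶠ x in atTop, |x * deriv a x| < C := hl.abs.eventually (gt_mem_nhds (lt_add_one _))
  obtain ⟨Y, hY⟩ := eventually_atTop.1 (hbd.and (eventually_exists_deriv_eq_slope (hR.diff ha)))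
  obtain ⟨K, hK⟩ := exists_nat_gt (max 1 (2 * C))
  have hK1 : (1 : ℝ) < K := (le_max_left _ _).trans_lt hK
  have hK2 : 2 * C < K := (le_max_right _ _).trans_lt hK
  refine ⟨K, ?_⟩
  filter_upwards [eventually_gt_atTop 0, tendsto_natCast_atTop_atTop.eventually
    (eventually_ge_atTop (max X Y))] with m hm0 hm
  have hm0' : (0 : ℝ) < m := by exact_mod_cast hm0
  set p : ℕ := K * m with hp
  have hpm : (p : ℝ) = K * m := by rw [hp]; push_cast; rfl
  have hmp : (m : ℝ) ≤ p := by rw [hpm]; nlinarith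
  have hXp : X ≤ p := (le_max_left _ _).trans (hm.trans hmp)
  have hYp : Y ≤ p := (le_max_right _ _).trans (hm.trans hmp)
  have hvar : |a ((p + m + m : ℕ) : ℝ) - a p| < 1 := by
    obtain ⟨y, hy1, hy2, hy3⟩ := (hY p hYp).2 (2 * m) (by positivity)
    have e : ((p + m + m : ℕ) : ℝ) = p + 2 * m := by push_cast; ring
    rw [e, hy3]
    have h1 := (hY y (hYp.trans hy1.le)).1
    have hp0 : (0 : ℝ) < p := hm0'.trans_le hmp
    have hy0 : 0 < y := hp0.trans hy1
    rw [abs_mul, abs_of_pos hy0] at h1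
    rw [abs_mul, abs_of_pos (by positivity)]
    have h3 : K * m * |deriv a y| ≤ y * |deriv a y| := by
      gcongr
      rw [← hpm]; exact hy1.le
    have hd := abs_nonneg (deriv a y)
    have h2 : K * (2 * m * |deriv a y|) < K * 1 := by nlinarith
    exact lt_of_mul_lt_mul_left h2 (by positivity)
  have hfl : ∀ x y : ℝ, x ≤ y → |y - x| < 1 → ⌊y⌋ ≤ ⌊x⌋ + 1 := by
    intro x y hxy h
    have h1 := Int.lt_floor_add_one x
    have h2 := (abs_lt.1 h).2
    have h3 := Int.floor_le y
    have : (⌊y⌋ : ℝ) < ⌊x⌋ + 1 + 1 := by linarith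
    have : ⌊y⌋ < ⌊x⌋ + 1 + 1 := by exact_mod_cast this
    omega
  have hmem : ∀ n : ℕ, p ≤ n → (n : ℝ) ∈ Set.Ici X := fun n hn =>
    hXp.trans (by exact_mod_cast hn)
  rcases hX with hX | hX
  · have hA : ∀ i j : ℕ, p ≤ i → i ≤ j → ⌊a i⌋ ≤ ⌊a j⌋ := fun i j hi hij =>
      Int.floor_mono (hX (hmem i hi) (hmem j (hi.trans hij)) (by exact_mod_cast hij))
    have h2 : ⌊a ((p + m + m : ℕ) : ℝ)⌋ ≤ ⌊a p⌋ + 1 := hfl _ _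
      (hX (hmem p le_rfl) (hmem _ (by omega)) (by exact_mod_cast (by omega))) hvar
    have h3 := hA p (p + m) le_rfl (by omega)
    have h4 := hA (p + m) (p + m + m) (by omega) (by omega)
    rcases (by omega : ⌊a (p : ℕ)⌋ = ⌊a ((p + m : ℕ) : ℝ)⌋ ∨
      ⌊a ((p + m : ℕ) : ℝ)⌋ = ⌊a ((p + m + m : ℕ) : ℝ)⌋) with h | h
    · left
      intro n hn
      have hn := Finset.mem_Ioc.1 hn
      have h5 := hA p n le_rfl hn.1.le
      have h6 := hA n (p + m) hn.1.le hn.2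
      exact le_antisymm h6 (h ▸ h5)
    · right
      intro n hn
      have hn := Finset.mem_Ioc.1 hn
      have h5 := hA (p + m) n (by omega) hn.1.le
      have h6 := hA n (p + m + m) (by omega) hn.2
      exact le_antisymm h6 (h ▸ h5)
  · have hA : ∀ i j : ℕ, p ≤ i → i ≤ j → ⌊a j⌋ ≤ ⌊a i⌋ := fun i j hi hij =>
      Int.floor_mono (hX (hmem i hi) (hmem j (hi.trans hij)) (by exact_mod_cast hij))
    have h2 : ⌊a p⌋ ≤ ⌊a ((p + m + m : ℕ) : ℝ)⌋ + 1 := hfl _ _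
      (hX (hmem p le_rfl) (hmem _ (by omega)) (by exact_mod_cast (by omega)))
      (by rw [abs_sub_comm]; exact hvar)
    have h3 := hA p (p + m) le_rfl (by omega)
    have h4 := hA (p + m) (p + m + m) (by omega) (by omega)
    rcases (by omega : ⌊a (p : ℕ)⌋ = ⌊a ((p + m : ℕ) : ℝ)⌋ ∨
      ⌊a ((p + m : ℕ) : ℝ)⌋ = ⌊a ((p + m + m : ℕ) : ℝ)⌋) with h | h
    · left
      intro n hn
      have hn := Finset.mem_Ioc.1 hn
      have h5 := hA p n le_rfl hn.1.le
      have h6 := hA n (p + m) hn.1.le hn.2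
      exact le_antisymm (h ▸ h5) h6
    · right
      intro n hn
      have hn := Finset.mem_Ioc.1 hn
      have h5 := hA (p + m) n (by omega) hn.1.le
      have h6 := hA n (p + m + m) (by omega) hn.2
      exact le_antisymm (h ▸ h5) h6

end SlowGrowth

/-! ### Spectral measures of bounded functions under an ergodic sequence of powers -/

section

variable {X : Type*} [MeasurableSpace X] {μ : Measure X}

lemma IsSpectralMeasure.norm_koopmanAvg_sq {T : X ≃ᵐ X} (hT : MeasurePreserving T μ μ) (c : ℕ → ℤ)
    {f : Lp ℂ 2 μ} {σ : Measure UnitAddCircle} [IsFiniteMeasure σ]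
    (hσ : IsSpectralMeasure σ fun n => (koopmanEquiv T hT ^ n) f) (N : ℕ) :
    ‖koopmanAvg (fun n => iterZ T (c n)) (fun _ => measurePreserving_iterZ hT _) N f‖ ^ 2 =
      ∫ z, ‖cesaro (fun n => fourier (c n) z) N‖ ^ 2 ∂σ := by
  have := hσ.norm_sq_sum (Finset.Icc 1 N) (fun _ => 1 / (N : ℂ)) c
  rw [koopmanAvg_apply, Finset.smul_sum]
  simp only [koopmanEquiv_zpow_apply hT] at this
  simp only [cesaro, Finset.mul_sum]
  exact this

variable [IsProbabilityMeasure μ]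

/-- By ergodicity the squared norms of the averages converge to the mass of 0, which is exactly what
the point 0 contributes for each `N ≥ 1`. The integral over the complement thus tends to 0, and
blockwise constancy leaves no mass there. -/
lemma IsSpectralMeasure.compl_zero_eq_zero {T : X ≃ᵐ X} (hT : MeasurePreserving T μ μ) {c : ℕ → ℤ}
    (hc : ErgodicSeq μ fun n => iterZ T (c n)) (hblock : IsBlockwiseConst c) {f : X → ℂ}
    (hf : MemLp f ∞ μ) {σ : Measure UnitAddCircle} [IsFiniteMeasure σ]
    (hσ : IsSpectralMeasure σ fun n => (koopmanEquiv T hT ^ n)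
      ((hf.mono_exponent le_top : MemLp f 2 μ).toLp f)) : σ {0}ᶜ = 0 := by
  set v : Lp ℂ 2 μ := (hf.mono_exponent le_top : MemLp f 2 μ).toLp f with hv
  have hS : ∀ n, MeasurePreserving (iterZ T (c n)) μ μ := fun _ => measurePreserving_iterZ hT _
  have h1 : Tendsto (fun N => ‖koopmanAvg (fun n => iterZ T (c n)) hS N v‖ ^ 2) atTop
      (𝓝 (‖meanProj μ v‖ ^ 2)) := ((ergodicSeq_iff hS).1 hc f hf).norm.pow 2
  have h2 : ‖meanProj μ v‖ ^ 2 = σ.real {0} := by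
    rw [measureReal_singleton_zero_of_isSpectralMeasure hT hc hσ, meanProj_apply, norm_smul,
      norm_oneLp, mul_one]
  rw [← Measure.restrict_eq_zero]
  refine hblock.measure_eq_zero ?_
  have h3 := (h1.sub_const (σ.real {0}))
  rw [h2, sub_self] at h3
  refine h3.congr' ?_
  filter_upwards [eventually_gt_atTop 0] with N hN
  have hN' : (N : ℂ) ≠ 0 := by exact_mod_cast hN.ne'
  have hint : Integrable (fun z => ‖cesaro (fun n => fourier (c n) z) N‖ ^ 2) σ :=
    integrable_of_continuous ((continuous_cesaro_fourier c N).norm.pow 2)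
  rw [hσ.norm_koopmanAvg_sq hT c N, ← integral_add_compl (measurableSet_singleton 0) hint,
    integral_singleton]
  simp [cesaro, hN']

/-- The correlations of the continuous part of a spectral measure vanish in the mean. -/
lemma tendsto_correlations_off_atoms {R : Set (ℝ → ℝ)} (hR : IsHardyRing R) {a : ℝ → ℝ}
    (ha : a ∈ R) {C : ℝ} {d : ℕ} (hgr : ∀ᶠ x in atTop, |a x| ≤ C * x ^ d)
    {T : X ≃ᵐ X} (hT : MeasurePreserving T μ μ)
    (hc : ErgodicSeq μ fun n => iterZ T ⌊a n⌋) {f : X → ℂ}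
    (hf : MemLp f ∞ μ) {σ : Measure UnitAddCircle} [IsFiniteMeasure σ]
    (hσ : IsSpectralMeasure σ fun n => (koopmanEquiv T hT ^ n)
      ((hf.mono_exponent le_top : MemLp f 2 μ).toLp f)) :
    Tendsto (fun N : ℕ => (∑ n ∈ Finset.Icc 1 N, ∑ m ∈ Finset.Icc 1 N,
      ‖∫ x, fourier (⌊a n⌋ - ⌊a m⌋) x ∂(σ.restrict {t | σ {t} ≠ 0}ᶜ)‖ ^ 2) / (N : ℝ) ^ 2)
      atTop (𝓝 0) := by
  set P : Set UnitAddCircle := {t | σ {t} ≠ 0} with hP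
  have hPc : P.Countable := by
    have := Measure.countable_meas_pos_of_disjoint_iUnion (μ := σ)
      (As := fun t : UnitAddCircle => {t}) (fun t => measurableSet_singleton t)
      (fun s t hst => Set.disjoint_singleton.2 hst)
    exact this.mono fun t ht => pos_iff_ne_zero.2 ht
  -- At most logarithmic growth leaves no spectral mass off 0, hence no continuous part. Faster
  -- growth gives vanishing exponential means for all but countably many multiples.
  rcases hR.tendsto_or_abs_atTop (hR.mul hR.id (hR.deriv ha)) with ⟨l, hl⟩ | hinf
  · have h0 := IsSpectralMeasure.compl_zero_eq_zero hT hc (hR.isBlockwiseConst_floor ha hl) hf hσ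
    have : σ.restrict Pᶜ = 0 := by
      rw [Measure.restrict_eq_zero]
      by_cases h : σ {0} = 0
      · refine measure_mono_null (Set.subset_univ _) ?_
        rw [← Set.union_compl_self {(0 : UnitAddCircle)}]
        exact measure_union_null h h0
      · exact measure_mono_null (Set.compl_subset_compl.2 (Set.singleton_subset_iff.2 h)) h0
    simp [this]
  · obtain ⟨Z, hZ, hZ'⟩ := hR.exists_countable_awayFromRatPoly ha hinf
    have hna : NullSingletonClass (σ.restrict Pᶜ) := ⟨fun t => by
      rw [Measure.restrict_apply (measurableSet_singleton t)]
      by_cases ht : t ∈ P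
      · have : ({t} ∩ Pᶜ : Set UnitAddCircle) = ∅ := by
          ext s; simp only [Set.mem_inter_iff, Set.mem_singleton_iff, Set.mem_compl_iff]
          constructor
          · rintro ⟨rfl, h⟩; exact h ht
          · exact fun h => h.elim
        rw [this, measure_empty]
      · exact measure_mono_null Set.inter_subset_left (not_not.1 ht)⟩
    refine tendsto_correlations_of_noAtoms (a := fun n => a n) hZ (fun ξ hξ => ?_) _
    refine hR.tendsto_cesaro_unitExp (b := fun x => ξ * a x) (k := d) (hR.const_mul ha ξ) ?_ (hZ' ξ hξ)
    refine hR.tendsto_iterate_deriv (hR.const_mul ha ξ) (C := |ξ| * C) ?_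
    filter_upwards [hgr] with x hx
    rw [abs_mul, mul_assoc]
    gcongr

end

/-! ### Ergodicity of product transformations -/

section ProductSpectral

variable {ℓ : ℕ} {c : Fin ℓ → ℕ → ℤ}

/-- The averages of the characters of the torus along a sequence of frequencies. -/
noncomputable def torusAvg (c : Fin ℓ → ℕ → ℤ) (N : ℕ) (z : Fin ℓ → UnitAddCircle) : ℂ :=
  cesaro (fun n => ∏ j, fourier (c j n) (z j)) N

lemma continuous_torusAvg (N : ℕ) : Continuous (torusAvg c N) := by
  unfold torusAvg cesaro
  exact continuous_const.mul (continuous_finsetSum _ fun n _ => continuous_finsetProd _ fun j _ =>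
    (map_continuous (fourier (c j n))).comp (continuous_apply j))

lemma norm_torusAvg_le (N : ℕ) (z : Fin ℓ → UnitAddCircle) : ‖torusAvg c N z‖ ≤ 1 := by
  refine norm_cesaro_le zero_le_one (fun n => ?_) N
  rw [norm_prod]
  simp only [norm_fourier, Finset.prod_const_one, le_refl]

lemma integral_norm_torusAvg_sq (σ : Fin ℓ → Measure UnitAddCircle) [∀ j, IsFiniteMeasure (σ j)]
    (N : ℕ) : ((∫ z, ‖torusAvg c N z‖ ^ 2 ∂(Measure.pi σ) : ℝ) : ℂ) =
      (∑ n ∈ Finset.Icc 1 N, ∑ m ∈ Finset.Icc 1 N, ∏ j, ∫ x, fourier (c j n - c j m) x ∂(σ j)) /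
        (N : ℂ) ^ 2 := by
  have h1 : ∀ z, ((‖torusAvg c N z‖ ^ 2 : ℝ) : ℂ) = (∑ n ∈ Finset.Icc 1 N, ∑ m ∈ Finset.Icc 1 N,
      ∏ j, fourier (c j n - c j m) (z j)) / (N : ℂ) ^ 2 := by
    intro z
    push_cast
    rw [torusAvg, ← Complex.mul_conj', ← cesaro₂_mul_star, cesaro₂]
    congr 1
    refine Finset.sum_congr rfl fun n _ => Finset.sum_congr rfl fun m _ => ?_
    rw [map_prod, ← Finset.prod_mul_distrib]
    exact Finset.prod_congr rfl fun j _ => (fourier_sub_apply _ _ _).symm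
  have hint : ∀ n m, Integrable (fun z : Fin ℓ → UnitAddCircle => ∏ j, fourier (c j n - c j m) (z j))
      (Measure.pi σ) := fun n m => integrable_of_continuous (continuous_finsetProd _ fun j _ =>
    (map_continuous (fourier (c j n - c j m))).comp (continuous_apply j))
  rw [← integral_complex_ofReal]
  simp only [h1]
  rw [integral_div, integral_finsetSum _ fun n _ => integrable_finsetSum _ fun m _ => hint n m]
  congr 1
  refine Finset.sum_congr rfl fun n _ => ?_
  rw [integral_finsetSum _ fun m _ => hint n m]
  refine Finset.sum_congr rfl fun m _ => ?_
  exact integral_fintype_prod_eq_prod (fun j x => fourier (c j n - c j m) x)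

/-- When the Gram matrix factors into Fourier coefficients, the norm of the average is computed on
the product of the spectral measures. This avoids a joint spectral theorem for the product system.
-/
lemma norm_average_sq_eq_integral {E : Type*} [NormedAddCommGroup E] [InnerProductSpace ℂ E]
    (σ : Fin ℓ → Measure UnitAddCircle) [∀ j, IsFiniteMeasure (σ j)] {w : ℕ → E}
    (hw : ∀ m n, inner ℂ (w m) (w n) = ∏ j, ∫ x, fourier (c j n - c j m) x ∂(σ j)) (N : ℕ) :
    ‖(1 / (N : ℂ)) • ∑ n ∈ Finset.Icc 1 N, w n‖ ^ 2 =
      ∫ z, ‖torusAvg c N z‖ ^ 2 ∂(Measure.pi σ) := by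
  have h1 := inner_self_eq_norm_sq_to_K (𝕜 := ℂ) (∑ n ∈ Finset.Icc 1 N, w n)
  simp only [Complex.coe_algebraMap, sum_inner, inner_sum, hw] at h1
  have h2 := integral_norm_torusAvg_sq (c := c) σ N
  rw [h1] at h2
  rw [norm_smul, mul_pow, norm_div, norm_one, Complex.norm_natCast, one_div, inv_pow]
  rw [inv_mul_eq_div]
  exact_mod_cast h2.symm

lemma sum_div_sq_le_sqrt (x : ℕ → ℕ → ℝ) (N : ℕ) :
    (∑ n ∈ Finset.Icc 1 N, ∑ m ∈ Finset.Icc 1 N, x n m) / (N : ℝ) ^ 2 ≤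
      √((∑ n ∈ Finset.Icc 1 N, ∑ m ∈ Finset.Icc 1 N, x n m ^ 2) / (N : ℝ) ^ 2) := by
  refine Real.le_sqrt_of_sq_le ?_
  rcases Nat.eq_zero_or_pos N with rfl | hN
  · simp
  have hN' : (0 : ℝ) < N := by exact_mod_cast hN
  have := sq_sum_le_card_mul_sum_sq (s := Finset.Icc 1 N ×ˢ Finset.Icc 1 N)
    (f := fun p : ℕ × ℕ => x p.1 p.2)
  rw [Finset.sum_product, Finset.sum_product] at this
  simp only [Finset.card_product, Nat.card_Icc, Nat.add_sub_cancel, Nat.cast_mul] at this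
  rw [div_pow, div_le_div_iff₀ (by positivity) (by positivity)]
  calc _ ≤ (N * N * ∑ n ∈ Finset.Icc 1 N, ∑ m ∈ Finset.Icc 1 N, x n m ^ 2) * (N : ℝ) ^ 2 := by gcongr
    _ = _ := by ring

/-- Restricting a single coordinate leaves a product measure. In the expanded square the other
coordinates are bounded by their total masses, and Cauchy–Schwarz passes from the mean of the
coefficients to the mean of their squares. -/
lemma tendsto_setIntegral_off_atoms (σ : Fin ℓ → Measure UnitAddCircle)
    [∀ j, IsFiniteMeasure (σ j)] (j : Fin ℓ) {P : Set UnitAddCircle}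
    (h : Tendsto (fun N : ℕ => (∑ n ∈ Finset.Icc 1 N, ∑ m ∈ Finset.Icc 1 N,
      ‖∫ x, fourier (c j n - c j m) x ∂((σ j).restrict P)‖ ^ 2) / (N : ℝ) ^ 2) atTop (𝓝 0)) :
    Tendsto (fun N => ∫ z in {z | z j ∈ P}, ‖torusAvg c N z‖ ^ 2 ∂(Measure.pi σ)) atTop (𝓝 0) := by
  classical
  set σ' : Fin ℓ → Measure UnitAddCircle :=
    fun i => (σ i).restrict (if i = j then P else Set.univ) with hσ'
  have hset : {z : Fin ℓ → UnitAddCircle | z j ∈ P} =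
      Set.univ.pi fun i => if i = j then P else Set.univ := by
    ext z
    simp only [Set.mem_ofPred_eq, Set.mem_pi, Set.mem_univ, true_imp_iff]
    constructor
    · intro hz i
      split_ifs with hi
      · rwa [hi]
      · trivial
    · intro hz
      simpa using hz j
  have hmeas : (Measure.pi σ).restrict {z | z j ∈ P} = Measure.pi σ' := by
    rw [hset, Measure.restrict_pi_pi]
  have hfin : ∀ i, IsFiniteMeasure (σ' i) := fun i => by rw [hσ']; infer_instance
  set M : ℝ := ∏ i ∈ Finset.univ.erase j, (σ' i).real Set.univ with hM
  have hM0 : 0 ≤ M := Finset.prod_nonneg fun i _ => measureReal_nonneg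
  have hσj : σ' j = (σ j).restrict P := by simp [hσ']
  have hbound : ∀ n m : ℕ, ‖∏ i, ∫ x, fourier (c i n - c i m) x ∂(σ' i)‖ ≤
      M * ‖∫ x, fourier (c j n - c j m) x ∂((σ j).restrict P)‖ := by
    intro n m
    rw [norm_prod, ← Finset.prod_erase_mul _ _ (Finset.mem_univ j), hσj, hM]
    gcongr with i _
    refine (norm_integral_le_of_norm_le_const (C := 1)
      (Eventually.of_forall fun x => (norm_fourier _ x).le)).trans ?_
    rw [one_mul]
  have hs := (h.sqrt.const_mul M)
  rw [Real.sqrt_zero, mul_zero] at hs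
  refine squeeze_zero (fun N => integral_nonneg fun z => by positivity) (fun N => ?_) hs
  rw [hmeas]
  have h1 := congrArg norm (integral_norm_torusAvg_sq (c := c) σ' N)
  rw [Complex.norm_real, Real.norm_of_nonneg (integral_nonneg fun z => by positivity)] at h1
  rw [h1, norm_div, norm_pow, Complex.norm_natCast]
  calc _ ≤ (∑ n ∈ Finset.Icc 1 N, ∑ m ∈ Finset.Icc 1 N,
        M * ‖∫ x, fourier (c j n - c j m) x ∂((σ j).restrict P)‖) / (N : ℝ) ^ 2 := by
        gcongr
        exact norm_sum_le_of_le _ fun n _ => norm_sum_le_of_le _ fun m _ => hbound n m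
    _ = M * ((∑ n ∈ Finset.Icc 1 N, ∑ m ∈ Finset.Icc 1 N,
        ‖∫ x, fourier (c j n - c j m) x ∂((σ j).restrict P)‖) / (N : ℝ) ^ 2) := by
        simp only [← Finset.mul_sum]
        ring
    _ ≤ _ := by
        gcongr
        exact sum_div_sq_le_sqrt _ N

/-- The torus is split into the points with all coordinates atoms and the rest. On the first set the
means converge boundedly to the indicator of the origin; the second is covered by the `ℓ` sets where
one coordinate is not an atom. -/
lemma tendsto_integral_norm_torusAvg_sq (σ : Fin ℓ → Measure UnitAddCircle)
    [∀ j, IsFiniteMeasure (σ j)]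
    (hoff : ∀ j, Tendsto (fun N : ℕ => (∑ n ∈ Finset.Icc 1 N, ∑ m ∈ Finset.Icc 1 N,
      ‖∫ x, fourier (c j n - c j m) x ∂((σ j).restrict {t | σ j {t} ≠ 0}ᶜ)‖ ^ 2) / (N : ℝ) ^ 2)
      atTop (𝓝 0))
    (hon : ∀ z : Fin ℓ → UnitAddCircle, (∀ j, σ j {z j} ≠ 0) →
      Tendsto (fun N => torusAvg c N z) atTop (𝓝 (if z = 0 then 1 else 0))) :
    Tendsto (fun N => ∫ z, ‖torusAvg c N z‖ ^ 2 ∂(Measure.pi σ)) atTop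
      (𝓝 (∏ j, (σ j).real {0})) := by
  set P : Fin ℓ → Set UnitAddCircle := fun j => {t | σ j {t} ≠ 0} with hP
  have hPc : ∀ j, (P j).Countable := fun j => by
    have := Measure.countable_meas_pos_of_disjoint_iUnion (μ := σ j)
      (As := fun t : UnitAddCircle => {t}) (fun t => measurableSet_singleton t)
      (fun s t hst => Set.disjoint_singleton.2 hst)
    exact this.mono fun t ht => pos_iff_ne_zero.2 ht
  set A : Set (Fin ℓ → UnitAddCircle) := Set.univ.pi P with hA
  have hAm : MeasurableSet A := MeasurableSet.univ_pi fun j => (hPc j).measurableSet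
  have hint : ∀ N, Integrable (fun z => ‖torusAvg c N z‖ ^ 2) (Measure.pi σ) := fun N =>
    integrable_of_continuous ((continuous_torusAvg N).norm.pow 2)
  have h1 : Tendsto (fun N => ∫ z in A, ‖torusAvg c N z‖ ^ 2 ∂(Measure.pi σ)) atTop
      (𝓝 (∫ z in A, Set.indicator {0} (fun _ => (1 : ℝ)) z ∂(Measure.pi σ))) := by
    refine tendsto_integral_of_dominated_convergence (fun _ => 1)
      (fun N => ((continuous_torusAvg N).norm.pow 2).aestronglyMeasurable) (integrable_const _) ?_ ?_
    · intro N
      refine Eventually.of_forall fun z => ?_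
      rw [norm_pow, norm_norm]
      exact pow_le_one₀ (norm_nonneg _) (norm_torusAvg_le N z)
    · filter_upwards [ae_restrict_mem hAm] with z hz
      have := (hon z fun j => hz j (Set.mem_univ j)).norm.pow 2
      convert this using 2
      by_cases hz0 : z = 0 <;> simp [hz0]
  have h2 : ∫ z in A, Set.indicator {0} (fun _ => (1 : ℝ)) z ∂(Measure.pi σ) =
      ∏ j, (σ j).real {0} := by
    have e1 : ∏ j, (σ j).real {0} = (Measure.pi σ).real {0} := by
      rw [Measure.real, Measure.pi_singleton, ENNReal.toReal_prod]
      rfl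
    refine (integral_indicator_one (measurableSet_singleton 0)).trans ?_
    rw [e1]
    by_cases h0 : (0 : Fin ℓ → UnitAddCircle) ∈ A
    · rw [Measure.real, Measure.restrict_apply (measurableSet_singleton 0),
        Set.inter_eq_left.2 (Set.singleton_subset_iff.2 h0)]
      rfl
    · have h3 : (Measure.pi σ) {0} = 0 := by
        rw [Measure.pi_singleton]
        have : ∃ j, (0 : UnitAddCircle) ∉ P j := by
          by_contra! h
          exact h0 fun j _ => h j
        obtain ⟨j, hj⟩ := this
        exact Finset.prod_eq_zero (Finset.mem_univ j) (not_not.1 hj)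
      rw [Measure.real, Measure.real, h3, Measure.restrict_apply (measurableSet_singleton 0),
        measure_mono_null Set.inter_subset_left h3]
  rw [h2] at h1
  have h3 : Tendsto (fun N => ∫ z in Aᶜ, ‖torusAvg c N z‖ ^ 2 ∂(Measure.pi σ)) atTop (𝓝 0) := by
    have h4 : Tendsto (fun N => ∑ j, ∫ z in {z | z j ∈ (P j)ᶜ}, ‖torusAvg c N z‖ ^ 2 ∂(Measure.pi σ))
        atTop (𝓝 0) := by
      have := tendsto_finsetSum (Finset.univ : Finset (Fin ℓ)) fun j _ =>
        tendsto_setIntegral_off_atoms (c := c) σ j (hoff j)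
      rw [Finset.sum_const_zero] at this
      exact this
    refine squeeze_zero (fun N => integral_nonneg fun z => by positivity) (fun N => ?_) h4
    have hm : ∀ j, MeasurableSet {z : Fin ℓ → UnitAddCircle | z j ∈ (P j)ᶜ} := fun j =>
      (measurable_pi_apply j) (hPc j).measurableSet.compl
    rw [← integral_indicator hAm.compl]
    simp only [← integral_indicator (hm _)]
    rw [← integral_finsetSum _ fun j _ => (hint N).indicator (hm j)]
    refine integral_mono ((hint N).indicator hAm.compl)
      (integrable_finsetSum _ fun j _ => (hint N).indicator (hm j)) fun z => ?_
    have hnn : ∀ i ∈ Finset.univ, 0 ≤ Set.indicator {z : Fin ℓ → UnitAddCircle | z i ∈ (P i)ᶜ}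
        (fun z => ‖torusAvg c N z‖ ^ 2) z := fun i _ =>
      Set.indicator_nonneg (fun z _ => by positivity) z
    by_cases hz : z ∈ A
    · rw [Set.indicator_of_notMem (by simpa using hz)]
      exact Finset.sum_nonneg hnn
    · rw [Set.indicator_of_mem (by simpa using hz)]
      have : ∃ j, z j ∉ P j := by
        by_contra! h
        exact hz fun j _ => h j
      obtain ⟨j, hj⟩ := this
      refine le_trans ?_ (Finset.single_le_sum hnn (Finset.mem_univ j))
      rw [Set.indicator_of_mem (show z ∈ {z : Fin ℓ → UnitAddCircle | z j ∈ (P j)ᶜ} from hj)]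
  have h5 := h1.add h3
  rw [add_zero] at h5
  exact h5.congr fun N => integral_add_compl hAm (hint N)

end ProductSpectral

/-! ### Product ergodicity -/

section ProductErgodicity

variable {X : Type*} [MeasurableSpace X] {μ : Measure X}

lemma exists_isSpectralMeasure_koopmanEquiv {T : X ≃ᵐ X} (hT : MeasurePreserving T μ μ)
    (f : Lp ℂ 2 μ) : ∃ σ : Measure UnitAddCircle, IsFiniteMeasure σ ∧
      IsSpectralMeasure σ fun n => (koopmanEquiv T hT ^ n) f :=
  exists_isSpectralMeasure fun m n k => inner_zpow_add _ f m n k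

variable [IsProbabilityMeasure μ] {ℓ : ℕ} {T : Fin ℓ → X ≃ᵐ X}

/-- The product ergodicity condition. -/
theorem JointlyErgodic.productErgodic {R : Set (ℝ → ℝ)} (hR : IsHardyRing R) {a : Fin ℓ → ℝ → ℝ}
    (ha : ∀ j, a j ∈ R) (hgr : ∀ j, ∃ (C : ℝ) (d : ℕ), ∀ᶠ x in atTop, |a j x| ≤ C * x ^ d)
    (hT : ∀ j, MeasurePreserving (T j) μ μ) (hjoint : JointlyErgodic μ T fun j n => a j n) :
    ProductErgodic μ T fun j n => a j n := by
  set S : ℕ → (Fin ℓ → X) → Fin ℓ → X := fun n x j => iterZ (T j) ⌊a j n⌋ (x j) with hSdef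
  have hS : ∀ n, MeasurePreserving (S n) (Measure.pi fun _ => μ) (Measure.pi fun _ => μ) :=
    fun n => measurePreserving_pi _ _ fun j => measurePreserving_iterZ (hT j) _
  refine ergodicSeq_of_generateFrom hS generateFrom_pi.symm isPiSystem_pi ?_
  rintro _ ⟨A, hA, rfl⟩ hs
  have hA : ∀ j, MeasurableSet (A j) := fun j => hA j (Set.mem_univ j)
  set f : Fin ℓ → X → ℂ := fun j => (A j).indicator fun _ => 1 with hf
  have hfm : ∀ j, MemLp (f j) ∞ μ := fun j => memLp_indicator_const _ (hA j) _
    (Or.inr (measure_ne_top _ _))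
  have hf2 : ∀ j, MemLp (f j) 2 μ := fun j => (hfm j).mono_exponent le_top
  set F : (Fin ℓ → X) → ℂ := (Set.univ.pi A).indicator fun _ => 1 with hF
  have hFprod : ∀ y, F y = ∏ j, f j (y j) := by
    intro y
    by_cases hy : y ∈ Set.univ.pi A
    · rw [hF, Set.indicator_of_mem hy]
      refine (Finset.prod_eq_one fun j _ => ?_).symm
      rw [hf]
      exact Set.indicator_of_mem (hy j (Set.mem_univ j)) _
    · rw [hF, Set.indicator_of_notMem hy]
      obtain ⟨j, hj⟩ : ∃ j, y j ∉ A j := by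
        by_contra! h
        exact hy fun j _ => h j
      exact (Finset.prod_eq_zero (Finset.mem_univ j) (Set.indicator_of_notMem hj _)).symm
  have hFm : MemLp F 2 (Measure.pi fun _ : Fin ℓ => μ) := memLp_indicator_const _ hs _
    (Or.inr (measure_ne_top _ _))
  have hv : indLp (Measure.pi fun _ : Fin ℓ => μ) hs = hFm.toLp F := rfl
  choose σ hσfin hσ using fun j => exists_isSpectralMeasure_koopmanEquiv (hT j) ((hf2 j).toLp (f j))
  have herg := fun j => hjoint.ergodicSeq j
  have hlim : Tendsto (fun N => ∫ z, ‖torusAvg (fun j n => ⌊a j n⌋) N z‖ ^ 2 ∂(Measure.pi σ)) atTop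
      (𝓝 (∏ j, (σ j).real {0})) := by
    refine tendsto_integral_norm_torusAvg_sq σ (fun j => ?_) fun z hz => ?_
    · obtain ⟨C, d, hCd⟩ := hgr j
      exact tendsto_correlations_off_atoms hR (ha j) hCd (hT j) (herg j) (hfm j) (hσ j)
    · exact hjoint.tendsto_cesaro_fourier hT fun j =>
        exists_unimodularEigenfunction (hT j) (herg j) (hσ j) (hz j)
  -- Fubini: inner products of tensors factor over the coordinates, and each factor is a Fourier
  -- coefficient of the corresponding spectral measure.
  have hinner : ∀ m n, inner ℂ (koopman (S m) (hS m) (hFm.toLp F))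
      (koopman (S n) (hS n) (hFm.toLp F)) =
      ∏ j, ∫ x, fourier (⌊a j n⌋ - ⌊a j m⌋) x ∂(σ j) := by
    intro m n
    rw [koopman_toLp, koopman_toLp, inner_toLp_toLp]
    have h1 : ∀ y, (starRingEnd ℂ) ((F ∘ S m) y) * (F ∘ S n) y =
        ∏ j, ((starRingEnd ℂ) (f j (iterZ (T j) ⌊a j m⌋ (y j))) *
          f j (iterZ (T j) ⌊a j n⌋ (y j))) := by
      intro y
      rw [Function.comp_apply, Function.comp_apply, hFprod, hFprod, map_prod,
        ← Finset.prod_mul_distrib]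
    simp only [h1]
    refine (integral_fintype_prod_eq_prod (fun j x => (starRingEnd ℂ)
      (f j (iterZ (T j) ⌊a j m⌋ x)) * f j (iterZ (T j) ⌊a j n⌋ x))).trans ?_
    refine Finset.prod_congr rfl fun j _ => ?_
    rw [hσ j]
    beta_reduce
    rw [koopmanEquiv_zpow_apply, koopmanEquiv_zpow_apply, koopman_toLp, koopman_toLp,
      inner_toLp_toLp]
    rfl
  have hmean : ∏ j, (σ j).real {0} =
      ‖inner ℂ (oneLp (Measure.pi fun _ : Fin ℓ => μ)) (hFm.toLp F)‖ ^ 2 := by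
    rw [inner_oneLp_toLp]
    simp only [hFprod]
    rw [integral_fintype_prod_eq_prod (fun j x => f j x), norm_prod, ← Finset.prod_pow]
    refine Finset.prod_congr rfl fun j _ => ?_
    rw [measureReal_singleton_zero_of_isSpectralMeasure (hT j) (herg j) (hσ j), inner_oneLp_toLp]
  rw [hv, mem_ergodicVectors, ← tendsto_sub_nhds_zero_iff, tendsto_zero_iff_norm_tendsto_zero]
  have h2 : Tendsto (fun N => ‖koopmanAvg S hS N (hFm.toLp F) -
      meanProj (Measure.pi fun _ : Fin ℓ => μ) (hFm.toLp F)‖ ^ 2) atTop (𝓝 0) := by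
    have h3 := hlim.sub_const (∏ j, (σ j).real {0})
    rw [sub_self] at h3
    refine h3.congr' ?_
    filter_upwards [eventually_gt_atTop 0] with N hN
    rw [norm_sub_meanProj_sq _ _ (inner_oneLp_koopmanAvg hS hN _), ← hmean, koopmanAvg_apply,
      norm_average_sq_eq_integral (c := fun j n => ⌊a j n⌋) σ hinner]
  have h4 := h2.sqrt
  simpa using h4

end ProductErgodicity

/-! ### Approximation in the mean by trigonometric sequences -/

section MeanApprox

/-- `u` is approximated in the mean by elements of `V`. -/
def MeanApprox (V : Set (ℕ → ℂ)) (u : ℕ → ℂ) : Prop :=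
  ∀ ε > 0, ∃ v ∈ V, ∀ᶠ N : ℕ in atTop, (∑ n ∈ Finset.Icc 1 N, ‖u n - v n‖) / N ≤ ε

lemma MeanApprox.of_tendsto {V : Set (ℕ → ℂ)} {u v : ℕ → ℂ} (hv : v ∈ V)
    (h : Tendsto (fun n => u n - v n) atTop (𝓝 0)) : MeanApprox V u := fun ε hε => by
  refine ⟨v, hv, ?_⟩
  have := tendsto_sum_div_of_tendsto (tendsto_zero_iff_norm_tendsto_zero.1 h)
  exact (this.eventually (gt_mem_nhds hε)).mono fun N hN => hN.le

lemma MeanApprox.exists_tendsto_cesaro {V : Set (ℕ → ℂ)} {u : ℕ → ℂ} (h : MeanApprox V u)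
    (hV : ∀ v ∈ V, ∃ l, Tendsto (cesaro v) atTop (𝓝 l)) : ∃ l, Tendsto (cesaro u) atTop (𝓝 l) := by
  refine cauchySeq_tendsto_of_complete ?_
  rw [Metric.cauchySeq_iff']
  intro ε hε
  obtain ⟨v, hv, hN⟩ := h (ε / 5) (by positivity)
  obtain ⟨l, hl⟩ := hV v hv
  have h1 : ∀ᶠ N : ℕ in atTop, dist (cesaro u N) l ≤ 2 * (ε / 5) := by
    filter_upwards [hN, Metric.tendsto_nhds.1 hl (ε / 5) (by positivity)] with N h1 h2
    have h3 : dist (cesaro u N) (cesaro v N) ≤ ε / 5 := by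
      rw [dist_eq_norm, ← cesaro_sub]
      exact (norm_cesaro_le_cesaro (fun n => le_rfl) N).trans h1
    linarith [dist_triangle (cesaro u N) (cesaro v N) l]
  obtain ⟨N₀, hN₀⟩ := eventually_atTop.1 h1
  refine ⟨N₀, fun N hN => ?_⟩
  have h2 := hN₀ N hN
  have h3 := hN₀ N₀ le_rfl
  have h4 := dist_triangle_right (cesaro u N) (cesaro u N₀) l
  linarith

/-- From `u u' - v v' = (u - v) u' + v (u' - v')`. The approximant `v` is chosen first, since the
accuracy required of `v'` depends on its bound. -/
lemma MeanApprox.mul {V V' : Set (ℕ → ℂ)} {u u' : ℕ → ℂ} (h : MeanApprox V u)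
    (h' : MeanApprox V' u') (hu' : ∀ n, ‖u' n‖ ≤ 1) (hV : ∀ v ∈ V, ∃ C, ∀ n, ‖v n‖ ≤ C)
    {W : Set (ℕ → ℂ)} (hW : ∀ v ∈ V, ∀ v' ∈ V', (fun n => v n * v' n) ∈ W) :
    MeanApprox W fun n => u n * u' n := by
  intro ε hε
  obtain ⟨v, hv, hN⟩ := h (ε / 2) (by positivity)
  obtain ⟨C, hC⟩ := hV v hv
  have hC1 : 0 < |C| + 1 := by positivity
  obtain ⟨v', hv', hN'⟩ := h' (ε / 2 / (|C| + 1)) (by positivity)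
  refine ⟨_, hW v hv v' hv', ?_⟩
  filter_upwards [hN, hN'] with N h1 h2
  have h3 : ∀ n, ‖u n * u' n - v n * v' n‖ ≤ ‖u n - v n‖ + (|C| + 1) * ‖u' n - v' n‖ := by
    intro n
    rw [show u n * u' n - v n * v' n = (u n - v n) * u' n + v n * (u' n - v' n) by ring]
    refine (norm_add_le _ _).trans ?_
    rw [norm_mul, norm_mul]
    gcongr
    · exact mul_le_of_le_one_right (norm_nonneg _) (hu' n)
    · exact (hC n).trans (by linarith [le_abs_self C])
  calc _ ≤ (∑ n ∈ Finset.Icc 1 N, (‖u n - v n‖ + (|C| + 1) * ‖u' n - v' n‖)) / (N : ℝ) := by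
        gcongr with n _
        exact h3 n
    _ = (∑ n ∈ Finset.Icc 1 N, ‖u n - v n‖) / N +
        (|C| + 1) * ((∑ n ∈ Finset.Icc 1 N, ‖u' n - v' n‖) / N) := by
        rw [Finset.sum_add_distrib, ← Finset.mul_sum]
        ring
    _ ≤ ε / 2 + (|C| + 1) * (ε / 2 / (|C| + 1)) := by gcongr
    _ = ε := by field_simp; ring

/-- The span of the sequences `e(q n + r a(n))` with `q` rational and `r` real. -/
def trigSeq (a : ℕ → ℝ) : Submodule ℂ (ℕ → ℂ) :=
  Submodule.span ℂ (Set.range fun p : ℚ × ℝ => fun n : ℕ => unitExp (p.1 * n + p.2 * a n))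

lemma unitExp_mem_trigSeq (a : ℕ → ℝ) (q : ℚ) (r : ℝ) :
    (fun n : ℕ => unitExp (q * n + r * a n)) ∈ trigSeq a :=
  Submodule.subset_span ⟨(q, r), rfl⟩

lemma exists_norm_le_of_mem_trigSeq {a : ℕ → ℝ} {v : ℕ → ℂ} (hv : v ∈ trigSeq a) :
    ∃ C, ∀ n, ‖v n‖ ≤ C := by
  induction hv using Submodule.span_induction with
  | mem v hv =>
    obtain ⟨p, rfl⟩ := hv
    exact ⟨1, fun n => (norm_unitExp _).le⟩
  | zero => exact ⟨0, fun n => by simp⟩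
  | add v w _ _ hv hw =>
    obtain ⟨C, hC⟩ := hv
    obtain ⟨D, hD⟩ := hw
    exact ⟨C + D, fun n => (norm_add_le _ _).trans (add_le_add (hC n) (hD n))⟩
  | smul c v _ hv =>
    obtain ⟨C, hC⟩ := hv
    refine ⟨‖c‖ * C, fun n => ?_⟩
    rw [Pi.smul_apply, norm_smul]
    gcongr
    exact hC n

lemma exists_tendsto_cesaro_mul_of_mem_trigSeq {a b : ℕ → ℝ}
    (h : ∀ (q : ℚ) (r s : ℝ),
      ∃ l, Tendsto (cesaro fun n => unitExp (q * n + (r * a n + s * b n))) atTop (𝓝 l))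
    {v w : ℕ → ℂ} (hv : v ∈ trigSeq a) (hw : w ∈ trigSeq b) :
    ∃ l, Tendsto (cesaro fun n => v n * w n) atTop (𝓝 l) := by
  induction hv, hw using Submodule.span_induction₂ with
  | mem_mem v w hv hw =>
    obtain ⟨p, rfl⟩ := hv
    obtain ⟨p', rfl⟩ := hw
    obtain ⟨l, hl⟩ := h (p.1 + p'.1) p.2 p'.2
    refine ⟨l, hl.congr fun N => ?_⟩
    congr 1
    ext n
    rw [← unitExp_add]
    congr 1
    push_cast
    ring
  | zero_left w hw => exact ⟨0, by simpa using cesaro_const 0⟩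
  | zero_right v hv => exact ⟨0, by simpa using cesaro_const 0⟩
  | add_left v v' w _ _ _ h1 h2 =>
    obtain ⟨l, hl⟩ := h1
    obtain ⟨l', hl'⟩ := h2
    refine ⟨l + l', (hl.add hl').congr fun N => ?_⟩
    rw [← cesaro_add]
    simp only [Pi.add_apply, add_mul]
  | add_right v w w' _ _ _ h1 h2 =>
    obtain ⟨l, hl⟩ := h1
    obtain ⟨l', hl'⟩ := h2
    refine ⟨l + l', (hl.add hl').congr fun N => ?_⟩
    rw [← cesaro_add]
    simp only [Pi.add_apply, mul_add]
  | smul_left c v w _ _ h1 =>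
    obtain ⟨l, hl⟩ := h1
    refine ⟨c * l, (hl.const_mul c).congr fun N => ?_⟩
    rw [← cesaro_const_mul]
    simp only [Pi.smul_apply, smul_eq_mul, mul_assoc]
  | smul_right c v w _ _ h1 =>
    obtain ⟨l, hl⟩ := h1
    refine ⟨c * l, (hl.const_mul c).congr fun N => ?_⟩
    rw [← cesaro_const_mul]
    simp only [Pi.smul_apply, smul_eq_mul, mul_left_comm]

lemma periodic_mul_unitExp_mem_trigSeq {χ : ℕ → ℂ} {Q : ℕ} (hQ : 0 < Q)
    (hχ : Function.Periodic χ Q) (a : ℕ → ℝ) (r : ℝ) :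
    (fun n => χ n * unitExp (r * a n)) ∈ trigSeq a := by
  obtain ⟨c, hc⟩ := exists_fourier_of_periodic hQ hχ
  have : (fun n => χ n * unitExp (r * a n)) = ∑ j ∈ Finset.range Q,
      c j • fun n : ℕ => unitExp (((j / Q : ℚ) : ℝ) * n + r * a n) := by
    ext n
    rw [hc, Finset.sum_apply, Finset.sum_mul]
    refine Finset.sum_congr rfl fun j _ => ?_
    rw [Pi.smul_apply, smul_eq_mul, unitExp_add, mul_assoc]
    push_cast
    rfl
  rw [this]
  exact Submodule.sum_mem _ fun j _ => Submodule.smul_mem _ _ (unitExp_mem_trigSeq a _ r)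

/-- The Fejér kernel, with value `1` at the integers. -/
noncomputable def fejer (M : ℕ) (y : ℝ) : ℝ :=
  ‖(M : ℂ)⁻¹ * ∑ k ∈ Finset.range M, unitExp (k * y)‖ ^ 2

lemma fejer_intCast {M : ℕ} (hM : 0 < M) (z : ℤ) : fejer M z = 1 := by
  have hM' : (M : ℂ) ≠ 0 := by exact_mod_cast hM.ne'
  have : ∀ k : ℕ, unitExp (k * (z : ℝ)) = 1 := fun k => by
    rw [unitExp_eq_one_iff]; exact ⟨k * z, by push_cast; rfl⟩
  simp [fejer, this, hM']

lemma fejer_sub_int (M : ℕ) (y : ℝ) (z : ℤ) : fejer M (y - z) = fejer M y := by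
  have : ∀ k : ℕ, unitExp (k * (y - z)) = unitExp (k * y) := fun k => by
    rw [← unitExp_add_int (k * y) (-(k * z))]
    congr 1
    push_cast
    ring
  simp only [fejer, this]

lemma fejer_nonneg (M : ℕ) (y : ℝ) : 0 ≤ fejer M y := by unfold fejer; positivity

lemma continuous_fejer (M : ℕ) : Continuous (fejer M) := by
  unfold fejer
  exact (continuous_const.mul (continuous_finsetSum _ fun k _ => continuous_unitExp.comp
    (continuous_const.mul continuous_id))).norm.pow 2

variable {a : ℕ → ℝ}

/-- Expanding the square, only the `M` diagonal terms survive in the mean, each of weight `1 / M ^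
2`. The limit is `1 / M`, and `2 / M` leaves room. This bounds the proportion of `n` for which `a n`
is close to an integer. -/
lemma eventually_average_fejer_le
    (h : ∀ k : ℤ, k ≠ 0 → Tendsto (cesaro fun n => unitExp (k * a n)) atTop (𝓝 0)) {M : ℕ}
    (hM : 0 < M) :
    ∀ᶠ N : ℕ in atTop, (∑ n ∈ Finset.Icc 1 N, fejer M (a n)) / N ≤ 2 / M := by
  have hM' : (M : ℂ) ≠ 0 := by exact_mod_cast hM.ne'
  have hM'' : (0 : ℝ) < M := by exact_mod_cast hM
  have e : ∀ n, (fejer M (a n) : ℂ) = ∑ k ∈ Finset.range M, ∑ l ∈ Finset.range M,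
      ((M : ℂ) ^ 2)⁻¹ * unitExp (((k - l : ℤ) : ℝ) * a n) := by
    intro n
    rw [fejer]
    push_cast
    rw [← Complex.mul_conj', map_mul, map_sum, mul_mul_mul_comm, Finset.sum_mul_sum, Finset.mul_sum]
    refine Finset.sum_congr rfl fun k _ => ?_
    rw [Finset.mul_sum]
    refine Finset.sum_congr rfl fun l _ => ?_
    rw [← unitExp_sub, map_inv₀, Complex.conj_natCast]
    congr 1
    · field_simp
    · congr 1; ring
  have hlim : Tendsto (cesaro fun n => (fejer M (a n) : ℂ)) atTop
      (𝓝 (∑ k ∈ Finset.range M, ∑ l ∈ Finset.range M,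
        ((M : ℂ) ^ 2)⁻¹ * (if l = k then 1 else 0))) := by
    simp only [e]
    have : (cesaro fun n => ∑ k ∈ Finset.range M, ∑ l ∈ Finset.range M,
        ((M : ℂ) ^ 2)⁻¹ * unitExp (((k - l : ℤ) : ℝ) * a n)) = fun N =>
        ∑ k ∈ Finset.range M, ∑ l ∈ Finset.range M,
        ((M : ℂ) ^ 2)⁻¹ * cesaro (fun n => unitExp (((k - l : ℤ) : ℝ) * a n)) N := by
      ext N
      rw [cesaro_sum]
      refine Finset.sum_congr rfl fun k _ => ?_
      rw [cesaro_sum]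
      exact Finset.sum_congr rfl fun l _ => cesaro_const_mul _ _ _
    rw [this]
    refine tendsto_finsetSum _ fun k _ => tendsto_finsetSum _ fun l _ => Tendsto.const_mul _ ?_
    split_ifs with hkl
    · subst hkl
      simpa using cesaro_const 1
    · exact h _ (by omega)
  have hval : ∑ k ∈ Finset.range M, ∑ l ∈ Finset.range M,
        ((M : ℂ) ^ 2)⁻¹ * (if l = k then 1 else 0) = ((1 / M : ℝ) : ℂ) := by
    have : ∀ k ∈ Finset.range M, ∑ l ∈ Finset.range M,
        ((M : ℂ) ^ 2)⁻¹ * (if l = k then 1 else 0) = ((M : ℂ) ^ 2)⁻¹ := by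
      intro k hk
      rw [← Finset.mul_sum, Finset.sum_ite_eq', if_pos hk, mul_one]
    rw [Finset.sum_congr rfl this, Finset.sum_const, Finset.card_range, nsmul_eq_mul]
    push_cast
    field_simp
  rw [hval] at hlim
  have hre := (Complex.continuous_re.tendsto _).comp hlim
  rw [Complex.ofReal_re] at hre
  have hlt : 1 / (M : ℝ) < 2 / M := by gcongr; norm_num
  filter_upwards [hre.eventually (gt_mem_nhds hlt)] with N hN
  have : (cesaro (fun n => (fejer M (a n) : ℂ)) N) =
      (((∑ n ∈ Finset.Icc 1 N, fejer M (a n)) / N : ℝ) : ℂ) := by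
    rw [cesaro]; push_cast; ring
  rw [Function.comp_apply, this, Complex.ofReal_re] at hN
  exact hN.le

lemma mem_trigSeq_of_mem_span_fourier (s : ℝ) {F : C(UnitAddCircle, ℂ)}
    (hF : F ∈ Submodule.span ℂ (Set.range (fourier (T := (1 : ℝ))))) :
    (fun n => unitExp (s * a n) * F (a n : UnitAddCircle)) ∈ trigSeq a := by
  induction hF using Submodule.span_induction with
  | mem F hF =>
    obtain ⟨k, rfl⟩ := hF
    convert unitExp_mem_trigSeq a 0 (s + k) using 2 with n
    rw [fourier_coe_eq_unitExp, ← unitExp_add]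
    congr 1
    push_cast
    ring
  | zero =>
    have := (trigSeq a).zero_mem
    convert this using 1
    ext n
    simp
  | add F G _ _ hF hG =>
    have := (trigSeq a).add_mem hF hG
    convert this using 1
    ext n
    simp [mul_add]
  | smul c F _ hF =>
    have := (trigSeq a).smul_mem c hF
    convert this using 1
    ext n
    simp [mul_left_comm]

/-- Characters of the integer part of an equidistributed sequence. -/
lemma meanApprox_unitExp_floor
    (h : ∀ k : ℤ, k ≠ 0 → Tendsto (cesaro fun n => unitExp (k * a n)) atTop (𝓝 0)) (s : ℝ) :
    MeanApprox (trigSeq a) fun n => unitExp (s * ⌊a n⌋) := by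
  intro ε hε
  obtain ⟨M, hM⟩ := exists_nat_gt (max 1 (4 / ε))
  have hM1 : (1 : ℝ) < M := (le_max_left _ _).trans_lt hM
  have hM0 : 0 < M := by exact_mod_cast (zero_lt_one.trans hM1)
  have hM2 : 2 / (M : ℝ) ≤ ε / 2 := by
    have := (le_max_right _ _).trans_lt hM
    rw [div_lt_iff₀ hε] at this
    rw [div_le_iff₀ (by positivity)]
    linarith
  -- As a function of the fractional part, `e(-s y)` has a jump at the integers. The factor `1 -
  -- fejer M y` vanishes there, which makes the product continuous on the circle at a cost of `2 /
  -- M` in the mean.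
  set g : ℝ → ℂ := fun y => unitExp (-s * y) * ((1 - fejer M y : ℝ) : ℂ) with hg
  have hg0 : g 0 = g 1 := by
    have h0 := fejer_intCast hM0 0
    have h1 := fejer_intCast hM0 1
    push_cast at h0 h1
    simp [hg, h0, h1]
  have hgc : Continuous g := (continuous_unitExp.comp (continuous_const.mul continuous_id)).mul
    (Complex.continuous_ofReal.comp (continuous_const.sub (continuous_fejer M)))
  set G : C(UnitAddCircle, ℂ) := ⟨AddCircle.liftIco 1 0 g,
    AddCircle.liftIco_zero_continuous hg0 hgc.continuousOn⟩ with hG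
  have hGa : ∀ y : ℝ, G (y : UnitAddCircle) = g (Int.fract y) := by
    intro y
    have h1 : (y : UnitAddCircle) = (Int.fract y : ℝ) := by
      rw [← sub_eq_zero, ← AddCircle.coe_sub, AddCircle.coe_eq_zero_iff]
      exact ⟨⌊y⌋, by rw [zsmul_one]; linarith [Int.floor_add_fract y]⟩
    rw [h1]
    exact AddCircle.liftIco_zero_coe_apply (f := g) ⟨Int.fract_nonneg y, Int.fract_lt_one y⟩
  have hGcl : G ∈ (Submodule.span ℂ (Set.range (fourier (T := (1 : ℝ))))).topologicalClosure := by
    rw [span_fourier_closure_eq_top]; trivial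
  obtain ⟨F, hF, hGF⟩ := Metric.mem_closure_iff.1 hGcl (ε / 2) (by positivity)
  refine ⟨_, mem_trigSeq_of_mem_span_fourier (a := a) s hF, ?_⟩
  filter_upwards [eventually_average_fejer_le h hM0, eventually_gt_atTop 0] with N hN hN0
  have hN0' : (0 : ℝ) < N := by exact_mod_cast hN0
  have hpt : ∀ n, ‖unitExp (s * ⌊a n⌋) - unitExp (s * a n) * F (a n : UnitAddCircle)‖ ≤
      fejer M (a n) + ε / 2 := by
    intro n
    have e1 : unitExp (s * ⌊a n⌋) = unitExp (s * a n) * unitExp (-s * Int.fract (a n)) := by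
      rw [← unitExp_add]
      congr 1
      linear_combination s * Int.floor_add_fract (a n)
    have e2 : fejer M (Int.fract (a n)) = fejer M (a n) := fejer_sub_int M (a n) ⌊a n⌋
    rw [e1, ← mul_sub, norm_mul, norm_unitExp, one_mul]
    have h1 : ‖unitExp (-s * Int.fract (a n)) - G (a n : UnitAddCircle)‖ = fejer M (a n) := by
      rw [hGa, hg]
      simp only
      rw [e2, show unitExp (-s * Int.fract (a n)) - unitExp (-s * Int.fract (a n)) *
        ((1 - fejer M (a n) : ℝ) : ℂ) = unitExp (-s * Int.fract (a n)) * (fejer M (a n) : ℂ) by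
          push_cast; ring, norm_mul, norm_unitExp, one_mul, Complex.norm_real,
        Real.norm_of_nonneg (fejer_nonneg M _)]
    have h2 : ‖G (a n : UnitAddCircle) - F (a n : UnitAddCircle)‖ ≤ ε / 2 := by
      have := (ContinuousMap.norm_coe_le_norm (G - F) (a n : UnitAddCircle))
      rw [dist_eq_norm] at hGF
      exact this.trans hGF.le
    have h3 := norm_sub_le_norm_sub_add_norm_sub (unitExp (-s * Int.fract (a n)))
      (G (a n : UnitAddCircle)) (F (a n : UnitAddCircle))
    linarith
  calc _ ≤ (∑ n ∈ Finset.Icc 1 N, (fejer M (a n) + ε / 2)) / (N : ℝ) := by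
        gcongr with n _
        exact hpt n
    _ = (∑ n ∈ Finset.Icc 1 N, fejer M (a n)) / N + ε / 2 := by
        rw [Finset.sum_add_distrib, add_div]
        simp
        field_simp
    _ ≤ ε := by linarith

end MeanApprox

/-! ### Convergence of character means along integer parts -/

lemma exists_periodic_unitExp_aeval (p : Polynomial ℚ) :
    ∃ Q : ℕ, 0 < Q ∧ Function.Periodic (fun n : ℕ => unitExp (Polynomial.aeval (n : ℝ) p)) Q := by
  induction p using Polynomial.induction_on' with
  | add p q hp hq =>
    obtain ⟨Q, hQ, hp⟩ := hp
    obtain ⟨Q', hQ', hq⟩ := hq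
    refine ⟨Q' * Q, Nat.mul_pos hQ' hQ, ?_⟩
    have h1 := hq.nat_mul Q
    rw [Nat.cast_id, mul_comm] at h1
    have h2 := (hp.nat_mul Q').mul h1
    refine fun n => Eq.trans ?_ ((h2 n).trans ?_)
    · simp [unitExp_add]
    · simp [unitExp_add]
  | monomial n c =>
    refine ⟨c.den, c.den_pos, ?_⟩
    have := periodic_unitExp_monomial c n 1
    simpa [Polynomial.aeval_monomial] using this

lemma exists_tendsto_cesaro_unitExp_mul (q : ℝ) :
    ∃ l, Tendsto (cesaro fun n => unitExp (q * n)) atTop (𝓝 l) := by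
  by_cases hq : ∃ k : ℤ, q = k
  · obtain ⟨k, rfl⟩ := hq
    refine ⟨1, (cesaro_const 1).congr fun N => ?_⟩
    congr 1
    ext n
    exact (unitExp_eq_one_iff.2 ⟨k * n, by push_cast; rfl⟩).symm
  · refine ⟨0, tendsto_cesaro_unitExp_of_sub_tendsto (α := q) (fun k hk => hq ⟨k, hk⟩) ?_⟩
    apply tendsto_const_nhds.congr
    intro n
    push_cast
    ring

lemma exists_tendsto_cesaro_of_periodic {χ : ℕ → ℂ} {Q : ℕ} (hQ : 0 < Q)
    (hχ : Function.Periodic χ Q) : ∃ l, Tendsto (cesaro χ) atTop (𝓝 l) := by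
  obtain ⟨c, hc⟩ := exists_fourier_of_periodic hQ hχ
  choose l hl using fun j : ℕ => exists_tendsto_cesaro_unitExp_mul ((j : ℝ) / Q)
  refine ⟨∑ j ∈ Finset.range Q, c j * l j,
    (tendsto_finsetSum _ fun j _ => (hl j).const_mul (c j)).congr fun N => ?_⟩
  simp only [← cesaro_const_mul]
  rw [← cesaro_sum]
  congr 1
  ext n
  exact (hc n).symm

lemma exists_le_of_periodic_of_pos {g : ℕ → ℝ} {Q : ℕ} (hQ : 0 < Q) (hg : Function.Periodic g Q)
    (hpos : ∀ n, 0 < g n) : ∃ ϑ > 0, ∀ n, ϑ ≤ g n := by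
  obtain ⟨m, -, hm⟩ := Finset.exists_min_image (Finset.range Q) g ⟨0, Finset.mem_range.2 hQ⟩
  refine ⟨g m, hpos m, fun n => ?_⟩
  rw [← hg.map_mod_nat n]
  exact hm _ (Finset.mem_range.2 (Nat.mod_lt _ hQ))

namespace IsHardyRing

variable {R : Set (ℝ → ℝ)} (hR : IsHardyRing R) {a : ℝ → ℝ}
include hR

/-- The exponential means of a function which is an almost rational polynomial, or stays
logarithmically away from rational polynomials, converge. -/
lemma exists_tendsto_cesaro_unitExp (ha : a ∈ R) {C : ℝ} {d : ℕ}
    (hgr : ∀ᶠ x in atTop, |a x| ≤ C * x ^ d)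
    (h : IsAlmostRationalPolynomial a ∨ StaysLogAwayFromRatPoly a) :
    ∃ l, Tendsto (cesaro fun n => unitExp (a n)) atTop (𝓝 l) := by
  rcases h with ⟨p, L, hL⟩ | h
  · obtain ⟨Q, hQ, hper⟩ := exists_periodic_unitExp_aeval p
    obtain ⟨l, hl⟩ := exists_tendsto_cesaro_of_periodic hQ hper
    refine ⟨l * unitExp L, tendsto_cesaro_congr
      (v := fun n => unitExp (Polynomial.aeval (n : ℝ) p) * unitExp L) ?_ ?_⟩
    · have h1 : Tendsto (fun n : ℕ => unitExp (a n - Polynomial.aeval (n : ℝ) p) - unitExp L) atTop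
          (𝓝 0) := by
        rw [tendsto_sub_nhds_zero_iff]
        exact (continuous_unitExp.tendsto L).comp (hL.comp tendsto_natCast_atTop_atTop)
      rw [tendsto_zero_iff_norm_tendsto_zero] at h1 ⊢
      refine h1.congr fun n => ?_
      rw [← one_mul ‖unitExp (a n - _) - _‖, ← norm_unitExp (Polynomial.aeval (n : ℝ) p), ← norm_mul,
        mul_sub, ← unitExp_add]
      congr 3
      ring
    · refine (hl.mul_const (unitExp L)).congr fun N => ?_
      rw [mul_comm, ← cesaro_const_mul]
      simp only [mul_comm]
  · exact ⟨0, hR.tendsto_cesaro_unitExp ha (hR.tendsto_iterate_deriv ha hgr)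
      (hR.awayFromRatPoly_of_staysLogAway ha h)⟩

/-- Up to a null sequence, `a n` equals `p n + L`, which is periodic modulo 1. Since `a - p - L` has
an eventual sign, the integer part eventually differs from `p n + L` by a periodic sequence, so the
character is asymptotically a periodic factor times `e(s a n)`. -/
lemma meanApprox_unitExp_floor_of_isAlmostRationalPolynomial (ha : a ∈ R)
    (h : IsAlmostRationalPolynomial a) (s : ℝ) :
    MeanApprox (trigSeq fun n => a n) fun n => unitExp (s * ⌊a n⌋) := by
  obtain ⟨p, L, hL⟩ := h
  obtain ⟨Q, hQ, hper⟩ := exists_periodic_unitExp_aeval p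
  set x : ℕ → ℝ := fun n => Polynomial.aeval (n : ℝ) p + L with hx
  have hxper : ∀ n, ∃ k : ℤ, x (n + Q) = x n + k := by
    intro n
    have h1 := hper n
    simp only at h1
    have h2 : unitExp (Polynomial.aeval ((n + Q : ℕ) : ℝ) p - Polynomial.aeval (n : ℝ) p) = 1 := by
      rw [sub_eq_add_neg, unitExp_add, h1, unitExp_neg, mul_inv_cancel₀ (unitExp_ne_zero _)]
    obtain ⟨k, hk⟩ := unitExp_eq_one_iff.1 h2
    exact ⟨k, by simp only [hx]; linarith⟩
  have hδ : Tendsto (fun n : ℕ => a n - x n) atTop (𝓝 0) := by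
    have := (hL.comp tendsto_natCast_atTop_atTop).sub_const L
    rw [sub_self] at this
    refine this.congr fun n => ?_
    simp only [hx, Function.comp_apply]
    ring
  have key : ∀ θ : ℕ → ℝ, Function.Periodic θ Q → (∀ᶠ n : ℕ in atTop, (⌊a n⌋ : ℝ) = x n - θ n) →
      MeanApprox (trigSeq fun n => a n) fun n => unitExp (s * ⌊a n⌋) := by
    intro θ hθ hfl
    have hχ : Function.Periodic (fun n => unitExp (-s * θ n)) Q := fun n => by
      simp only [hθ n]
    refine MeanApprox.of_tendsto (periodic_mul_unitExp_mem_trigSeq hQ hχ (fun n => a n) s) ?_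
    have h1 : Tendsto (fun n : ℕ => 2 * Real.pi * (|s| * |a n - x n|)) atTop (𝓝 0) := by
      simpa using (hδ.abs.const_mul |s|).const_mul (2 * Real.pi)
    refine squeeze_zero_norm' ?_ h1
    filter_upwards [hfl] with n hn
    rw [hn, show s * (x n - θ n) = -s * θ n + s * x n by ring, unitExp_add, ← mul_sub, norm_mul,
      norm_unitExp, one_mul]
    refine (norm_unitExp_sub_le _ _).trans ?_
    rw [← mul_sub, abs_mul, abs_sub_comm]
  have hmem : (fun y => a y - Polynomial.aeval y p - L) ∈ R :=
    hR.sub (hR.sub ha (hR.aeval_rat p)) (hR.const L)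
  have hsign : (∀ᶠ n : ℕ in atTop, 0 ≤ a n - x n) ∨ ∀ᶠ n : ℕ in atTop, a n - x n < 0 := by
    have e : ∀ n : ℕ, a n - x n = a n - Polynomial.aeval (n : ℝ) p - L := fun n => by
      simp only [hx]; ring
    simp only [e]
    rcases hR.sign hmem with h | h | h
    · exact Or.inl ((tendsto_natCast_atTop_atTop.eventually h).mono fun n hn => hn.ge)
    · exact Or.inl ((tendsto_natCast_atTop_atTop.eventually h).mono fun n hn => hn.le)
    · exact Or.inr (tendsto_natCast_atTop_atTop.eventually h)
  have hper' : Function.Periodic (fun n => Int.fract (x n)) Q := fun n => by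
    obtain ⟨k, hk⟩ := hxper n
    simp only [hk, Int.fract_add_intCast]
  have hper'' : Function.Periodic (fun n => 1 - Int.fract (-x n)) Q := fun n => by
    obtain ⟨k, hk⟩ := hxper n
    simp only [hk, neg_add, ← sub_eq_add_neg, Int.fract_sub_intCast]
  rcases hsign with hs | hs
  -- Approach from above: once the error is below the least gap `1 - fract (x n)`, positive by
  -- periodicity, the integer parts of `a n` and `x n` agree.
  · refine key _ hper' ?_
    obtain ⟨ϑ, hϑ, hle⟩ := exists_le_of_periodic_of_pos hQ
      (g := fun n => 1 - Int.fract (x n)) (fun n => by simp only [hper' n])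
      (fun n => sub_pos.2 (Int.fract_lt_one _))
    filter_upwards [hs, hδ.eventually (gt_mem_nhds hϑ)] with n h1 h2
    have h3 := hle n
    have h4 := Int.fract_nonneg (x n)
    have h5 := Int.floor_add_fract (x n)
    have : ⌊a n⌋ = ⌊x n⌋ := by
      rw [Int.floor_eq_iff]
      constructor <;> linarith
    rw [this]
    linarith
  -- Approach from below: the correction is `1 - fract (-x n)` rather than `fract (x n)`. At an
  -- integral `x n` it equals 1, because there the integer part of `a n` is `x n - 1`.
  · refine key _ hper'' ?_
    obtain ⟨ϑ, hϑ, hle⟩ := exists_le_of_periodic_of_pos hQ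
      (g := fun n => 1 - Int.fract (-x n)) hper''
      (fun n => sub_pos.2 (Int.fract_lt_one _))
    filter_upwards [hs, hδ.eventually (lt_mem_nhds (neg_lt_zero.2 hϑ))] with n h1 h2
    have h3 := hle n
    have h4 := Int.fract_nonneg (-x n)
    have h5 := Int.floor_add_fract (-x n)
    have : ⌊a n⌋ = -⌊-x n⌋ - 1 := by
      rw [Int.floor_eq_iff]
      push_cast
      constructor <;> linarith
    rw [this]
    push_cast
    linarith

/-- In the logarithmic case a nonzero integer multiple stays away as well, since `k a - p = k (a - p
/ k)`; so all nontrivial exponential means vanish and `a n` is equidistributed modulo 1. -/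
lemma meanApprox_unitExp_floor (ha : a ∈ R) {C : ℝ} {d : ℕ}
    (hgr : ∀ᶠ x in atTop, |a x| ≤ C * x ^ d)
    (h : IsAlmostRationalPolynomial a ∨ StaysLogAwayFromRatPoly a) (s : ℝ) :
    MeanApprox (trigSeq fun n => a n) fun n => unitExp (s * ⌊a n⌋) := by
  rcases h with h | h
  · exact hR.meanApprox_unitExp_floor_of_isAlmostRationalPolynomial ha h s
  · refine _root_.meanApprox_unitExp_floor (fun k hk => ?_) s
    have hk' : (k : ℝ) ≠ 0 := by exact_mod_cast hk
    refine hR.tendsto_cesaro_unitExp (b := fun x => k * a x) (k := d) (hR.const_mul ha k)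
      (hR.tendsto_iterate_deriv (hR.const_mul ha k) (C := |(k : ℝ)| * C) ?_)
      (hR.awayFromRatPoly_of_staysLogAway (hR.const_mul ha k) fun p => ?_)
    · filter_upwards [hgr] with x hx
      rw [abs_mul, mul_assoc]
      gcongr
    · have := (h (Polynomial.C (k : ℚ)⁻¹ * p)).const_mul_right hk'
      refine this.congr_right fun x => ?_
      simp only [map_mul, Polynomial.aeval_C]
      rw [mul_sub, ← mul_assoc]
      congr 2
      have : (algebraMap ℚ ℝ) (k : ℚ)⁻¹ = (k : ℝ)⁻¹ := by simp
      rw [this, mul_inv_cancel₀ hk', one_mul]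

/-- The means of the characters of the integer parts of two Hardy functions converge. -/
lemma exists_tendsto_cesaro_unitExp_floor {b : ℝ → ℝ} (ha : a ∈ R) (hb : b ∈ R)
    (hga : ∃ (C : ℝ) (d : ℕ), ∀ᶠ x in atTop, |a x| ≤ C * x ^ d)
    (hgb : ∃ (C : ℝ) (d : ℕ), ∀ᶠ x in atTop, |b x| ≤ C * x ^ d)
    (h : ∀ c d : ℝ, IsAlmostRationalPolynomial (fun x => c * a x - d * b x) ∨
      StaysLogAwayFromRatPoly (fun x => c * a x - d * b x)) (s t : ℝ) :
    ∃ l, Tendsto (cesaro fun n => unitExp (s * ⌊a n⌋) * unitExp (t * ⌊b n⌋)) atTop (𝓝 l) := by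
  obtain ⟨A, p, hA⟩ := hga
  obtain ⟨B, q, hB⟩ := hgb
  -- The coefficients `(1, 0)` here and `(0, -1)` next specialise the hypothesis to the individual
  -- functions.
  have h1 := hR.meanApprox_unitExp_floor ha hA (by simpa using h 1 0) s
  have h2 := hR.meanApprox_unitExp_floor hb hB (by simpa using h 0 (-1)) t
  have h3 := h1.mul h2 (fun n => (norm_unitExp _).le)
    (fun v hv => exists_norm_le_of_mem_trigSeq hv)
    (W := {u | ∃ v ∈ trigSeq fun n => a n, ∃ w ∈ trigSeq fun n => b n, u = fun n => v n * w n})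
    (fun v hv w hw => ⟨v, hv, w, hw, rfl⟩)
  refine h3.exists_tendsto_cesaro ?_
  rintro _ ⟨v, hv, w, hw, rfl⟩
  refine exists_tendsto_cesaro_mul_of_mem_trigSeq (fun q' r r' => ?_) hv hw
  have hmem : (fun x => q' * x + (r * a x + r' * b x)) ∈ R :=
    hR.add (hR.const_mul hR.id _) (hR.add (hR.const_mul ha r) (hR.const_mul hb r'))
  have hX : ∀ (P : Polynomial ℚ) (x : ℝ),
      Polynomial.aeval x (P + Polynomial.C q' * Polynomial.X) = Polynomial.aeval x P + q' * x := by
    intro P x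
    simp
  have hX' : ∀ (P : Polynomial ℚ) (x : ℝ),
      Polynomial.aeval x (P - Polynomial.C q' * Polynomial.X) = Polynomial.aeval x P - q' * x := by
    intro P x
    simp
  refine hR.exists_tendsto_cesaro_unitExp (a := fun x => q' * x + (r * a x + r' * b x)) hmem
    (C := |(q' : ℝ)| + (|r| * |A| + |r'| * |B|)) (d := 1 + p + q) ?_ ?_
  · filter_upwards [hA, hB, eventually_ge_atTop 1] with x e1 e2 hx
    have hx0 : 0 ≤ x := by linarith
    have m1 : x ≤ x ^ (1 + p + q) := le_self_pow₀ hx (by omega)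
    have m2 : x ^ p ≤ x ^ (1 + p + q) := pow_le_pow_right₀ hx (by omega)
    have m3 : x ^ q ≤ x ^ (1 + p + q) := pow_le_pow_right₀ hx (by omega)
    have n1 : |a x| ≤ |A| * x ^ (1 + p + q) := e1.trans
      (mul_le_mul (le_abs_self A) m2 (by positivity) (abs_nonneg A))
    have n2 : |b x| ≤ |B| * x ^ (1 + p + q) := e2.trans
      (mul_le_mul (le_abs_self B) m3 (by positivity) (abs_nonneg B))
    refine (abs_add_le _ _).trans ?_
    rw [add_mul, add_mul, mul_assoc, mul_assoc]
    refine add_le_add ?_ ((abs_add_le _ _).trans (add_le_add ?_ ?_))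
    · rw [abs_mul, abs_of_nonneg hx0]
      gcongr
    · rw [abs_mul]
      gcongr
    · rw [abs_mul]
      gcongr
  -- The linear term `q' x` is a rational polynomial, so it is absorbed in the polynomial of either
  -- alternative.
  · have e : ∀ x, r * a x + r' * b x = r * a x - (-r') * b x := fun x => by ring
    rcases h r (-r') with ⟨P, L, hL⟩ | hlog
    · left
      refine ⟨P + Polynomial.C q' * Polynomial.X, L, hL.congr fun x => ?_⟩
      rw [hX]
      ring
    · right
      intro P
      refine (hlog (P - Polynomial.C q' * Polynomial.X)).congr_right fun x => ?_
      rw [hX']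
      ring

end IsHardyRing

/-! ### Ergodicity of differences -/

section CommutingUnitaries

variable {E : Type*} [NormedAddCommGroup E] [InnerProductSpace ℂ E] [CompleteSpace E]

/-- Averages along two commuting unitary operators converge as soon as the corresponding averages
of characters do. -/
lemma exists_tendsto_average_of_commute {U V : E ≃ₗᵢ[ℂ] E} (hUV : Commute U V) (f : E)
    (k l : ℕ → ℤ) (h : ∀ z w : UnitAddCircle,
      ∃ L, Tendsto (cesaro fun n => fourier (k n) z * fourier (l n) w) atTop (𝓝 L)) :
    ∃ g, Tendsto (fun N : ℕ => (1 / (N : ℂ)) • ∑ n ∈ Finset.Icc 1 N, (V ^ l n) ((U ^ k n) f)) atTop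
      (𝓝 g) := by
  -- Commutation makes the two-parameter family of vectors an orbit of unitaries, hence stationary,
  -- so it has a spectral measure on the torus.
  have hstat : ∀ m n t : Fin 2 → ℤ,
      inner ℂ ((V ^ (m + t) 1) ((U ^ (m + t) 0) f)) ((V ^ (n + t) 1) ((U ^ (n + t) 0) f)) =
      inner ℂ ((V ^ m 1) ((U ^ m 0) f)) ((V ^ n 1) ((U ^ n 0) f)) := by
    intro m n t
    have h1 : ∀ m : Fin 2 → ℤ, (V ^ (m + t) 1) ((U ^ (m + t) 0) f) =
        (V ^ t 1) ((U ^ t 0) ((V ^ m 1) ((U ^ m 0) f))) := by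
      intro m
      have h2 : V ^ (m + t) 1 * U ^ (m + t) 0 = V ^ t 1 * (U ^ t 0 * (V ^ m 1 * U ^ m 0)) := by
        rw [Pi.add_apply, Pi.add_apply, add_comm (m 1), add_comm (m 0), zpow_add, zpow_add,
          ← mul_assoc (U ^ t 0), (hUV.zpow_zpow (t 0) (m 1)).eq]
        group
      exact congrArg (fun W : E ≃ₗᵢ[ℂ] E => W f) h2
    rw [h1, h1, LinearIsometryEquiv.inner_map_map, LinearIsometryEquiv.inner_map_map]
  obtain ⟨σ, hσfin, hσ⟩ := exists_spectralMeasure (d := Fin 2)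
    (V := fun m => (V ^ m 1) ((U ^ m 0) f)) hstat
  set A : ℕ → UnitAddTorus (Fin 2) → ℂ :=
    fun N z => cesaro (fun n => fourier (k n) (z 0) * fourier (l n) (z 1)) N with hA
  have hAc : ∀ N, Continuous (A N) := fun N => continuous_const.mul
    (continuous_finsetSum _ fun n _ => Continuous.fun_mul ((map_continuous (fourier (k n))).comp
      (continuous_apply 0)) ((map_continuous (fourier (l n))).comp (continuous_apply 1)))
  have hA1 : ∀ N z, ‖A N z‖ ≤ 1 := fun N z => norm_cesaro_le zero_le_one
    (fun n => by rw [norm_mul, norm_fourier, norm_fourier, one_mul]) N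
  set x : ℕ → E := fun N => (1 / (N : ℂ)) • ∑ n ∈ Finset.Icc 1 N, (V ^ l n) ((U ^ k n) f) with hx
  -- The difference of two averages is one finite combination, indexed by a disjoint union, so the
  -- spectral isometry applies to it. Pointwise convergence of the character means then gives the
  -- Cauchy property by dominated convergence.
  have hdist : ∀ N M, ‖x N - x M‖ ^ 2 = ∫ z, ‖A N z - A M z‖ ^ 2 ∂σ := by
    intro N M
    have h1 := norm_sq_sum_eq_integral hσ ((Finset.Icc 1 N).disjSum (Finset.Icc 1 M))
      (Sum.elim (fun _ => 1 / (N : ℂ)) fun _ => -(1 / (M : ℂ)))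
      (Sum.elim (fun n => ![k n, l n]) fun n => ![k n, l n])
    simp only [Finset.sum_disjSum, Sum.elim_inl, Sum.elim_inr, neg_smul, neg_mul,
      Finset.sum_neg_distrib, ← sub_eq_add_neg, ← Finset.smul_sum, ← Finset.mul_sum,
      UnitAddTorus.mFourier, ContinuousMap.coe_mk, Fin.prod_univ_two, Matrix.cons_val_zero,
      Matrix.cons_val_one] at h1
    exact h1
  refine cauchySeq_tendsto_of_complete ?_
  rw [cauchySeq_iff_tendsto_dist_atTop_0]
  have hlim : Tendsto (fun p : ℕ × ℕ => ∫ z, ‖A p.1 z - A p.2 z‖ ^ 2 ∂σ) atTop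
      (𝓝 (∫ _, (0 : ℝ) ∂σ)) := by
    refine tendsto_integral_filter_of_dominated_convergence (fun _ => 4) ?_ ?_
      (integrable_const _) ?_
    · exact Eventually.of_forall fun p =>
        (((hAc p.1).sub (hAc p.2)).norm.pow 2).aestronglyMeasurable
    · refine Eventually.of_forall fun p => Eventually.of_forall fun z => ?_
      rw [norm_pow, norm_norm]
      have := (norm_sub_le (A p.1 z) (A p.2 z)).trans (add_le_add (hA1 p.1 z) (hA1 p.2 z))
      nlinarith [norm_nonneg (A p.1 z - A p.2 z)]
    · refine Eventually.of_forall fun z => ?_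
      obtain ⟨L, hL⟩ := h (z 0) (z 1)
      have h1 : Tendsto (fun p : ℕ × ℕ => A p.1 z - A p.2 z) atTop (𝓝 (L - L)) := by
        rw [← prod_atTop_atTop_eq]
        exact (hL.comp tendsto_fst).sub (hL.comp tendsto_snd)
      simpa using h1.norm.pow 2
  rw [integral_zero] at hlim
  have h2 := hlim.sqrt
  rw [Real.sqrt_zero] at h2
  refine h2.congr fun p => ?_
  rw [← hdist, Real.sqrt_sq (norm_nonneg _), dist_eq_norm]

end CommutingUnitaries

/-! ### Difference ergodicity -/

section DifferenceErgodicity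

variable {X : Type*} [MeasurableSpace X] {μ : Measure X}

lemma commute_koopmanEquiv {T T' : X ≃ᵐ X} (hT : MeasurePreserving T μ μ)
    (hT' : MeasurePreserving T' μ μ) (h : ∀ᵐ x ∂μ, T (T' x) = T' (T x)) :
    Commute (koopmanEquiv T hT) (koopmanEquiv T' hT') := by
  refine LinearIsometryEquiv.ext fun v => Lp.ext ?_
  have h1 : koopmanEquiv T hT (koopmanEquiv T' hT' v) =ᵐ[μ] fun x => v (T' (T x)) := by
    filter_upwards [koopmanEquiv_coeFn hT (koopmanEquiv T' hT' v),
      hT.quasiMeasurePreserving.ae (koopmanEquiv_coeFn hT' v)] with x h1 h2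
    rw [h1, Function.comp_apply, h2, Function.comp_apply]
  have h2 : koopmanEquiv T' hT' (koopmanEquiv T hT v) =ᵐ[μ] fun x => v (T (T' x)) := by
    filter_upwards [koopmanEquiv_coeFn hT' (koopmanEquiv T hT v),
      hT'.quasiMeasurePreserving.ae (koopmanEquiv_coeFn hT v)] with x h1 h2
    rw [h1, Function.comp_apply, h2, Function.comp_apply]
  refine EventuallyEq.trans h1 (EventuallyEq.trans ?_ h2.symm)
  filter_upwards [h] with x hx
  rw [hx]

lemma koopman_iterZ_comp {T T' : X ≃ᵐ X} (hT : MeasurePreserving T μ μ)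
    (hT' : MeasurePreserving T' μ μ) (k l : ℤ) (v : Lp ℂ 2 μ) :
    koopman (iterZ T k ∘ iterZ T' l)
      ((measurePreserving_iterZ hT k).comp (measurePreserving_iterZ hT' l)) v =
      (koopmanEquiv T' hT' ^ l) ((koopmanEquiv T hT ^ k) v) := by
  rw [koopmanEquiv_zpow_apply, koopmanEquiv_zpow_apply]
  refine Lp.ext ?_
  filter_upwards [koopman_coeFn ((measurePreserving_iterZ hT k).comp
      (measurePreserving_iterZ hT' l)) v, koopman_coeFn (measurePreserving_iterZ hT' l)
      (koopman (iterZ T k) (measurePreserving_iterZ hT k) v),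
    (measurePreserving_iterZ hT' l).quasiMeasurePreserving.ae
      (koopman_coeFn (measurePreserving_iterZ hT k) v)] with x h1 h2 h3
  rw [h1, h2]
  exact h3.symm

variable [IsProbabilityMeasure μ] {ℓ : ℕ} {T : Fin ℓ → X ≃ᵐ X}

lemma eq_of_forall_inner_eq {v w : Lp ℂ 2 μ}
    (h : ∀ s (hs : MeasurableSet s), inner ℂ (indLp μ hs) v = inner ℂ (indLp μ hs) w) : v = w := by
  rw [← sub_eq_zero]
  refine (Lp.eq_zero_iff_ae_eq_zero).2 ?_
  have hint : Integrable (v - w : Lp ℂ 2 μ) μ := (Lp.memLp (v - w)).integrable (by norm_num)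
  refine Lp.ae_eq_zero_of_forall_setIntegral_eq_zero _ two_ne_zero (by simp)
    (fun s _ _ => hint.integrableOn) fun s hs _ => ?_
  rw [← L2.inner_indicatorConstLp_one hs (measure_ne_top μ s)]
  have := h s hs
  rw [← sub_eq_zero, ← inner_sub_right] at this
  exact this

/-- Joint ergodicity is applied with `f` and `g` in two slots and 1 in all others; convergence in
`L²` on a probability space allows integration. -/
lemma JointlyErgodic.tendsto_integral_mul {b : Fin ℓ → ℕ → ℝ} (hj : JointlyErgodic μ T b)
    (hT : ∀ j, MeasurePreserving (T j) μ μ) {i j : Fin ℓ} (hij : i ≠ j) {f g : X → ℂ}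
    (hf : MemLp f ∞ μ) (hg : MemLp g ∞ μ) :
    Tendsto (cesaro fun n => ∫ x, f (iterZ (T i) ⌊b i n⌋ x) * g (iterZ (T j) ⌊b j n⌋ x) ∂μ) atTop
      (𝓝 ((∫ x, f x ∂μ) * ∫ x, g x ∂μ)) := by
  set F : Fin ℓ → X → ℂ := fun m => if m = i then f else if m = j then g else fun _ => 1 with hF
  have hFi : F i = f := by simp [hF]
  have hFj : F j = g := by simp [hF, hij.symm]
  have hFo : ∀ m, m ≠ i ∧ m ≠ j → F m = fun _ => 1 := fun m hm => by simp [hF, hm.1, hm.2]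
  have h := hj F (fun m => by
    by_cases hm : m = i
    · rw [hm, hFi]; exact hf
    by_cases hm' : m = j
    · rw [hm', hFj]; exact hg
    rw [hFo m ⟨hm, hm'⟩]
    exact memLp_const 1)
  have h1 : ∀ y : Fin ℓ → X, ∏ m, F m (y m) = f (y i) * g (y j) := fun y => by
    rw [Fintype.prod_eq_mul i j hij fun m hm => by rw [hFo m hm], hFi, hFj]
  have h2 : ∏ m, ∫ x, F m x ∂μ = (∫ x, f x ∂μ) * ∫ x, g x ∂μ := by
    rw [Fintype.prod_eq_mul i j hij fun m hm => by rw [hFo m hm]; simp, hFi, hFj]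
  have h3 : ∀ n x, ∏ m, F m (iterZ (T m) ⌊b m n⌋ x) =
      f (iterZ (T i) ⌊b i n⌋ x) * g (iterZ (T j) ⌊b j n⌋ x) := fun n x =>
    h1 fun m => iterZ (T m) ⌊b m n⌋ x
  simp only [h2, h3] at h
  have hint : ∀ n : ℕ, MemLp (fun x => f (iterZ (T i) ⌊b i n⌋ x) * g (iterZ (T j) ⌊b j n⌋ x)) 2 μ :=
    fun n => ((hg.comp_measurePreserving (measurePreserving_iterZ (hT j) ⌊b j n⌋)).mul
      (hf.comp_measurePreserving (measurePreserving_iterZ (hT i) ⌊b i n⌋)) :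
        MemLp _ ∞ μ).mono_exponent le_top
  have hsum : ∀ N : ℕ, MemLp (fun x => (1 / (N : ℂ)) * ∑ n ∈ Finset.Icc 1 N,
      f (iterZ (T i) ⌊b i n⌋ x) * g (iterZ (T j) ⌊b j n⌋ x)) 2 μ := fun N =>
    (memLp_finsetSum _ fun n _ => hint n).const_mul _
  have h4 := tendsto_integral_of_L1' (μ := μ) (fun _ => (∫ x, f x ∂μ) * ∫ x, g x ∂μ)
    aestronglyMeasurable_const (Eventually.of_forall fun N => (hsum N).integrable (by norm_num))
    (tendsto_of_tendsto_of_tendsto_of_le_of_le tendsto_const_nhds h (fun _ => zero_le)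
      fun N => eLpNorm_le_eLpNorm_of_exponent_le (by norm_num)
        ((hsum N).aestronglyMeasurable.sub aestronglyMeasurable_const))
  rw [integral_const, probReal_univ, one_smul] at h4
  refine h4.congr fun N => ?_
  rw [integral_const_mul, integral_finsetSum _ fun n _ => (hint n).integrable (by norm_num)]
  rfl

/-- The difference ergodicity condition. -/
theorem JointlyErgodic.differenceErgodic {R : Set (ℝ → ℝ)} (hR : IsHardyRing R)
    {a : Fin ℓ → ℝ → ℝ} (ha : ∀ j, a j ∈ R)
    (hgr : ∀ j, ∃ (C : ℝ) (d : ℕ), ∀ᶠ x in atTop, |a j x| ≤ C * x ^ d)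
    (hT : ∀ j, MeasurePreserving (T j) μ μ) (hTcomm : ∀ i j, ∀ᵐ x ∂μ, T i (T j x) = T j (T i x))
    (hjoint : JointlyErgodic μ T fun j n => a j n)
    (h : ∀ i j : Fin ℓ, i ≠ j → ∀ c d : ℝ,
      IsAlmostRationalPolynomial (fun x => c * a i x - d * a j x) ∨
      StaysLogAwayFromRatPoly (fun x => c * a i x - d * a j x)) :
    DifferenceErgodic μ T fun j n => a j n := by
  intro i j hij
  have hS : ∀ n : ℕ, MeasurePreserving (iterZ (T i) ⌊a i n⌋ ∘ iterZ (T j) (-⌊a j n⌋)) μ μ :=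
    fun n => (measurePreserving_iterZ (hT i) _).comp (measurePreserving_iterZ (hT j) _)
  refine (ergodicSeq_iff hS).2 fun f hf => ?_
  have hf2 : MemLp f 2 μ := hf.mono_exponent le_top
  set v : Lp ℂ 2 μ := hf2.toLp f with hv
  -- Norm convergence is obtained first, with an unknown limit; the limit is then identified weakly.
  obtain ⟨y, hy⟩ := exists_tendsto_average_of_commute
    (commute_koopmanEquiv (hT i) (hT j) (hTcomm i j)) v (fun n => ⌊a i n⌋) (fun n => -⌊a j n⌋) (by
      intro z w
      obtain ⟨s, rfl⟩ := QuotientAddGroup.mk_surjective z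
      obtain ⟨t, rfl⟩ := QuotientAddGroup.mk_surjective w
      obtain ⟨L, hL⟩ := hR.exists_tendsto_cesaro_unitExp_floor (ha i) (ha j) (hgr i) (hgr j)
        (h i j hij) s (-t)
      refine ⟨L, hL.congr fun N => ?_⟩
      congr 1
      ext n
      refine congrArg₂ (· * ·) ?_ ?_
      · refine Eq.trans ?_ (fourier_coe_eq_unitExp _ s).symm
        rw [mul_comm]
      · refine Eq.trans ?_ (fourier_coe_eq_unitExp _ t).symm
        push_cast
        rw [mul_comm, mul_neg, neg_mul])
  have hy' : Tendsto (fun N => koopmanAvg (fun n : ℕ => iterZ (T i) ⌊a i n⌋ ∘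
      iterZ (T j) (-⌊a j n⌋)) hS N v) atTop (𝓝 y) := by
    refine hy.congr fun N => ?_
    rw [koopmanAvg_apply]
    congr 1
    exact Finset.sum_congr rfl fun n _ => (koopman_iterZ_comp (hT i) (hT j) _ _ v).symm
  suffices y = meanProj μ v by rwa [this] at hy'
  refine eq_of_forall_inner_eq fun s hs => ?_
  have hgm : MemLp (s.indicator fun _ => (1 : ℂ)) ∞ μ := memLp_indicator_const _ hs _
    (Or.inr (measure_ne_top _ _))
  set g : X → ℂ := s.indicator fun _ => (1 : ℂ) with hg
  have hg2 : MemLp g 2 μ := hgm.mono_exponent le_top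
  have hgs : ∀ x, (starRingEnd ℂ) (g x) = g x := fun x => by
    by_cases hx : x ∈ s <;> simp [hg, hx]
  have hind : indLp μ hs = hg2.toLp g := rfl
  have hlim := hjoint.tendsto_integral_mul hT hij hf hgm
  refine tendsto_nhds_unique ((innerSL ℂ (indLp μ hs)).continuous.tendsto _ |>.comp hy) ?_
  have hval : inner ℂ (indLp μ hs) (meanProj μ v) = (∫ x, f x ∂μ) * ∫ x, g x ∂μ := by
    rw [meanProj_apply, inner_smul_right, hv, inner_oneLp_toLp, ← inner_conj_symm, hind,
      inner_oneLp_toLp, ← integral_conj]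
    simp only [hgs]
  rw [hval]
  refine hlim.congr fun N => ?_
  rw [Function.comp_apply, innerSL_apply_apply, inner_smul_right, inner_sum, cesaro]
  congr 1
  refine Finset.sum_congr rfl fun n _ => ?_
  -- Unitarity moves the inverse power of `T j` onto the indicator, turning the difference average
  -- into a two-function average covered by joint ergodicity.
  have h1 : inner ℂ (indLp μ hs) ((koopmanEquiv (T j) (hT j) ^ (-⌊a j n⌋))
      ((koopmanEquiv (T i) (hT i) ^ ⌊a i n⌋) v)) =
      inner ℂ ((koopmanEquiv (T j) (hT j) ^ ⌊a j n⌋) (indLp μ hs))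
        ((koopmanEquiv (T i) (hT i) ^ ⌊a i n⌋) v) := by
    rw [← (koopmanEquiv (T j) (hT j) ^ ⌊a j n⌋).inner_map_map (indLp μ hs), zpow_neg]
    congr 1
    exact (koopmanEquiv (T j) (hT j) ^ ⌊a j n⌋).apply_symm_apply _
  rw [h1, koopmanEquiv_zpow_apply, koopmanEquiv_zpow_apply, hind, hv, koopman_toLp, koopman_toLp,
    inner_toLp_toLp]
  refine integral_congr_ae (Eventually.of_forall fun x => ?_)
  simp only [Function.comp_apply, hgs]
  ring

end DifferenceErgodicity

/-! ### The theorem -/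

theorem theorem1p6
    (H : Subring (Germ (atTop : Filter ℝ) ℝ)) (hH : IsHardyField H)
    (hcomp : ClosedUnderComp H) (hinv : ClosedUnderCompInv H)
    {ℓ : ℕ} (a : Fin ℓ → ℝ → ℝ) (ha : ∀ j, IsHardyPolyGrowth H (a j))
    {X : Type*} [MeasurableSpace X] (μ : Measure X) [IsProbabilityMeasure μ]
    (T : Fin ℓ → X ≃ᵐ X) (hT : ∀ j, MeasurePreserving (T j) μ μ)
    (hTcomm : ∀ i j, ∀ᵐ x ∂μ, T i (T j x) = T j (T i x))
    (hjoint : JointlyErgodic μ T fun j n => a j n) :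
    (ProductErgodic μ T fun j n => a j n) ∧
    ((∀ i j : Fin ℓ, i ≠ j → ∀ c d : ℝ,
        IsAlmostRationalPolynomial (fun x => c * a i x - d * a j x) ∨
        StaysLogAwayFromRatPoly (fun x => c * a i x - d * a j x)) →
      DifferenceErgodic μ T fun j n => a j n) := by
  obtain ⟨R, hR, hHR⟩ := exists_isHardyRing hH hcomp hinv
  have haR : ∀ j, a j ∈ R := fun j => hHR _ (ha j).1
  have hgr : ∀ j, ∃ (C : ℝ) (d : ℕ), ∀ᶠ x in atTop, |a j x| ≤ C * x ^ d := fun j => by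
    obtain ⟨d, -, hd⟩ := (ha j).2
    exact exists_pow_bound_of_isBigO_rpow hd
  refine ⟨hjoint.productErgodic hR haR hgr hT, fun h =>
    hjoint.differenceErgodic hR haR hgr hT hTcomm h⟩
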